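/- Let $\overline{\mathbb R}=\mathbb R\cup\{\infty\}\subset\overline{\mathbb C}$, let $E\subset\overline{\mathbb R}$ be compact with infinitely many points, $E\ne\overline{\mathbb R}$, let $D\ge 0$ be an integral divisor of degree $n$ with support in $\overline{\mathbb R}\setminus E$, and let $x_*\in\overline{\mathbb R}\setminus E$; put $d_n=D(x_*)$. Let $r(z,c)=1/(c-z)$ for $c\in\mathbb R$ and $r(z,\infty)=z$. For a rational function $F$ write $(F)_\infty(c)\ge 0$ for the order of its pole at $c\in\overline{\mathbb C}$ ($0$ if there is no pole), and let $\mathcal L(D)=\{F \text{ rational}: (F)_\infty\le D\}$. Let $F_n\in\mathcal L(D)$, $\|F_n\|_E:=\sup_E|F_n|\le 1$, be an extremal function, i.e. a maximizer of $$\operatorname{Re}\lim_{x\to x_*}\frac{F(x)}{r(x,x_*)^{d_n}}\qquad\text{over all } F\in\mathcal L(D),\ \|F\|_E\le 1,$$ and assume that $F_n$ is not constant. Put $E_n=\{z\in\overline{\mathbb C}: F_n(z)\in[-1,1]\}$ and $\Omega_n=\overline{\mathbb C}\setminus E_n$. For a pole $c$ of $F_n$ let $G_{E_n}(\cdot,c)$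 be the Green function of $\Omega_n$ with pole at $c$ (harmonic on $\Omega_n\setminus\{c\}$, equal to $-\log|w|$ plus a harmonic function near $c$ in a local coordinate $w$ centred at $c$, and with boundary values $0$ on $\partial\Omega_n$). Let $B_{E_n}(\cdot,c)=e^{-G_{E_n}(\cdot,c)-i\widetilde{G_{E_n}(\cdot,c)}}$ be the associated complex Green function, where $\widetilde{\ \cdot\ }$ denotes a harmonic conjugate; it is defined locally (and extended analytically by $0$ to $c$) and continued analytically along paths in $\Omega_n$ as an a priori multivalued function. Let $$B_n(z)=e^{i\phi_n}\prod_{c}B_{E_n}(z,c)^{(F_n)_\infty(c)},$$ where all factors are continued along the same path from $x_*$ to $z$ in $\Omega_n$ and the constant phase $\phi_n\in\mathbb R$ is normalized by $$\lim_{x\to x_*}B_n(x)\,r(x,x_*)^{d_n}>0 .$$ Then $B_n$ is a single-valued analytic function on $\overline{\mathbb C}\setminus E_n$, and for all $z\in\overline{\mathbb C}\setminus E_n$ $$F_n(z)=\frac12\Big(B_n(z)+\frac1{B_n(z)}\Big),$$ where both sides equal $\infty$ at the zeros of $B_n$. -/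

import Mathlib

open Filter Topology OnePoint

noncomputable section

/-- The Riemann sphere. -/
abbrev RSphere : Type := OnePoint ℂ

/-- The extended real line, as a subset of the Riemann sphere. -/
def extendedReals : Set RSphere := Set.range (OnePoint.map (fun x : ℝ => (x : ℂ)))

/-- The affine coordinate of a finite point of the sphere (junk value `0` at `∞`). -/
def affineCoord : RSphere → ℂ
  | ∞ => 0
  | (z : ℂ) => z

/-- The standard holomorphic parametrisation of a neighbourhood of `p`, centred at `p`:
`w ↦ z + w` for a finite point `p = z`, and `w ↦ 1 / w` (with `0 ↦ ∞`) for `p = ∞`. -/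
def sphereParam : RSphere → ℂ → RSphere
  | ∞ => fun w => if w = 0 then ∞ else ((w⁻¹ : ℂ) : RSphere)
  | (z : ℂ) => fun w => ((z + w : ℂ) : RSphere)

/-- Analyticity, at a point of the sphere, of a complex-valued function defined near it. -/
def SphereAnalyticAt (f : RSphere → ℂ) (p : RSphere) : Prop :=
  AnalyticAt ℂ (fun w => f (sphereParam p w)) 0

/-- Harmonicity, at a point of the sphere, of a real-valued function defined near it. -/
def SphereHarmonicAt (g : RSphere → ℝ) (p : RSphere) : Prop :=
  InnerProductSpace.HarmonicAt (fun w : ℂ => g (sphereParam p w)) 0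

/-! ### Meromorphic functions on the sphere, that is, rational functions -/

/-- The value of a rational function at a point of the sphere. -/
def ratValue (F : RatFunc ℂ) : RSphere → RSphere
  | ∞ => if F.denom.natDegree < F.num.natDegree then ∞
      else ((F.num.coeff F.denom.natDegree / F.denom.leadingCoeff : ℂ) : RSphere)
  | (z : ℂ) => if F.denom.eval z = 0 then ∞
      else ((F.num.eval z / F.denom.eval z : ℂ) : RSphere)

/-- The polar divisor `(F)_∞`: the order of the pole of `F` at a point, and `0` where `F` has no
pole. (The subtraction is truncated on purpose.) -/
def polarDivisor (F : RatFunc ℂ) : RSphere → ℕ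
  | ∞ => F.num.natDegree - F.denom.natDegree
  | (z : ℂ) => F.denom.rootMultiplicity z

/-- The space `ℒ(D)` of an integral divisor `D`. -/
def divisorSpace (D : RSphere →₀ ℕ) : Set (RatFunc ℂ) :=
  {F | ∀ c, polarDivisor F c ≤ D c}

/-- `‖F‖_E ≤ 1` for the supremum norm on `E`. -/
def SupNormLeOne (E : Set RSphere) (F : RatFunc ℂ) : Prop :=
  ∀ x ∈ E, ∃ w : ℂ, ratValue F x = (w : RSphere) ∧ ‖w‖ ≤ 1

/-- `r(z, c) = 1 / (c - z)` for finite `c`, so that `r(∞, c) = 0`, and `r(z, ∞) = z`. It is only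
used for `z ≠ c` (at `z = c`, where `r` has its pole, the value is junk). -/
def rKernel (z : RSphere) : RSphere → ℂ
  | ∞ => affineCoord z
  | (c : ℂ) => match z with
    | ∞ => 0
    | (z' : ℂ) => 1 / (c - z')

/-- `lim_{x → x_*} F(x) / r(x, x_*) ^ D(x_*) = l`. -/
def HasLeadingValue (D : RSphere →₀ ℕ) (xs : RSphere) (F : RatFunc ℂ) (l : ℂ) : Prop :=
  Tendsto (fun x => affineCoord (ratValue F x) / rKernel x xs ^ D xs) (𝓝[≠] xs) (𝓝 l)

/-- `F` is an extremal function: it is admissible (`F ∈ ℒ(D)` and `‖F‖_E ≤ 1`) and among all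
admissible functions it maximises the real part of `lim_{x → x_*} F(x) / r(x, x_*) ^ D(x_*)`. -/
def IsExtremalFunction (E : Set RSphere) (D : RSphere →₀ ℕ) (xs : RSphere) (F : RatFunc ℂ) :
    Prop :=
  F ∈ divisorSpace D ∧ SupNormLeOne E F ∧
    ∃ l : ℂ, HasLeadingValue D xs F l ∧
      IsGreatest {t : ℝ | ∃ H ∈ divisorSpace D, SupNormLeOne E H ∧
        ∃ m : ℂ, HasLeadingValue D xs H m ∧ t = m.re} l.re

/-- The extension `F⁻¹([-1, 1])` of `E`. -/
def extensionSet (F : RatFunc ℂ) : Set RSphere :=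
  {z | ∃ t : ℝ, t ∈ Set.Icc (-1) 1 ∧ ratValue F z = ((t : ℂ) : RSphere)}

/-! ### Green functions and complex Green functions -/

/-- `g` is the (classical) Green function, with pole `c ∈ Ω`, of an open subset `Ω` of the sphere
that is regular for the Dirichlet problem: it is harmonic on `Ω ∖ {c}`, it differs from `-log|w|`
by a harmonic function near `c`, where `w` is a local coordinate centred at `c`, and it vanishes at
the boundary of `Ω`. Only the values on `Ω ∖ {c}` matter. -/
structure IsGreenFunction (Ω : Set RSphere) (c : RSphere) (g : RSphere → ℝ) : Prop where
  harmonic : ∀ z ∈ Ω, z ≠ c → SphereHarmonicAt g z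
  log_pole : ∃ h : ℂ → ℝ, InnerProductSpace.HarmonicAt h 0 ∧
    ∀ᶠ w in 𝓝[≠] (0 : ℂ), g (sphereParam c w) = -Real.log ‖w‖ + h w
  boundary : ∀ ζ ∈ frontier Ω, Tendsto g (𝓝[Ω] ζ) (𝓝 0)

open Classical in
/-- The Green function `G_K(z, c)` of the complement of `K` with pole `c` (junk value `0` if there
is none). -/
def greenFunction (K : Set RSphere) (c : RSphere) : RSphere → ℝ :=
  if h : ∃ g, IsGreenFunction Kᶜ c g then Classical.choose h else 0

/-- `b` is, near `p`, a branch of the complex Green function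
`B_K(z, c) = exp (-G_K(z, c) - i * G̃_K(z, c))`: it is analytic at `p`, and near every point `q ≠ c`
close to `p` it equals `exp (-(G + i v))`, where `G = G_K(·, c)` and `v` is a harmonic conjugate of
`G` near `q`, i.e. `G + i v` is analytic there. -/
def IsComplexGreenBranchAt (K : Set RSphere) (c p : RSphere) (b : RSphere → ℂ) : Prop :=
  SphereAnalyticAt b p ∧ ∀ᶠ q in 𝓝 p, q ≠ c →
    ∃ v : RSphere → ℝ,
      SphereAnalyticAt (fun z => (greenFunction K c z : ℂ) + Complex.I * (v z : ℂ)) q ∧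
      ∀ᶠ z in 𝓝 q, b z = Complex.exp (-((greenFunction K c z : ℂ) + Complex.I * (v z : ℂ)))

/-- `f t`, `t ∈ [0, 1]`, is an analytic continuation along the path `γ` of a branch of the complex
Green function `B_K(·, c)`: every `f t` is a branch near `γ t`, and `f s` and `f t` agree near `γ s`
whenever `s` is close to `t`. -/
structure IsComplexGreenContinuation (K : Set RSphere) (c : RSphere) {x y : RSphere}
    (γ : Path x y) (f : unitInterval → RSphere → ℂ) : Prop where
  branch : ∀ t, IsComplexGreenBranchAt K c (γ t) (f t)
  compatible : ∀ t, ∀ᶠ s in 𝓝 t, f s =ᶠ[𝓝 (γ s)] f t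

/-- The multivalued function
`B_n(z) = e^{iφ} ∏_c B_{E_n}(z, c) ^ (F)_∞(c)`, with `E_n = F⁻¹([-1, 1])`,
normalised by `lim_{x → x_*} B_n(x) r(x, x_*) ^ D(x_*) > 0`: the number `w` is one of its values at
`z`. That is, branches of the factors near `x_*` are chosen, and a unimodular factor `u = e^{iφ}`
for which their product satisfies the normalisation; all of them are continued analytically along
one path from `x_*` to `z` in the complement of `E_n`; and `w` is the value of the product at the
end point. -/
def IsGreenProductValue (D : RSphere →₀ ℕ) (xs : RSphere) (F : RatFunc ℂ) (z : RSphere) (w : ℂ) :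
    Prop :=
  ∃ γ : Path xs z, (∀ t, γ t ∈ (extensionSet F)ᶜ) ∧
    ∃ f : RSphere → unitInterval → RSphere → ℂ,
      (∀ c, 0 < polarDivisor F c → IsComplexGreenContinuation (extensionSet F) c γ (f c)) ∧
      ∃ u : ℂ, ‖u‖ = 1 ∧
        (∃ l : ℝ, 0 < l ∧
          Tendsto (fun x => (u * ∏ᶠ c, f c 0 x ^ polarDivisor F c) * rKernel x xs ^ D xs)
            (𝓝[≠] xs) (𝓝 (l : ℂ))) ∧
        w = u * ∏ᶠ c, f c 1 z ^ polarDivisor F c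

/-- The Joukowsky map `w ↦ (w + 1 / w) / 2`, with `0 ↦ ∞`. -/
def joukowsky (w : ℂ) : RSphere :=
  if w = 0 then ∞ else (((1 / 2 : ℂ) * (w + 1 / w) : ℂ) : RSphere)

end

/-!
Let `K = F⁻¹([-1, 1])` and `Ω = Kᶜ`. Composing `F` with the inverse of the Joukowsky map that takes
values in the unit disc gives a single-valued analytic function `B` on `Ω` with
`F = (B + 1 / B) / 2`; it exists without any assumption on `F`, since `s / (1 + √(1 - s²))`, with
`s = 1 / F`, only needs the principal square root off the negative axis. What has to be shown is
that `B` is the normalized product of the complex Green functions of `Ω`.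

The map `B : Ω → 𝔻` is proper: `‖B‖ → 1` at the boundary of `Ω`, because the Joukowsky map takes
circles to ellipses with foci `±1`. Its zeros are the poles of `F`, with multiplicities
(`isProperToDisc_ratJoukowskyInv`). Such a map gives all the potential theory that is needed. The
Green function of `Ω` with pole at a zero `c` of `B` exists: `-log ‖B‖`, divided by the order of the
zero, is a superharmonic majorant with boundary values zero, and harmonic replacement in countably
many discs produces a harmonic function between it and a subharmonic minorant
(`exists_sphereHarmonic_between`, `IsProperToDisc.exists_isGreenFunction`). By the maximum principle
`-log ‖B‖` is the sum of these Green functions, weighted by the orders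
(`IsProperToDisc.sum_greenFunction`). Hence any product of branches of the complex Green functions
has the modulus of `B`, is a unimodular constant multiple of `B`, and remains so with the same
constant along a continuation; the normalization at `xs` makes this constant one
(`IsProperToDisc.isGreenProductValue_iff`). Values are taken at every point of `Ω`, as `Ω` is
connected.

The extremality of `F` enters through three facts: `F` has a positive leading value at `xs`, greater
than one if `D xs = 0`, so that `xs ∈ Ω` and `B` has the required normalization; `F` is real on the
real line, so that `E ⊆ K` and `K` is nonempty; and `K` is contained in the extended real line, so
that `Ω` is connected. All three follow from a first-order optimality condition
(`IsExtremalForm.re_neg`) for `F = P / Q`, where `Q` is the fixed form with divisor `D`: a variation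
that does not increase `|F|` to first order where `|F| = 1` on `E`, and keeps it to first order only
at zeros of a fixed nonzero form, decreases the leading value. With the variation `0` around the mean
of two extremal functions it gives uniqueness, hence reality. If `F = t ∈ [-1, 1]` at a nonreal point
`z`, then the real form `P - t Q` vanishes at `z` and at its conjugate; replacing these two zeros by
a double zero at `xs`, with a minus sign, yields a variation that preserves the leading value
although the condition says that it decreases.
-/

noncomputable section

open InnerProductSpace

/-! ### Charts of the Riemann sphere -/

@[simp] lemma sphereParam_coe (z w : ℂ) : sphereParam (z : RSphere) w = ((z + w : ℂ) : RSphere) :=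
  rfl

lemma sphereParam_infty (w : ℂ) :
    sphereParam ∞ w = if w = 0 then ∞ else ((w⁻¹ : ℂ) : RSphere) := rfl

lemma sphereParam_infty_of_ne {w : ℂ} (hw : w ≠ 0) :
    sphereParam ∞ w = ((w⁻¹ : ℂ) : RSphere) := by simp [sphereParam_infty, hw]

@[simp] lemma affineCoord_coe (z : ℂ) : affineCoord (z : RSphere) = z := rfl

@[simp] lemma affineCoord_infty : affineCoord ∞ = 0 := rfl

@[simp] lemma sphereParam_zero (p : RSphere) : sphereParam p 0 = p := by
  induction p using OnePoint.rec <;> simp [sphereParam_infty]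

/-- The local coordinate centred at `p` inverse to `sphereParam p`; away from the range of
`sphereParam p` it takes junk values. -/
def sphereChart : RSphere → RSphere → ℂ
  | ∞ => fun q => (affineCoord q)⁻¹
  | (z : ℂ) => fun q => affineCoord q - z

lemma sphereChart_coe (z : ℂ) (q : RSphere) : sphereChart (z : RSphere) q = affineCoord q - z := rfl

lemma sphereChart_infty (q : RSphere) : sphereChart ∞ q = (affineCoord q)⁻¹ := rfl

@[simp] lemma sphereChart_sphereParam (p : RSphere) (w : ℂ) :
    sphereChart p (sphereParam p w) = w := by
  induction p using OnePoint.rec with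
  | infty => by_cases hw : w = 0 <;> simp [sphereParam_infty, hw, sphereChart_infty]
  | coe z => simp [sphereChart_coe]

lemma sphereParam_injective (p : RSphere) : Function.Injective (sphereParam p) :=
  Function.LeftInverse.injective (sphereChart_sphereParam p)

lemma sphereParam_eq_self_iff {p : RSphere} {w : ℂ} : sphereParam p w = p ↔ w = 0 := by
  constructor
  · intro h
    exact sphereParam_injective p (h.trans (sphereParam_zero p).symm)
  · rintro rfl
    exact sphereParam_zero p

/-- The inversion `z ↦ 1 / z` of the sphere. -/
def sphereInversion (z : RSphere) : RSphere := z.elim ((0 : ℂ) : RSphere) (sphereParam ∞)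

lemma continuous_sphereParam_infty : Continuous (sphereParam ∞) := by
  rw [continuous_iff_continuousAt]
  intro w
  by_cases hw : w = 0
  · subst hw
    rw [continuousAt_iff_punctured_nhds, sphereParam_zero]
    have h : Tendsto (fun w : ℂ => ((w⁻¹ : ℂ) : RSphere)) (𝓝[≠] 0) (𝓝 ∞) := by
      refine OnePoint.tendsto_coe_infty.comp ?_
      rw [Filter.coclosedCompact_eq_cocompact, ← Metric.cobounded_eq_cocompact]
      exact tendsto_inv₀_nhdsNE_zero
    refine h.congr' ?_
    filter_upwards [self_mem_nhdsWithin] with x hx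
    exact (sphereParam_infty_of_ne hx).symm
  · have h : ContinuousAt (fun w : ℂ => ((w⁻¹ : ℂ) : RSphere)) w :=
      OnePoint.continuous_coe.continuousAt.comp (continuousAt_inv₀ hw)
    refine h.congr ?_
    filter_upwards [isOpen_ne.mem_nhds hw] with x hx
    exact (sphereParam_infty_of_ne hx).symm

lemma continuous_sphereInversion : Continuous sphereInversion := by
  rw [OnePoint.continuous_iff]
  refine ⟨?_, continuous_sphereParam_infty⟩
  rw [Filter.coclosedCompact_eq_cocompact, ← Metric.cobounded_eq_cocompact]
  have h : Tendsto (fun w : ℂ => ((w⁻¹ : ℂ) : RSphere)) (Bornology.cobounded ℂ)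
      (𝓝 ((0 : ℂ) : RSphere)) :=
    (OnePoint.continuous_coe.tendsto _).comp tendsto_inv₀_cobounded
  refine h.congr' ?_
  filter_upwards [Bornology.isBounded_def.1 (Bornology.isBounded_singleton (x := (0 : ℂ)))]
    with x hx
  exact (sphereParam_infty_of_ne hx).symm

lemma sphereInversion_involutive : Function.Involutive sphereInversion := by
  intro z
  induction z using OnePoint.rec with
  | infty => simp [sphereInversion]
  | coe z => by_cases hz : z = 0 <;> simp [sphereInversion, sphereParam_infty, hz]

lemma isOpenEmbedding_sphereParam (p : RSphere) : IsOpenEmbedding (sphereParam p) := by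
  induction p using OnePoint.rec with
  | infty =>
    have h := (sphereInversion_involutive.toPerm.toHomeomorphOfIsInducing
      (Homeomorph.mk sphereInversion_involutive.toPerm continuous_sphereInversion
        continuous_sphereInversion).isInducing).isOpenEmbedding.comp
      (OnePoint.isOpenEmbedding_coe (X := ℂ))
    exact h
  | coe z =>
    exact (OnePoint.isOpenEmbedding_coe (X := ℂ)).comp (Homeomorph.addLeft z).isOpenEmbedding

lemma continuous_sphereParam (p : RSphere) : Continuous (sphereParam p) :=
  (isOpenEmbedding_sphereParam p).continuous

lemma map_sphereParam_nhds (p : RSphere) (w : ℂ) :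
    map (sphereParam p) (𝓝 w) = 𝓝 (sphereParam p w) :=
  (isOpenEmbedding_sphereParam p).map_nhds_eq w

lemma map_sphereParam_nhds_zero (p : RSphere) : map (sphereParam p) (𝓝 0) = 𝓝 p := by
  rw [map_sphereParam_nhds, sphereParam_zero]

lemma map_sphereParam_nhdsNE (p : RSphere) : map (sphereParam p) (𝓝[≠] 0) = 𝓝[≠] p := by
  have h := (isOpenEmbedding_sphereParam p).isEmbedding.map_nhdsWithin_eq {(0 : ℂ)}ᶜ 0
  rw [h, sphereParam_zero]
  have h2 : sphereParam p '' {(0 : ℂ)}ᶜ = {p}ᶜ ∩ Set.range (sphereParam p) := by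
    ext q
    constructor
    · rintro ⟨w, hw, rfl⟩
      exact ⟨fun h => hw (sphereParam_eq_self_iff.1 h), w, rfl⟩
    · rintro ⟨hq, w, rfl⟩
      exact ⟨w, fun h => hq (sphereParam_eq_self_iff.2 h), rfl⟩
  rw [h2]
  refine nhdsWithin_inter_of_mem' ?_
  exact nhdsWithin_le_nhds ((isOpenEmbedding_sphereParam p).isOpen_range.mem_nhds ⟨0, by simp⟩)

lemma eventually_sphere_iff {p : RSphere} {P : RSphere → Prop} :
    (∀ᶠ q in 𝓝 p, P q) ↔ ∀ᶠ w in 𝓝 (0 : ℂ), P (sphereParam p w) := by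
  rw [← map_sphereParam_nhds_zero p, eventually_map]

lemma eventually_sphereParam_iff {p : RSphere} {w : ℂ} {P : RSphere → Prop} :
    (∀ᶠ q in 𝓝 (sphereParam p w), P q) ↔ ∀ᶠ x in 𝓝 w, P (sphereParam p x) := by
  rw [← map_sphereParam_nhds, eventually_map]

lemma eventually_sphere_nhdsNE_iff {p : RSphere} {P : RSphere → Prop} :
    (∀ᶠ q in 𝓝[≠] p, P q) ↔ ∀ᶠ w in 𝓝[≠] (0 : ℂ), P (sphereParam p w) := by
  rw [← map_sphereParam_nhdsNE p, eventually_map]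

lemma tendsto_sphere_nhdsNE_iff {α : Type*} {p : RSphere} {f : RSphere → α} {l : Filter α} :
    Tendsto f (𝓝[≠] p) l ↔ Tendsto (fun w => f (sphereParam p w)) (𝓝[≠] 0) l := by
  rw [← map_sphereParam_nhdsNE p, tendsto_map'_iff]; rfl

lemma continuousAt_sphereParam_iff {α : Type*} [TopologicalSpace α] {p : RSphere} {w : ℂ}
    {f : RSphere → α} :
    ContinuousAt f (sphereParam p w) ↔ ContinuousAt (fun x => f (sphereParam p x)) w := by
  rw [ContinuousAt, ← map_sphereParam_nhds, tendsto_map'_iff]; rfl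

instance nhdsNE_sphere_neBot (p : RSphere) : (𝓝[≠] p).NeBot := by
  rw [← map_sphereParam_nhdsNE p]; infer_instance

/-- Every neighbourhood of `p` contains a closed chart disc centred at `p`. -/
lemma exists_closedBall_subset_of_mem_nhds {p : RSphere} {U : Set RSphere} (hU : U ∈ 𝓝 p) :
    ∃ r > 0, ∀ w ∈ Metric.closedBall (0 : ℂ) r, sphereParam p w ∈ U := by
  rw [← map_sphereParam_nhds_zero p] at hU
  obtain ⟨r, hr, h⟩ := Metric.nhds_basis_closedBall.mem_iff.1 hU
  exact ⟨r, hr, fun w hw => h hw⟩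

/-! ### Harmonic and analytic functions in charts -/

lemma HarmonicAt.exists_analyticOnNhd_ball {f : ℂ → ℝ} {z : ℂ} (hf : HarmonicAt f z) :
    ∃ r > 0, ∃ F : ℂ → ℂ, AnalyticOnNhd ℂ F (Metric.ball z r) ∧
      ∀ w ∈ Metric.ball z r, f w = (F w).re := by
  obtain ⟨r, hr, h⟩ := Metric.eventually_nhds_iff_ball.1 hf.eventually
  obtain ⟨F, hF, hFe⟩ := HarmonicOnNhd.exists_analyticOnNhd_ball_re_eq (f := f) (fun w hw => h w hw)
  exact ⟨r, hr, F, hF, fun w hw => (hFe hw).symm⟩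

lemma HarmonicAt.exists_analyticAt {f : ℂ → ℝ} {z : ℂ} (hf : HarmonicAt f z) :
    ∃ F : ℂ → ℂ, AnalyticAt ℂ F z ∧ f =ᶠ[𝓝 z] fun w => (F w).re := by
  obtain ⟨r, hr, F, hF, h⟩ := HarmonicAt.exists_analyticOnNhd_ball hf
  exact ⟨F, hF z (Metric.mem_ball_self hr), eventually_of_mem (Metric.ball_mem_nhds z hr) h⟩

lemma HarmonicAt.comp_analyticAt {f : ℂ → ℝ} {φ : ℂ → ℂ} {z : ℂ} (hf : HarmonicAt f (φ z))
    (hφ : AnalyticAt ℂ φ z) : HarmonicAt (fun w => f (φ w)) z := by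
  obtain ⟨F, hF, h⟩ := HarmonicAt.exists_analyticAt hf
  rw [harmonicAt_congr_nhds (f₂ := fun w => (F (φ w)).re)]
  · exact (AnalyticAt.fun_comp hF hφ).harmonicAt_re
  · exact hφ.continuousAt.eventually h

/-- The chart centred at `sphereParam p w₀` is obtained from the one centred at `p` by a local
change of coordinates. -/
lemma exists_transition (p : RSphere) (w₀ : ℂ) :
    ∃ φ ψ : ℂ → ℂ, AnalyticAt ℂ φ 0 ∧ φ 0 = w₀ ∧ AnalyticAt ℂ ψ w₀ ∧ ψ w₀ = 0 ∧
      (∀ᶠ w in 𝓝 0, sphereParam (sphereParam p w₀) w = sphereParam p (φ w)) ∧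
      (∀ᶠ w in 𝓝 w₀, sphereParam p w = sphereParam (sphereParam p w₀) (ψ w)) := by
  induction p using OnePoint.rec with
  | coe z =>
    refine ⟨fun w => w₀ + w, fun w => w - w₀, by fun_prop, by simp, by fun_prop, by simp, ?_, ?_⟩
    · filter_upwards with w
      simp [add_assoc]
    · filter_upwards with w
      simp
  | infty =>
    by_cases h0 : w₀ = 0
    · subst h0
      exact ⟨id, id, analyticAt_id, rfl, analyticAt_id, rfl, by simp, by simp⟩
    · refine ⟨fun w => (w₀⁻¹ + w)⁻¹, fun w => w⁻¹ - w₀⁻¹, ?_, by simp, ?_, by simp, ?_, ?_⟩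
      · exact AnalyticAt.fun_inv (by fun_prop) (by simpa using h0)
      · exact (analyticAt_inv h0).fun_sub analyticAt_const
      · have : ∀ᶠ w in 𝓝 (0 : ℂ), w₀⁻¹ + w ≠ 0 := by
          have hc : ContinuousAt (fun w : ℂ => w₀⁻¹ + w) 0 := by fun_prop
          exact hc.eventually_ne (by simpa using h0)
        filter_upwards [this] with w hw
        rw [sphereParam_infty_of_ne h0, sphereParam_infty_of_ne (inv_ne_zero hw)]
        simp
      · filter_upwards [isOpen_ne.mem_nhds h0] with w hw
        rw [sphereParam_infty_of_ne h0, sphereParam_infty_of_ne hw]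
        simp

lemma sphereHarmonicAt_sphereParam_iff {g : RSphere → ℝ} {p : RSphere} {w₀ : ℂ} :
    SphereHarmonicAt g (sphereParam p w₀) ↔ HarmonicAt (fun w => g (sphereParam p w)) w₀ := by
  obtain ⟨φ, ψ, hφ, hφ0, hψ, hψ0, h1, h2⟩ := exists_transition p w₀
  constructor
  · intro h
    rw [harmonicAt_congr_nhds (h2.mono fun w hw => congrArg g hw)]
    exact HarmonicAt.comp_analyticAt (f := fun w => g (sphereParam (sphereParam p w₀) w))
      (hψ0.symm ▸ h) hψ
  · intro h
    rw [SphereHarmonicAt, harmonicAt_congr_nhds (h1.mono fun w hw => congrArg g hw)]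
    exact HarmonicAt.comp_analyticAt (f := fun w => g (sphereParam p w)) (hφ0.symm ▸ h) hφ

lemma sphereAnalyticAt_sphereParam_iff {g : RSphere → ℂ} {p : RSphere} {w₀ : ℂ} :
    SphereAnalyticAt g (sphereParam p w₀) ↔ AnalyticAt ℂ (fun w => g (sphereParam p w)) w₀ := by
  obtain ⟨φ, ψ, hφ, hφ0, hψ, hψ0, h1, h2⟩ := exists_transition p w₀
  constructor
  · intro h
    rw [analyticAt_congr (h2.mono fun w hw => congrArg g hw)]
    exact AnalyticAt.fun_comp (g := fun w => g (sphereParam (sphereParam p w₀) w))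
      (hψ0.symm ▸ h) hψ
  · intro h
    rw [SphereAnalyticAt, analyticAt_congr (h1.mono fun w hw => congrArg g hw)]
    exact AnalyticAt.fun_comp (g := fun w => g (sphereParam p w)) (hφ0.symm ▸ h) hφ

lemma SphereAnalyticAt.continuousAt {g : RSphere → ℂ} {p : RSphere} (h : SphereAnalyticAt g p) :
    ContinuousAt g p := by
  rw [← sphereParam_zero p, continuousAt_sphereParam_iff]
  exact AnalyticAt.continuousAt h

lemma SphereHarmonicAt.continuousAt {g : RSphere → ℝ} {p : RSphere} (h : SphereHarmonicAt g p) :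
    ContinuousAt g p := by
  rw [← sphereParam_zero p, continuousAt_sphereParam_iff]
  exact h.1.continuousAt

lemma sphereHarmonicAt_congr {f g : RSphere → ℝ} {p : RSphere} (h : f =ᶠ[𝓝 p] g) :
    SphereHarmonicAt f p ↔ SphereHarmonicAt g p :=
  harmonicAt_congr_nhds (eventually_sphere_iff.1 h)

lemma SphereHarmonicAt.add {f g : RSphere → ℝ} {p : RSphere} (hf : SphereHarmonicAt f p)
    (hg : SphereHarmonicAt g p) : SphereHarmonicAt (fun z => f z + g z) p :=
  HarmonicAt.add hf hg

lemma SphereHarmonicAt.const_mul {f : RSphere → ℝ} {p : RSphere} (a : ℝ)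
    (hf : SphereHarmonicAt f p) : SphereHarmonicAt (fun z => a * f z) p :=
  HarmonicAt.const_smul (c := a) hf

lemma SphereHarmonicAt.neg {f : RSphere → ℝ} {p : RSphere}
    (hf : SphereHarmonicAt f p) : SphereHarmonicAt (fun z => - f z) p :=
  HarmonicAt.neg hf

lemma sphereHarmonicAt_const (a : ℝ) (p : RSphere) : SphereHarmonicAt (fun _ => a) p :=
  harmonicAt_const a

lemma SphereHarmonicAt.sum {ι : Type*} (s : Finset ι) {f : ι → RSphere → ℝ} {p : RSphere}
    (hf : ∀ i ∈ s, SphereHarmonicAt (f i) p) :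
    SphereHarmonicAt (fun z => ∑ i ∈ s, f i z) p := by
  classical
  induction s using Finset.induction_on with
  | empty => simpa using sphereHarmonicAt_const 0 p
  | insert i s hi ih =>
    simp only [Finset.sum_insert hi]
    exact (hf i (by simp)).add (ih fun j hj => hf j (by simp [hj]))

lemma SphereAnalyticAt.log_norm {f : RSphere → ℂ} {p : RSphere} (hf : SphereAnalyticAt f p)
    (h0 : f p ≠ 0) : SphereHarmonicAt (fun z => Real.log ‖f z‖) p :=
  AnalyticAt.harmonicAt_log_norm hf (by simpa using h0)

/-! ### Maximum principle and the Dirichlet problem in a disc -/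

/-- A topological form of the maximum principle: a function which is constant near each of its
local maxima exceeding `C` is bounded by `C` as soon as its boundary values are. -/
lemma le_of_frontier_le_of_isLocalMax {X : Type*} [TopologicalSpace X] [T2Space X]
    [PreconnectedSpace X] {W : Set X} (hne : W ≠ Set.univ)
    (hcpt : IsCompact (closure W)) {u : X → ℝ} (hc : ContinuousOn u (closure W)) {C : ℝ}
    (hfr : ∀ x ∈ frontier W, u x ≤ C)
    (hmax : ∀ x ∈ W, C < u x → (∀ᶠ y in 𝓝 x, u y ≤ u x) → ∀ᶠ y in 𝓝 x, u y = u x) :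
    ∀ x ∈ W, u x ≤ C := by
  intro x hx
  by_contra! hlt
  obtain ⟨z, hz, hzmax⟩ := hcpt.exists_isMaxOn ⟨x, subset_closure hx⟩ hc
  have hCz : C < u z := hlt.trans_le (hzmax (subset_closure hx))
  have hint : ∀ y ∈ closure W, u y = u z → y ∈ interior W := by
    intro y hy hyz
    by_contra hyW
    exact absurd (hfr y ⟨hy, hyW⟩) (by rw [hyz]; exact not_le.2 hCz)
  have hclosed : IsClosed (closure W ∩ u ⁻¹' {u z}) :=
    hc.preimage_isClosed_of_isClosed isClosed_closure isClosed_singleton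
  have hopen : IsOpen (closure W ∩ u ⁻¹' {u z}) := by
    rw [isOpen_iff_mem_nhds]
    rintro y ⟨hy, hyz⟩
    have hyi := hint y hy hyz
    have hnhds : W ∈ 𝓝 y := mem_interior_iff_mem_nhds.1 hyi
    have hyz' : u y = u z := hyz
    have h1 := hmax y (interior_subset hyi) (by rw [hyz']; exact hCz) (by
      filter_upwards [hnhds] with t ht
      rw [hyz']
      exact hzmax (subset_closure ht))
    filter_upwards [hnhds, h1] with t ht ht1
    exact ⟨subset_closure ht, ht1.trans hyz'⟩
  have huniv : closure W ∩ u ⁻¹' {u z} = Set.univ :=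
    IsClopen.eq_univ ⟨hclosed, hopen⟩ ⟨z, hz, rfl⟩
  apply hne
  rw [Set.eq_univ_iff_forall]
  intro y
  have hy : y ∈ closure W ∩ u ⁻¹' {u z} := by rw [huniv]; trivial
  exact interior_subset (hint y hy.1 hy.2)

/-- The strong maximum principle for harmonic functions. -/
lemma HarmonicAt.eventually_eq_of_isLocalMax {f : ℂ → ℝ} {z : ℂ} (hf : HarmonicAt f z)
    (hmax : ∀ᶠ w in 𝓝 z, f w ≤ f z) : ∀ᶠ w in 𝓝 z, f w = f z := by
  obtain ⟨F, hF, h⟩ := HarmonicAt.exists_analyticAt hf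
  have hd : ∀ᶠ w in 𝓝 z, DifferentiableAt ℂ (fun w => Complex.exp (F w)) w :=
    hF.eventually_analyticAt.mono fun w hw => hw.differentiableAt.cexp
  have hz : f z = (F z).re := h.self_of_nhds
  have hloc : IsLocalMax (norm ∘ fun w => Complex.exp (F w)) z := by
    filter_upwards [hmax, h] with w hw hw'
    simp only [Function.comp, Complex.norm_exp]
    rw [← hw', ← hz]
    exact Real.exp_le_exp.2 hw
  filter_upwards [Complex.eventually_eq_of_isLocalMax_norm hd hloc, h] with w hw hw'
  have := congrArg norm hw
  rw [Complex.norm_exp, Complex.norm_exp, ← hw', ← hz] at this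
  exact Real.exp_injective this

/-- The Poisson extension to the disc of radius `R` about `0` of the values of `f` on the boundary
circle; outside the open disc it is `f` itself. -/
def poissonExtension (R : ℝ) (f : ℂ → ℝ) (w : ℂ) : ℝ :=
  if ‖w‖ < R then Real.circleAverage (poissonKernel 0 w • f) 0 R else f w

lemma poissonExtension_of_lt {R : ℝ} {f : ℂ → ℝ} {w : ℂ} (hw : ‖w‖ < R) :
    poissonExtension R f w = Real.circleAverage (poissonKernel 0 w • f) 0 R := if_pos hw

lemma poissonExtension_of_le {R : ℝ} {f : ℂ → ℝ} {w : ℂ} (hw : R ≤ ‖w‖) :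
    poissonExtension R f w = f w := if_neg (not_lt.2 hw)

lemma continuousOn_poissonKernel_sphere {R : ℝ} {w : ℂ} (hw : ‖w‖ < R) :
    ContinuousOn (poissonKernel 0 w) (Metric.sphere 0 |R|) := by
  rw [poissonKernel_eq_re_herglotzRieszKernel]
  exact Complex.continuous_re.comp_continuousOn
    (continuousOn_herglotzRieszKernel_sphere (by simpa using hw))

lemma circleIntegrable_poissonKernel_smul {R : ℝ} {f : ℂ → ℝ} {w : ℂ} (hw : ‖w‖ < R)
    (hf : CircleIntegrable f 0 R) : CircleIntegrable (poissonKernel 0 w • f) 0 R :=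
  hf.continuousOn_smul (continuousOn_poissonKernel_sphere hw)

lemma harmonicAt_poissonExtension {R : ℝ} {f : ℂ → ℝ} (hf : CircleIntegrable f 0 R) {w : ℂ}
    (hw : ‖w‖ < R) : HarmonicAt (poissonExtension R f) w := by
  have hw' : w ∈ Metric.ball (0 : ℂ) R := by simpa using hw
  have h1 : CircleIntegrable (fun ζ ↦ (f ζ : ℂ)) 0 R := by
    simp only [CircleIntegrable, intervalIntegrable_iff] at hf ⊢
    exact Complex.ofRealCLM.integrable_comp hf
  have h2 := (analyticOnNhd_circleAverage_herglotzRieszKernel_smul h1 w hw').harmonicAt_re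
  rw [harmonicAt_congr_nhds (f₂ := fun w => (Real.circleAverage
    (fun ζ ↦ herglotzRieszKernel 0 w ζ • (f ζ : ℂ)) 0 R).re)]
  · exact h2
  · filter_upwards [Metric.isOpen_ball.mem_nhds hw'] with x hx
    rw [poissonExtension_of_lt (by simpa using hx), poissonKernel_eq_re_herglotzRieszKernel]
    exact (re_circleAverage_herglotzRieszKernel_smul hf hx).symm

lemma circleAverage_poissonKernel {R : ℝ} {w : ℂ} (hw : ‖w‖ < R) :
    Real.circleAverage (poissonKernel 0 w) 0 R = 1 := by
  have h := HarmonicOnNhd.circleAverage_poissonKernel_smul (f := fun _ => (1 : ℝ)) (c := 0) (R := R)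
    (w := w) (fun x _ => harmonicAt_const 1) (by simpa using hw)
  rw [← h]
  congr 1
  ext z
  simp

lemma poissonKernel_nonneg {R : ℝ} {w z : ℂ} (hw : ‖w‖ < R) (hz : ‖z‖ = R) :
    0 ≤ poissonKernel 0 w z := by
  rw [poissonKernel_def]
  apply div_nonneg _ (by positivity)
  simp only [sub_zero, hz]
  nlinarith [norm_nonneg w]

lemma eventually_circleAverage_poissonKernel_le {R : ℝ} {f : ℂ → ℝ}
    (hf : ContinuousOn f (Metric.sphere 0 R)) {ζ : ℂ} (hζ : ‖ζ‖ = R) {ε : ℝ} (hε : 0 < ε) :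
    ∀ᶠ w in 𝓝 ζ, ‖w‖ < R →
      Real.circleAverage (poissonKernel 0 w • f) 0 R ≤ f ζ + ε := by
  have hR0 : 0 ≤ R := hζ ▸ norm_nonneg ζ
  have hζs : ζ ∈ Metric.sphere (0 : ℂ) R := by simpa using hζ
  obtain ⟨δ, hδ, hδf⟩ := Metric.continuousOn_iff.1 hf ζ hζs (ε / 2) (half_pos hε)
  obtain ⟨M, hM⟩ := (isCompact_sphere (0 : ℂ) R).bddAbove_image hf
  have hint : CircleIntegrable f 0 R := hf.circleIntegrable hR0
  have hcw : ∀ᶠ w in 𝓝 ζ, (|M| + |f ζ|) * ((R ^ 2 - ‖w‖ ^ 2) / (δ / 2) ^ 2) < ε / 2 := by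
    have hcont : ContinuousAt
        (fun w : ℂ => (|M| + |f ζ|) * ((R ^ 2 - ‖w‖ ^ 2) / (δ / 2) ^ 2)) ζ := by fun_prop
    exact hcont.eventually_lt continuousAt_const (by simpa [hζ] using hε)
  filter_upwards [hcw, Metric.ball_mem_nhds ζ (half_pos hδ)] with w hw hwζ hwR
  set c := (|M| + |f ζ|) * ((R ^ 2 - ‖w‖ ^ 2) / (δ / 2) ^ 2) with hc
  have hk : CircleIntegrable (poissonKernel 0 w) 0 R :=
    (continuousOn_poissonKernel_sphere hwR).circleIntegrable'
  have hk2 : CircleIntegrable (fun z => (f ζ + ε / 2) • poissonKernel 0 w z) 0 R :=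
    hk.const_smul
  have hRw : 0 ≤ R ^ 2 - ‖w‖ ^ 2 := by nlinarith [norm_nonneg w]
  have key : Real.circleAverage (poissonKernel 0 w • f) 0 R ≤
      Real.circleAverage (fun z => (f ζ + ε / 2) • poissonKernel 0 w z + c) 0 R := by
    apply Real.circleAverage_mono (circleIntegrable_poissonKernel_smul hwR hint)
      (hk2.add (circleIntegrable_const c 0 R))
    intro z hz
    rw [abs_of_nonneg hR0] at hz
    have hzR : ‖z‖ = R := by simpa using hz
    have hk0 := poissonKernel_nonneg hwR hzR
    have hc0 : 0 ≤ c := by positivity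
    change poissonKernel 0 w z * f z ≤ (f ζ + ε / 2) * poissonKernel 0 w z + c
    by_cases hzδ : dist z ζ < δ
    · have h1 := (abs_lt.1 (Real.dist_eq _ _ ▸ hδf z hz hzδ)).2
      nlinarith
    · have h1 : δ / 2 ≤ ‖z - w‖ := by
        have h2 := dist_triangle z w ζ
        rw [Metric.mem_ball] at hwζ
        rw [← dist_eq_norm]
        linarith
      have h2 : poissonKernel 0 w z ≤ (R ^ 2 - ‖w‖ ^ 2) / (δ / 2) ^ 2 := by
        rw [poissonKernel_def]
        simp only [sub_zero, hzR]
        gcongr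
      have h3 : f z ≤ M := hM ⟨z, hz, rfl⟩
      have h4 : f z - f ζ - ε / 2 ≤ |M| + |f ζ| := by
        linarith [le_abs_self M, neg_abs_le (f ζ)]
      have h5 : poissonKernel 0 w z * (f z - f ζ - ε / 2) ≤ c := by
        calc poissonKernel 0 w z * (f z - f ζ - ε / 2)
            ≤ poissonKernel 0 w z * (|M| + |f ζ|) := by gcongr
          _ ≤ ((R ^ 2 - ‖w‖ ^ 2) / (δ / 2) ^ 2) * (|M| + |f ζ|) := by gcongr
          _ = c := by rw [hc]; ring
      linarith
  have h6 : Real.circleAverage (fun z => (f ζ + ε / 2) • poissonKernel 0 w z + c) 0 R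
      = f ζ + ε / 2 + c := by
    rw [Real.circleAverage_fun_add hk2 (circleIntegrable_const c 0 R), Real.circleAverage_const,
      Real.circleAverage_fun_smul, circleAverage_poissonKernel hwR]
    simp
  linarith

/-- The Poisson integral solves the Dirichlet problem in the disc. -/
lemma continuousOn_poissonExtension {R : ℝ} {f : ℂ → ℝ}
    (hf : ContinuousOn f (Metric.sphere 0 R)) (hR : 0 < R) :
    ContinuousOn (poissonExtension R f) (Metric.closedBall 0 R) := by
  intro ζ hζ
  rcases (mem_closedBall_zero_iff.1 hζ).lt_or_eq with hlt | heq
  · exact (harmonicAt_poissonExtension (hf.circleIntegrable hR.le)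
      hlt).1.continuousAt.continuousWithinAt
  · have hζs : ζ ∈ Metric.sphere (0 : ℂ) R := by simpa using heq
    rw [ContinuousWithinAt, poissonExtension_of_le heq.ge, Metric.tendsto_nhds]
    intro ε hε
    have h1 := eventually_circleAverage_poissonKernel_le hf heq (half_pos hε)
    have h2 := eventually_circleAverage_poissonKernel_le hf.neg heq (half_pos hε)
    obtain ⟨δ, hδ, hδf⟩ := Metric.continuousOn_iff.1 hf ζ hζs ε hε
    filter_upwards [nhdsWithin_le_nhds h1, nhdsWithin_le_nhds h2, self_mem_nhdsWithin,
      nhdsWithin_le_nhds (Metric.ball_mem_nhds ζ hδ)] with w hw1 hw2 hwR hwδ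
    rcases (mem_closedBall_zero_iff.1 hwR).lt_or_eq with hlt | hweq
    · rw [poissonExtension_of_lt hlt, Real.dist_eq, abs_lt]
      have h3 := hw1 hlt
      have h4 := hw2 hlt
      have h5 : Real.circleAverage (poissonKernel 0 w • -f) 0 R =
          - Real.circleAverage (poissonKernel 0 w • f) 0 R := by
        rw [show poissonKernel 0 w • -f = (-1 : ℝ) • (poissonKernel 0 w • f) by ext; simp,
          Real.circleAverage_smul]
        simp
      change Real.circleAverage (poissonKernel 0 w • -f) 0 R ≤ _ at h4
      rw [h5, Pi.neg_apply] at h4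
      constructor <;> linarith
    · rw [poissonExtension_of_le hweq.ge]
      exact hδf w (by simpa using hweq) hwδ

/-- A bounded pointwise limit of functions harmonic in a disc and continuous on its closure is
harmonic, by dominated convergence in the Poisson integral formula. -/
lemma harmonicAt_of_tendsto {R C : ℝ} {f : ℕ → ℂ → ℝ} {g : ℂ → ℝ}
    (hh : ∀ n, ∀ w, ‖w‖ < R → HarmonicAt (f n) w)
    (hc : ∀ n, ContinuousOn (f n) (Metric.closedBall 0 R))
    (hb : ∀ n, ∀ w ∈ Metric.closedBall (0 : ℂ) R, |f n w| ≤ C)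
    (hlim : ∀ w ∈ Metric.closedBall (0 : ℂ) R, Tendsto (fun n => f n w) atTop (𝓝 (g w)))
    {w : ℂ} (hw : ‖w‖ < R) : HarmonicAt g w := by
  have hR : 0 < R := (norm_nonneg w).trans_lt hw
  have hmem : ∀ θ, circleMap 0 R θ ∈ Metric.closedBall (0 : ℂ) R := fun θ => by
    simp [abs_of_pos hR]
  have hcircle : ∀ n, Continuous fun θ => f n (circleMap 0 R θ) := fun n =>
    (hc n).comp_continuous (continuous_circleMap 0 R) hmem
  have hmeas : Measurable fun θ => g (circleMap 0 R θ) :=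
    measurable_of_tendsto_metrizable (fun n => (hcircle n).measurable)
      (tendsto_pi_nhds.2 fun θ => hlim _ (hmem θ))
  have hgb : ∀ z ∈ Metric.closedBall (0 : ℂ) R, |g z| ≤ C := fun z hz =>
    le_of_tendsto (hlim z hz).abs (Eventually.of_forall fun n => hb n z hz)
  have hgint : CircleIntegrable g 0 R := by
    rw [CircleIntegrable, intervalIntegrable_iff]
    refine MeasureTheory.Measure.integrableOn_of_bounded (M := C)
      (by simp [ENNReal.mul_eq_top]) hmeas.aestronglyMeasurable ?_
    exact Eventually.of_forall fun θ => hgb _ (hmem θ)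
  rw [harmonicAt_congr_nhds (f₂ := poissonExtension R g)]
  · exact harmonicAt_poissonExtension hgint hw
  · have hwb : w ∈ Metric.ball (0 : ℂ) R := by simpa using hw
    filter_upwards [Metric.isOpen_ball.mem_nhds hwb] with x hx
    have hxR : ‖x‖ < R := by simpa using hx
    rw [poissonExtension_of_lt hxR]
    refine tendsto_nhds_unique (hlim x (Metric.ball_subset_closedBall hx)) ?_
    have hP : ∀ n, Real.circleAverage (poissonKernel 0 x • f n) 0 R = f n x := fun n =>
      HarmonicContOnCl.circleAverage_poissonKernel_smul
        (HarmonicContOnCl.mk_ball (fun z hz => hh n z (by simpa using hz)) (hc n)) hx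
    have hkc : Continuous fun θ => poissonKernel 0 x (circleMap 0 R θ) :=
      (continuousOn_poissonKernel_sphere hxR).comp_continuous (continuous_circleMap 0 R)
        fun θ => by simp
    simp_rw [← hP, Real.circleAverage_def]
    refine Tendsto.const_smul ?_ _
    refine intervalIntegral.tendsto_integral_filter_of_dominated_convergence
      (fun θ => |poissonKernel 0 x (circleMap 0 R θ)| * C) ?_ ?_ ?_ ?_
    · exact Eventually.of_forall fun n => (hkc.mul (hcircle n)).aestronglyMeasurable
    · refine Eventually.of_forall fun n => Eventually.of_forall fun θ _ => ?_
      simp only [Pi.smul_apply', smul_eq_mul, norm_mul, Real.norm_eq_abs]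
      exact mul_le_mul_of_nonneg_left (hb n _ (hmem θ)) (abs_nonneg _)
    · exact (hkc.abs.mul continuous_const).intervalIntegrable _ _
    · refine Eventually.of_forall fun θ _ => ?_
      simp only [Pi.smul_apply', smul_eq_mul]
      exact (hlim _ (hmem θ)).const_mul _

/-- Comparison of a bounded harmonic function on a punctured disc with its boundary values: the
puncture is negligible, as the addition of a small multiple of `log ‖w‖` shows. -/
lemma le_zero_of_harmonicAt_punctured {R C : ℝ} (hR : 0 < R) {u : ℂ → ℝ}
    (hh : ∀ w, w ≠ 0 → ‖w‖ < R → HarmonicAt u w)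
    (hc : ContinuousOn u (Metric.closedBall 0 R \ {0}))
    (hb : ∀ w, w ≠ 0 → ‖w‖ < R → u w ≤ C) (hs : ∀ w, ‖w‖ = R → u w ≤ 0)
    {w : ℂ} (hw0 : w ≠ 0) (hw : ‖w‖ < R) : u w ≤ 0 := by
  refine le_of_forall_pos_le_add fun ε hε => ?_
  have hwn : 0 < ‖w‖ := norm_pos_iff.2 hw0
  have hlogw : 0 < Real.log (R / ‖w‖) := Real.log_pos (by rwa [one_lt_div hwn])
  -- the factor `a` makes the correction term equal to `ε` at the point `w`
  set a := ε / Real.log (R / ‖w‖) with ha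
  have ha0 : 0 < a := by positivity
  obtain ⟨ρ, hρ0, hρw, hρC⟩ : ∃ ρ, 0 < ρ ∧ ρ < ‖w‖ ∧ C ≤ a * Real.log (R / ρ) := by
    refine ⟨min (‖w‖ / 2) (R * Real.exp (-(|C| / a))), by positivity,
      (min_le_left _ _).trans_lt (by linarith), ?_⟩
    have h1 : Real.exp (|C| / a) ≤ R / min (‖w‖ / 2) (R * Real.exp (-(|C| / a))) := by
      rw [le_div_iff₀ (by positivity)]
      calc _ ≤ Real.exp (|C| / a) * (R * Real.exp (-(|C| / a))) := by
            gcongr; exact min_le_right _ _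
        _ = R := by rw [Real.exp_neg]; field_simp
    have h2 : |C| / a ≤ Real.log (R / min (‖w‖ / 2) (R * Real.exp (-(|C| / a)))) := by
      have h3 := Real.log_le_log (Real.exp_pos _) h1
      rwa [Real.log_exp] at h3
    rw [div_le_iff₀ ha0] at h2
    linarith [le_abs_self C]
  set W : Set ℂ := {z | ρ < ‖z‖ ∧ ‖z‖ < R} with hW
  have hWcl : closure W ⊆ {z | ρ ≤ ‖z‖ ∧ ‖z‖ ≤ R} :=
    closure_minimal (fun z hz => ⟨hz.1.le, hz.2.le⟩)
      ((isClosed_le continuous_const continuous_norm).inter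
        (isClosed_le continuous_norm continuous_const))
  have hWo : IsOpen W := (isOpen_lt continuous_const continuous_norm).inter
    (isOpen_lt continuous_norm continuous_const)
  have hne0 : ∀ z ∈ closure W, z ≠ 0 := fun z hz => norm_pos_iff.1 (hρ0.trans_le (hWcl hz).1)
  have key := le_of_frontier_le_of_isLocalMax (W := W) (C := 0)
    (u := fun z => u z - a * Real.log (R / ‖z‖)) ?_ ?_ ?_ ?_ ?_ w ⟨hρw, hw⟩
  · rw [ha, div_mul_cancel₀ _ hlogw.ne'] at key
    linarith
  · intro h
    have : (0 : ℂ) ∈ W := by rw [h]; trivial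
    simp only [hW, Set.mem_ofPred_eq, norm_zero] at this
    linarith [this.1]
  · refine (isCompact_closedBall (0 : ℂ) R).of_isClosed_subset isClosed_closure fun z hz => ?_
    simpa using (hWcl hz).2
  · refine (hc.mono fun z hz => ⟨by simpa using (hWcl hz).2, hne0 z hz⟩).sub ?_
    refine continuousOn_const.mul (ContinuousOn.log ?_ ?_)
    · exact continuousOn_const.div continuous_norm.continuousOn
        fun z hz => norm_ne_zero_iff.2 (hne0 z hz)
    · intro z hz
      exact (div_pos hR (norm_pos_iff.2 (hne0 z hz))).ne'
  · intro z hz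
    have hzW := hWcl hz.1
    have hzn : ¬ (ρ < ‖z‖ ∧ ‖z‖ < R) := fun h => hz.2 (by rw [hWo.interior_eq]; exact h)
    rcases hzW.2.lt_or_eq with hlt | heq
    · have h1 : ‖z‖ = ρ := le_antisymm (not_lt.1 fun h => hzn ⟨h, hlt⟩) hzW.1
      have h2 := hb z (hne0 z hz.1) hlt
      simp only [h1]
      linarith
    · simp only [heq, div_self hR.ne', Real.log_one, mul_zero, sub_zero]
      exact hs z heq
  · intro z hz _ hmax
    have hz0 : z ≠ 0 := hne0 z (subset_closure hz)
    refine HarmonicAt.eventually_eq_of_isLocalMax ?_ hmax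
    have h1 : HarmonicAt (fun z : ℂ => Real.log ‖z‖) z :=
      AnalyticAt.harmonicAt_log_norm analyticAt_id hz0
    have h2 := ((hh z hz0 hz.2).add (HarmonicAt.const_smul (c := a) h1)).sub
      (harmonicAt_const (a * Real.log R))
    rw [harmonicAt_congr_nhds (f₂ := _)]
    · exact h2
    · filter_upwards [isOpen_ne.mem_nhds hz0] with y hy
      simp only [Pi.sub_apply, Pi.add_apply, Pi.smul_apply, smul_eq_mul]
      rw [Real.log_div hR.ne' (norm_ne_zero_iff.2 hy)]
      ring

/-- Removable singularities of bounded harmonic functions. -/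
lemma exists_harmonicAt_of_bounded {u : ℂ → ℝ} {C : ℝ}
    (hh : ∀ᶠ w in 𝓝[≠] (0 : ℂ), HarmonicAt u w) (hb : ∀ᶠ w in 𝓝[≠] (0 : ℂ), |u w| ≤ C) :
    ∃ h : ℂ → ℝ, HarmonicAt h 0 ∧ ∀ᶠ w in 𝓝[≠] (0 : ℂ), u w = h w := by
  obtain ⟨R, hR, hRh⟩ := Metric.nhds_basis_closedBall.eventually_iff.1
    (eventually_nhdsWithin_iff.1 (hh.and hb))
  have hh' : ∀ w : ℂ, w ≠ 0 → ‖w‖ ≤ R → HarmonicAt u w ∧ |u w| ≤ C := fun w hw hwR =>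
    hRh (by simpa using hwR) hw
  have hcont : ContinuousOn u (Metric.closedBall 0 R \ {0}) := fun z hz =>
    (hh' z hz.2 (by simpa using hz.1)).1.1.continuousAt.continuousWithinAt
  have hsph : ContinuousOn u (Metric.sphere 0 R) := hcont.mono fun z hz => by
    have hz' : ‖z‖ = R := by simpa using hz
    refine ⟨by simpa using hz'.le, ?_⟩
    rintro rfl
    simp at hz'
    exact hR.ne hz'
  have hPc := continuousOn_poissonExtension hsph hR
  have hPh : ∀ w : ℂ, ‖w‖ < R → HarmonicAt (poissonExtension R u) w := fun w hw =>
    harmonicAt_poissonExtension (hsph.circleIntegrable hR.le) hw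
  obtain ⟨M, hM⟩ := (isCompact_closedBall (0 : ℂ) R).bddAbove_image hPc.abs
  have hM' : ∀ w : ℂ, ‖w‖ < R → |poissonExtension R u w| ≤ M := fun w hw =>
    hM ⟨w, by simpa using hw.le, rfl⟩
  refine ⟨poissonExtension R u, hPh 0 (by simpa using hR), ?_⟩
  have hball : ∀ᶠ w in 𝓝[≠] (0 : ℂ), ‖w‖ < R :=
    nhdsWithin_le_nhds (continuous_norm.continuousAt.eventually_lt continuousAt_const
      (by simpa using hR))
  filter_upwards [hball, self_mem_nhdsWithin] with w hw hw0
  apply le_antisymm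
  · have := le_zero_of_harmonicAt_punctured hR (u := u - poissonExtension R u) (C := C + M)
      (fun z hz hzR => (hh' z hz hzR.le).1.sub (hPh z hzR))
      (hcont.sub (hPc.mono Set.sdiff_subset))
      (fun z hz hzR => by
        have h1 := abs_le.1 (hh' z hz hzR.le).2
        have h2 := abs_le.1 (hM' z hzR)
        simp only [Pi.sub_apply]
        linarith)
      (fun z hz => by simp [poissonExtension_of_le hz.ge]) hw0 hw
    simpa using this
  · have := le_zero_of_harmonicAt_punctured hR (u := poissonExtension R u - u) (C := C + M)
      (fun z hz hzR => (hPh z hzR).sub (hh' z hz hzR.le).1)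
      ((hPc.mono Set.sdiff_subset).sub hcont)
      (fun z hz hzR => by
        have h1 := abs_le.1 (hh' z hz hzR.le).2
        have h2 := abs_le.1 (hM' z hzR)
        simp only [Pi.sub_apply]
        linarith)
      (fun z hz => by simp [poissonExtension_of_le hz.ge]) hw0 hw
    simpa using this

/-! ### Harmonic functions between a subsolution and a supersolution -/

/-- A strong pointwise form of subharmonicity: `u` is touched from below at `z` by a function that
is harmonic near `z`. It suffices for the maximum principle, and it is visibly preserved by sums
and by harmonic replacement in discs. -/
def SphereSubharmonicAt (u : RSphere → ℝ) (z : RSphere) : Prop :=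
  ∃ N : RSphere → ℝ, SphereHarmonicAt N z ∧ N z = u z ∧ ∀ᶠ y in 𝓝 z, N y ≤ u y

lemma SphereHarmonicAt.subharmonicAt {u : RSphere → ℝ} {z : RSphere} (h : SphereHarmonicAt u z) :
    SphereSubharmonicAt u z :=
  ⟨u, h, rfl, Eventually.of_forall fun _ => le_rfl⟩

lemma SphereSubharmonicAt.add {u v : RSphere → ℝ} {z : RSphere} (hu : SphereSubharmonicAt u z)
    (hv : SphereSubharmonicAt v z) : SphereSubharmonicAt (fun y => u y + v y) z := by
  obtain ⟨N, hN, hNz, hNu⟩ := hu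
  obtain ⟨N', hN', hNz', hNv⟩ := hv
  refine ⟨fun y => N y + N' y, hN.add hN', by simp [hNz, hNz'], ?_⟩
  filter_upwards [hNu, hNv] with y h1 h2
  exact add_le_add h1 h2

lemma SphereSubharmonicAt.eventually_eq_of_isLocalMax {u : RSphere → ℝ} {z : RSphere}
    (hu : SphereSubharmonicAt u z) (hmax : ∀ᶠ y in 𝓝 z, u y ≤ u z) :
    ∀ᶠ y in 𝓝 z, u y = u z := by
  obtain ⟨N, hN, hNz, hNu⟩ := hu
  have h1 : ∀ᶠ w in 𝓝 (0 : ℂ), N (sphereParam z w) ≤ N (sphereParam z 0) := by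
    rw [sphereParam_zero, hNz]
    refine (eventually_sphere_iff (P := fun y => N y ≤ u z)).1 ?_
    filter_upwards [hmax, hNu] with y h1 h2 using h2.trans h1
  have h2 := HarmonicAt.eventually_eq_of_isLocalMax hN h1
  rw [sphereParam_zero] at h2
  have h3 : ∀ᶠ y in 𝓝 z, N y = N z := eventually_sphere_iff.2 h2
  filter_upwards [hmax, hNu, h3] with y h1 h2 h3
  exact le_antisymm h1 (by rw [← hNz, ← h3]; exact h2)

/-- Comparison principle in a chart disc: a subharmonic function is nonpositive if it is
nonpositive on the boundary circle. -/
lemma SphereSubharmonicAt.nonpos_of_disc {p : RSphere} {R : ℝ} {u : RSphere → ℝ}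
    (hc : ContinuousOn (fun w => u (sphereParam p w)) (Metric.closedBall 0 R))
    (hu : ∀ w : ℂ, ‖w‖ < R → SphereSubharmonicAt u (sphereParam p w))
    (hs : ∀ w : ℂ, ‖w‖ = R → u (sphereParam p w) ≤ 0) {w : ℂ} (hw : ‖w‖ < R) :
    u (sphereParam p w) ≤ 0 := by
  have hR : R ≠ 0 := ((norm_nonneg w).trans_lt hw).ne'
  refine le_of_frontier_le_of_isLocalMax (W := Metric.ball (0 : ℂ) R)
    (u := fun w => u (sphereParam p w)) ?_ ?_ ?_ ?_ ?_ w (by simpa using hw)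
  · intro h
    have h1 : ((|R| : ℝ) : ℂ) ∈ Metric.ball (0 : ℂ) R := by rw [h]; trivial
    rw [mem_ball_zero_iff, Complex.norm_real, Real.norm_eq_abs, abs_abs] at h1
    exact absurd (le_abs_self R) (not_le.2 h1)
  · rw [closure_ball _ hR]; exact isCompact_closedBall _ _
  · rwa [closure_ball _ hR]
  · intro x hx
    rw [frontier_ball _ hR] at hx
    exact hs x (by simpa using hx)
  · intro x hx _ hmax
    exact eventually_sphereParam_iff.1 ((hu x (by simpa using hx)).eventually_eq_of_isLocalMax
      (eventually_sphereParam_iff.2 hmax))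

open Classical in
/-- The function obtained from `v` by replacing its values in the chart disc of radius `R` about
`p` by the Poisson extension of its values on the boundary circle. -/
def harmonicReplacement (p : RSphere) (R : ℝ) (v : RSphere → ℝ) (z : RSphere) : ℝ :=
  if z ∈ sphereParam p '' Metric.ball 0 R then
    poissonExtension R (fun w => v (sphereParam p w)) (sphereChart p z) else v z

lemma harmonicReplacement_sphereParam (p : RSphere) (R : ℝ) (v : RSphere → ℝ) (w : ℂ) :
    harmonicReplacement p R v (sphereParam p w) =
      poissonExtension R (fun w => v (sphereParam p w)) w := by
  by_cases hw : ‖w‖ < R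
  · rw [harmonicReplacement, if_pos ⟨w, by simpa using hw, rfl⟩, sphereChart_sphereParam]
  · rw [harmonicReplacement, if_neg, poissonExtension_of_le (not_lt.1 hw)]
    rintro ⟨w', hw', h⟩
    rw [sphereParam_injective p h] at hw'
    exact hw (by simpa using hw')

lemma harmonicReplacement_of_notMem {p : RSphere} {R : ℝ} {v : RSphere → ℝ} {z : RSphere}
    (hz : ∀ w : ℂ, ‖w‖ < R → sphereParam p w ≠ z) : harmonicReplacement p R v z = v z := by
  rw [harmonicReplacement, if_neg]
  rintro ⟨w, hw, rfl⟩
  exact hz w (by simpa using hw) rfl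

section Replacement

variable {U : Set RSphere} (hU : IsOpen U) {p : RSphere} {R : ℝ} (hR : 0 < R)
  (hD : ∀ w ∈ Metric.closedBall (0 : ℂ) R, sphereParam p w ∈ U) {v M : RSphere → ℝ}
  (hv : ContinuousOn v U) (hM : ContinuousOn M U)

include hD hv in
lemma continuousOn_comp_sphereParam :
    ContinuousOn (fun w => v (sphereParam p w)) (Metric.closedBall 0 R) :=
  hv.comp (continuous_sphereParam p).continuousOn hD

include hR hD hv

lemma sphereHarmonicAt_harmonicReplacement {w : ℂ} (hw : ‖w‖ < R) :
    SphereHarmonicAt (harmonicReplacement p R v) (sphereParam p w) := by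
  rw [sphereHarmonicAt_sphereParam_iff]
  simp only [harmonicReplacement_sphereParam]
  refine harmonicAt_poissonExtension ?_ hw
  exact ((continuousOn_comp_sphereParam hD hv).mono
    Metric.sphere_subset_closedBall).circleIntegrable hR.le

lemma continuousOn_harmonicReplacement_disc :
    ContinuousOn (fun w => harmonicReplacement p R v (sphereParam p w))
      (Metric.closedBall 0 R) := by
  simp only [harmonicReplacement_sphereParam]
  exact continuousOn_poissonExtension ((continuousOn_comp_sphereParam hD hv).mono
    Metric.sphere_subset_closedBall) hR

include hU in
lemma continuousOn_harmonicReplacement : ContinuousOn (harmonicReplacement p R v) U := by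
  intro z hz
  apply ContinuousAt.continuousWithinAt
  by_cases hzD : z ∈ sphereParam p '' Metric.closedBall 0 R
  · obtain ⟨w, hw, rfl⟩ := hzD
    rw [continuousAt_sphereParam_iff, ← continuousWithinAt_univ,
      ← Set.union_compl_self (Metric.closedBall (0 : ℂ) R)]
    refine (continuousOn_harmonicReplacement_disc hR hD hv w hw).union ?_
    rcases (mem_closedBall_zero_iff.1 hw).lt_or_eq with hlt | heq
    · have := (sphereHarmonicAt_harmonicReplacement hR hD hv hlt).continuousAt
      exact (continuousAt_sphereParam_iff.1 this).continuousWithinAt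
    · have h1 : ContinuousAt (fun x => v (sphereParam p x)) w :=
        continuousAt_sphereParam_iff.1 (hv.continuousAt (hU.mem_nhds hz))
      refine h1.continuousWithinAt.congr (fun y hy => ?_) ?_
      · rw [harmonicReplacement_sphereParam, poissonExtension_of_le]
        simpa using (not_le.1 fun h => hy (mem_closedBall_zero_iff.2 h)).le
      · rw [harmonicReplacement_sphereParam, poissonExtension_of_le heq.ge]
  · have hcl : IsClosed (sphereParam p '' Metric.closedBall 0 R) :=
      ((isCompact_closedBall (0 : ℂ) R).image (continuous_sphereParam p)).isClosed
    refine (hv.continuousAt (hU.mem_nhds hz)).congr ?_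
    filter_upwards [hcl.isOpen_compl.mem_nhds hzD] with y hy
    refine (harmonicReplacement_of_notMem fun w hw h => hy ⟨w, ?_, h⟩).symm
    simpa using hw.le

lemma le_harmonicReplacement (hvs : ∀ z ∈ U, SphereSubharmonicAt v z) (z : RSphere) :
    v z ≤ harmonicReplacement p R v z := by
  by_cases hz : ∃ w : ℂ, ‖w‖ < R ∧ sphereParam p w = z
  · obtain ⟨w, hw, rfl⟩ := hz
    have := SphereSubharmonicAt.nonpos_of_disc (p := p) (R := R)
      (u := fun y => v y + -harmonicReplacement p R v y)
      ((continuousOn_comp_sphereParam hD hv).add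
        (continuousOn_harmonicReplacement_disc hR hD hv).neg)
      (fun x hx => (hvs _ (hD x (by simpa using hx.le))).add
        (sphereHarmonicAt_harmonicReplacement hR hD hv hx).neg.subharmonicAt)
      (fun x hx => by
        rw [harmonicReplacement_sphereParam, poissonExtension_of_le hx.ge]; simp) hw
    linarith
  · push Not at hz
    exact (harmonicReplacement_of_notMem hz).ge

lemma sphereSubharmonicAt_harmonicReplacement (hvs : ∀ z ∈ U, SphereSubharmonicAt v z)
    {z : RSphere} (hz : z ∈ U) : SphereSubharmonicAt (harmonicReplacement p R v) z := by
  by_cases hzD : ∃ w : ℂ, ‖w‖ < R ∧ sphereParam p w = z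
  · obtain ⟨w, hw, rfl⟩ := hzD
    exact (sphereHarmonicAt_harmonicReplacement hR hD hv hw).subharmonicAt
  · push Not at hzD
    obtain ⟨N, hN, hNz, hNv⟩ := hvs z hz
    refine ⟨N, hN, hNz.trans (harmonicReplacement_of_notMem hzD).symm, ?_⟩
    exact hNv.mono fun y hy => hy.trans (le_harmonicReplacement hR hD hv hvs y)

include hM in
lemma harmonicReplacement_le (hMs : ∀ z ∈ U, SphereSubharmonicAt (fun z => -M z) z)
    (hle : ∀ z ∈ U, v z ≤ M z) {z : RSphere} (hz : z ∈ U) : harmonicReplacement p R v z ≤ M z := by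
  by_cases hzD : ∃ w : ℂ, ‖w‖ < R ∧ sphereParam p w = z
  · obtain ⟨w, hw, rfl⟩ := hzD
    have := SphereSubharmonicAt.nonpos_of_disc (p := p) (R := R)
      (u := fun y => harmonicReplacement p R v y + -M y)
      ((continuousOn_harmonicReplacement_disc hR hD hv).add
        (continuousOn_comp_sphereParam hD hM).neg)
      (fun x hx => (sphereHarmonicAt_harmonicReplacement hR hD hv hx).subharmonicAt.add
        (hMs _ (hD x (by simpa using hx.le))))
      (fun x hx => by
        have := hle _ (hD x (by simpa using hx.le))
        rw [harmonicReplacement_sphereParam, poissonExtension_of_le hx.ge]; linarith) hw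
    linarith
  · push Not at hzD
    exact (harmonicReplacement_of_notMem hzD).trans_le (hle z hz)

end Replacement

lemma isLindelof_sphere (U : Set RSphere) : IsLindelof U := by
  have h1 : IsLindelof (((↑) : ℂ → RSphere) '' (((↑) : ℂ → RSphere) ⁻¹' U)) :=
    (HereditarilyLindelofSpace.isLindelof _).image OnePoint.continuous_coe
  have h2 : IsLindelof (U ∩ {∞}) :=
    ((Set.finite_singleton (∞ : RSphere)).subset Set.inter_subset_right).isCompact.isLindelof
  have h3 : U = (((↑) : ℂ → RSphere) '' (((↑) : ℂ → RSphere) ⁻¹' U)) ∪ (U ∩ {∞}) := by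
    ext z
    induction z using OnePoint.rec <;> simp
  rw [h3]
  exact h1.union h2

/-- Between a continuous subharmonic function and a larger continuous superharmonic function there
is a harmonic one. It is the limit of the increasing sequence obtained from the subharmonic
function by harmonic replacement in countably many discs covering `U`, each of them being used
infinitely often. -/
theorem exists_sphereHarmonic_between {U : Set RSphere} (hU : IsOpen U) {v M : RSphere → ℝ}
    (hv : ContinuousOn v U) (hM : ContinuousOn M U)
    (hvs : ∀ z ∈ U, SphereSubharmonicAt v z)
    (hMs : ∀ z ∈ U, SphereSubharmonicAt (fun z => -M z) z) (hle : ∀ z ∈ U, v z ≤ M z) :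
    ∃ g : RSphere → ℝ, ∀ z ∈ U, SphereHarmonicAt g z ∧ v z ≤ g z ∧ g z ≤ M z := by
  rcases U.eq_empty_or_nonempty with rfl | hne
  · exact ⟨0, by simp⟩
  have hr : ∀ z : RSphere, ∃ r > 0, z ∈ U →
      ∀ w ∈ Metric.closedBall (0 : ℂ) r, sphereParam z w ∈ U := by
    intro z
    by_cases hz : z ∈ U
    · obtain ⟨r, hr, h⟩ := exists_closedBall_subset_of_mem_nhds (hU.mem_nhds hz)
      exact ⟨r, hr, fun _ => h⟩
    · exact ⟨1, one_pos, fun h => absurd h hz⟩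
  choose r hr0 hrU using hr
  obtain ⟨t, htc, htU, hcov⟩ := (isLindelof_sphere U).elim_nhds_subcover
    (fun z => sphereParam z '' Metric.ball 0 (r z)) (fun z _ => by
      rw [← map_sphereParam_nhds_zero z]
      exact image_mem_map (Metric.ball_mem_nhds 0 (hr0 z)))
  have htne : t.Nonempty := by
    obtain ⟨z, hz⟩ := hne
    obtain ⟨i, hi, -⟩ := Set.mem_iUnion₂.1 (hcov hz)
    exact ⟨i, hi⟩
  obtain ⟨c, rfl⟩ := htc.exists_eq_range htne
  have hcU : ∀ j, c j ∈ U := fun j => htU _ ⟨j, rfl⟩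
  -- the disc with index `j` is used at the steps `Nat.pair j k`, for all `k`
  let a : ℕ → RSphere → ℝ := fun n => Nat.rec v
    (fun n f => harmonicReplacement (c n.unpair.1) (r (c n.unpair.1)) f) n
  have ha : ∀ n, a (n + 1) =
      harmonicReplacement (c n.unpair.1) (r (c n.unpair.1)) (a n) := fun n => rfl
  have hinv : ∀ n, ContinuousOn (a n) U ∧ (∀ z ∈ U, SphereSubharmonicAt (a n) z) ∧
      ∀ z ∈ U, a n z ≤ M z := by
    intro n
    induction n with
    | zero => exact ⟨hv, hvs, hle⟩
    | succ n ih =>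
      have hd := hrU _ (hcU n.unpair.1)
      have h0 := hr0 (c n.unpair.1)
      rw [ha]
      exact ⟨continuousOn_harmonicReplacement hU h0 hd ih.1,
        fun z hz => sphereSubharmonicAt_harmonicReplacement h0 hd ih.1 ih.2.1 hz,
        fun z hz => harmonicReplacement_le h0 hd ih.1 hM hMs ih.2.2 hz⟩
  have hmono : ∀ z, Monotone fun n => a n z := fun z => monotone_nat_of_le_succ fun n => by
    rw [ha]
    exact le_harmonicReplacement (hr0 _) (hrU _ (hcU _)) (hinv n).1 (hinv n).2.1 z
  have hbdd : ∀ z ∈ U, BddAbove (Set.range fun n => a n z) := fun z hz =>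
    ⟨M z, by rintro _ ⟨n, rfl⟩; exact (hinv n).2.2 z hz⟩
  have hlim : ∀ z ∈ U, Tendsto (fun n => a n z) atTop (𝓝 (⨆ n, a n z)) := fun z hz =>
    tendsto_atTop_ciSup (hmono z) (hbdd z hz)
  refine ⟨fun z => ⨆ n, a n z, fun z hz => ⟨?_, le_ciSup (hbdd z hz) 0,
    ciSup_le fun n => (hinv n).2.2 z hz⟩⟩
  obtain ⟨_, ⟨j, rfl⟩, w, hw, rfl⟩ := Set.mem_iUnion₂.1 (hcov hz)
  have hw' : ‖w‖ < r (c j) := by simpa using hw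
  have hd := hrU _ (hcU j)
  obtain ⟨C, hC⟩ := (isCompact_closedBall (0 : ℂ) (r (c j))).bddAbove_image
    ((continuousOn_comp_sphereParam hd hv).abs.add
      (continuousOn_comp_sphereParam hd hM).abs)
  rw [sphereHarmonicAt_sphereParam_iff]
  refine harmonicAt_of_tendsto (R := r (c j)) (C := C)
    (f := fun k x => a (Nat.pair j k + 1) (sphereParam (c j) x)) ?_ ?_ ?_ ?_ hw'
  · intro k x hx
    rw [← sphereHarmonicAt_sphereParam_iff, ha, Nat.unpair_pair]
    exact sphereHarmonicAt_harmonicReplacement (hr0 _) hd (hinv _).1 hx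
  · intro k
    exact continuousOn_comp_sphereParam hd (hinv (Nat.pair j k + 1)).1
  · intro k x hx
    have h1 : |v (sphereParam (c j) x)| + |M (sphereParam (c j) x)| ≤ C := hC ⟨x, hx, rfl⟩
    have h2 : v (sphereParam (c j) x) ≤ a (Nat.pair j k + 1) (sphereParam (c j) x) :=
      hmono (sphereParam (c j) x) (Nat.zero_le (Nat.pair j k + 1))
    have h3 := (hinv (Nat.pair j k + 1)).2.2 _ (hd x hx)
    rw [abs_le]
    constructor
    · linarith [neg_abs_le (v (sphereParam (c j) x)), abs_nonneg (M (sphereParam (c j) x))]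
    · linarith [le_abs_self (M (sphereParam (c j) x)), abs_nonneg (v (sphereParam (c j) x))]
  · intro x hx
    have hstep : Tendsto (fun k => Nat.pair j k + 1) atTop atTop :=
      tendsto_atTop_mono (fun k => (Nat.right_le_pair j k).trans (Nat.le_succ _)) tendsto_id
    exact (hlim _ (hd x hx)).comp hstep

/-! ### Existence and uniqueness of Green functions -/

/-- `B` is an analytic map from `Ω` to the unit disc with `‖B‖ → 1` at the boundary, whose zeros are
the points of `S`, the point `c` being a zero of order `m c`. -/
structure IsProperToDisc (Ω : Set RSphere) (S : Finset RSphere) (m : RSphere → ℕ)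
    (B : RSphere → ℂ) : Prop where
  analyticAt : ∀ z ∈ Ω, SphereAnalyticAt B z
  norm_lt_one : ∀ z ∈ Ω, ‖B z‖ < 1
  tendsto_frontier : ∀ ζ ∈ frontier Ω, Tendsto (fun z => ‖B z‖) (𝓝[Ω] ζ) (𝓝 1)
  mem_of_zero : ∀ c ∈ S, c ∈ Ω
  ne_zero : ∀ z ∈ Ω, z ∉ S → B z ≠ 0
  order_pos : ∀ c ∈ S, 0 < m c
  factor : ∀ c ∈ S, ∃ a : ℂ → ℂ, AnalyticAt ℂ a 0 ∧ a 0 ≠ 0 ∧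
    ∀ᶠ w in 𝓝 (0 : ℂ), B (sphereParam c w) = w ^ m c * a w

/-- The pole order `m c` is visible in `log ‖B‖`, up to a harmonic function. -/
lemma IsProperToDisc.exists_log_eq {Ω : Set RSphere} {S : Finset RSphere} {m : RSphere → ℕ}
    {B : RSphere → ℂ} (hB : IsProperToDisc Ω S m B) {c : RSphere} (hc : c ∈ S) :
    ∃ k : ℂ → ℝ, HarmonicAt k 0 ∧ ∀ᶠ w in 𝓝[≠] (0 : ℂ), B (sphereParam c w) ≠ 0 ∧
      Real.log ‖B (sphereParam c w)‖ = m c * Real.log ‖w‖ + k w := by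
  obtain ⟨a, ha, ha0, h⟩ := hB.factor c hc
  refine ⟨fun w => Real.log ‖a w‖, ha.harmonicAt_log_norm ha0, ?_⟩
  filter_upwards [nhdsWithin_le_nhds h, nhdsWithin_le_nhds (ha.continuousAt.eventually_ne ha0),
    self_mem_nhdsWithin] with w hw haw hw0
  have hw0' : w ^ m c ≠ 0 := pow_ne_zero _ hw0
  rw [hw]
  refine ⟨mul_ne_zero hw0' haw, ?_⟩
  rw [norm_mul, Real.log_mul (norm_ne_zero_iff.2 hw0') (norm_ne_zero_iff.2 haw), norm_pow,
    Real.log_pow]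

/-- The Green function with pole at a zero `c` of `B` exists: it is squeezed between
`max (log (r / ‖w‖)) 0` and the superharmonic function `-(log ‖B‖) / m c`. The latter is truncated
away from `c`, to remove its other poles. -/
lemma IsProperToDisc.exists_isGreenFunction {Ω : Set RSphere} (hΩ : IsOpen Ω) {S : Finset RSphere}
    {m : RSphere → ℕ} {B : RSphere → ℂ} (hB : IsProperToDisc Ω S m B) {c : RSphere} (hc : c ∈ S) :
    ∃ g, IsGreenFunction Ω c g := by
  obtain ⟨k, hk, hkB⟩ := hB.exists_log_eq hc
  have hm : (0 : ℝ) < m c := Nat.cast_pos.2 (hB.order_pos c hc)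
  set μ : ℝ := (m c : ℝ)⁻¹ with hμ
  have hμ0 : 0 < μ := inv_pos.2 hm
  have hcont : ContinuousAt (fun w => -(μ * k w)) 0 := (hk.1.continuousAt.const_mul μ).neg
  obtain ⟨r, hr, hrU, hrk, hrB⟩ : ∃ r > 0, (∀ w ∈ Metric.closedBall (0 : ℂ) r,
      sphereParam c w ∈ Ω) ∧ (∀ w ∈ Metric.closedBall (0 : ℂ) r,
        Real.log r ≤ -(μ * k w) ∧ -(μ * k w) ≤ -(μ * k 0) + 1) ∧
      ∀ w ∈ Metric.closedBall (0 : ℂ) r, w ≠ 0 → B (sphereParam c w) ≠ 0 ∧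
        -(μ * Real.log ‖B (sphereParam c w)‖) = -Real.log ‖w‖ + -(μ * k w) := by
    have h1 : ∀ᶠ w in 𝓝 (0 : ℂ), sphereParam c w ∈ Ω :=
      eventually_sphere_iff.1 (hΩ.mem_nhds (hB.mem_of_zero c hc))
    have h2 : ∀ᶠ w in 𝓝 (0 : ℂ), -(μ * k 0) - 1 < -(μ * k w) ∧ -(μ * k w) < -(μ * k 0) + 1 :=
      (hcont.eventually (lt_mem_nhds (by linarith))).and
        (hcont.eventually (gt_mem_nhds (by linarith)))
    obtain ⟨R, hR, h⟩ := Metric.nhds_basis_closedBall.eventually_iff.1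
      (h1.and (h2.and (eventually_nhdsWithin_iff.1 hkB)))
    refine ⟨min R (Real.exp (-(μ * k 0) - 1)), by positivity, ?_, ?_, ?_⟩
    · exact fun w hw => (h (Metric.closedBall_subset_closedBall (min_le_left _ _) hw)).1
    · intro w hw
      have h3 := (h (Metric.closedBall_subset_closedBall (min_le_left _ _) hw)).2.1
      refine ⟨?_, h3.2.le⟩
      refine (Real.log_le_log (by positivity) (min_le_right _ _)).trans ?_
      rw [Real.log_exp]
      exact h3.1.le
    · intro w hw hw0
      obtain ⟨h3, h4⟩ := (h (Metric.closedBall_subset_closedBall (min_le_left _ _) hw)).2.2 hw0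
      refine ⟨h3, ?_⟩
      rw [h4, mul_add, hμ, ← mul_assoc, inv_mul_cancel₀ hm.ne']
      ring
  have hnorm : ∀ {w : ℂ}, ‖w‖ ≤ r → w ∈ Metric.closedBall (0 : ℂ) r := fun h => by simpa using h
  have hcc : IsClosed (sphereParam c '' Metric.closedBall 0 r) :=
    ((isCompact_closedBall (0 : ℂ) r).image (continuous_sphereParam c)).isClosed
  -- `ε` is a lower bound of `‖B‖` on the circle of radius `r`
  obtain ⟨ε, hε, hε1, hεB⟩ : ∃ ε > 0, ε < 1 ∧ ∀ w : ℂ, ‖w‖ = r → ε < ‖B (sphereParam c w)‖ := by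
    have hco : ContinuousOn (fun w => ‖B (sphereParam c w)‖) (Metric.sphere (0 : ℂ) r) := by
      intro w hw
      have h1 := (hB.analyticAt _ (hrU w (Metric.sphere_subset_closedBall hw))).continuousAt
      exact (continuousAt_sphereParam_iff.1 h1).norm.continuousWithinAt
    obtain ⟨w₀, hw₀, hmin⟩ := (isCompact_sphere (0 : ℂ) r).exists_isMinOn
      (NormedSpace.sphere_nonempty.2 hr.le) hco
    have hw₀r : ‖w₀‖ = r := by simpa using hw₀
    have h0 : 0 < ‖B (sphereParam c w₀)‖ := norm_pos_iff.2
      (hrB w₀ (hnorm hw₀r.le) (by rintro rfl; simp at hw₀r; exact hr.ne hw₀r)).1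
    have h1 := hB.norm_lt_one _ (hrU w₀ (hnorm hw₀r.le))
    refine ⟨‖B (sphereParam c w₀)‖ / 2, by positivity, by linarith, fun w hw => ?_⟩
    have : ‖B (sphereParam c w₀)‖ ≤ ‖B (sphereParam c w)‖ := hmin (by simpa using hw)
    linarith
  classical
  set v : RSphere → ℝ := fun z =>
    if z ∈ sphereParam c '' Metric.ball 0 r then Real.log (r / ‖sphereChart c z‖) else 0 with hv
  set M : RSphere → ℝ := fun z => if z ∈ sphereParam c '' Metric.ball 0 r then
    -(μ * Real.log ‖B z‖) else -(μ * Real.log (max ‖B z‖ ε)) with hM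
  have hball : ∀ {w : ℂ}, sphereParam c w ∈ sphereParam c '' Metric.ball 0 r ↔ ‖w‖ < r := by
    intro w
    rw [(sphereParam_injective c).mem_set_image]
    simp
  have hvin : ∀ {w : ℂ}, ‖w‖ < r → v (sphereParam c w) = Real.log (r / ‖w‖) := fun h => by
    simp only [hv, if_pos (hball.2 h), sphereChart_sphereParam]
  have hvout : ∀ {z}, z ∉ sphereParam c '' Metric.ball 0 r → v z = 0 := fun h => by
    simp only [hv, if_neg h]
  have hv0 : ∀ z, 0 ≤ v z := by
    intro z
    by_cases hz : z ∈ sphereParam c '' Metric.ball 0 r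
    · obtain ⟨w, hw, rfl⟩ := hz
      have hw' : ‖w‖ < r := by simpa using hw
      rw [hvin hw']
      rcases eq_or_ne w 0 with rfl | hw0
      · simp
      · exact Real.log_nonneg ((one_le_div (norm_pos_iff.2 hw0)).2 hw'.le)
    · exact (hvout hz).ge
  have hlogc : ∀ w : ℂ, w ≠ 0 →
      SphereHarmonicAt (fun z => Real.log r + -Real.log ‖sphereChart c z‖) (sphereParam c w) := by
    intro w hw
    rw [sphereHarmonicAt_sphereParam_iff]
    simp only [sphereChart_sphereParam]
    exact (harmonicAt_const _).add (AnalyticAt.harmonicAt_log_norm analyticAt_id hw).neg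
  have hlogB : ∀ z ∈ Ω, B z ≠ 0 → SphereHarmonicAt (fun z => -(μ * Real.log ‖B z‖)) z :=
    fun z hz hz0 => (((hB.analyticAt z hz).log_norm hz0).const_mul μ).neg
  have hvdisc : ∀ w : ℂ, w ≠ 0 → ‖w‖ < r →
      (fun z => Real.log r + -Real.log ‖sphereChart c z‖) =ᶠ[𝓝 (sphereParam c w)] v := by
    intro w hw hwr
    refine eventually_sphereParam_iff.2 ?_
    filter_upwards [isOpen_ne.mem_nhds hw,
      (isOpen_lt continuous_norm continuous_const).mem_nhds hwr] with x hx hxr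
    rw [hvin hxr, sphereChart_sphereParam, Real.log_div hr.ne' (norm_ne_zero_iff.2 hx)]
    ring
  have hMdisc : ∀ w : ℂ, ‖w‖ ≤ r →
      (fun z => -(μ * Real.log ‖B z‖)) =ᶠ[𝓝 (sphereParam c w)] M := by
    intro w hwr
    rcases hwr.lt_or_eq with hlt | heq
    · refine eventually_sphereParam_iff.2 ?_
      filter_upwards [(isOpen_lt continuous_norm continuous_const).mem_nhds hlt] with x hxr
      simp only [hM, if_pos (hball.2 hxr)]
    · have h1 := (hB.analyticAt _ (hrU w (hnorm hwr))).continuousAt.norm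
      filter_upwards [h1.eventually (lt_mem_nhds (hεB w heq))] with z hz
      simp only [hM, max_eq_left hz.le, ite_self]
  have hMout : ∀ z, z ∉ sphereParam c '' Metric.closedBall 0 r →
      (fun z => -(μ * Real.log (max ‖B z‖ ε))) =ᶠ[𝓝 z] M := by
    intro z hz
    filter_upwards [hcc.isOpen_compl.mem_nhds hz] with y hy
    simp only [hM]
    rw [if_neg fun h => hy (Set.image_mono Metric.ball_subset_closedBall h)]
  have hvout' : ∀ z, z ∉ sphereParam c '' Metric.closedBall 0 r → (fun _ => (0 : ℝ)) =ᶠ[𝓝 z] v := by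
    intro z hz
    filter_upwards [hcc.isOpen_compl.mem_nhds hz] with y hy
    exact (hvout fun h => hy (Set.image_mono Metric.ball_subset_closedBall h)).symm
  have hU : IsOpen (Ω \ {c}) := hΩ.sdiff isClosed_singleton
  have hne : ∀ {w : ℂ}, sphereParam c w ∈ Ω \ {c} → w ≠ 0 := fun h h0 =>
    h.2 (sphereParam_eq_self_iff.2 h0)
  -- the squeeze away from the pole: `v` is subharmonic, `M` is superharmonic and `v ≤ M`
  have hex : ∃ g : RSphere → ℝ, ∀ z ∈ Ω \ {c},
      SphereHarmonicAt g z ∧ v z ≤ g z ∧ g z ≤ M z := by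
    refine exists_sphereHarmonic_between hU ?_ ?_ ?_ ?_ ?_
    · intro z hz
      apply ContinuousAt.continuousWithinAt
      by_cases hzD : z ∈ sphereParam c '' Metric.closedBall 0 r
      · obtain ⟨w, hw, rfl⟩ := hzD
        have hw0 := hne hz
        have h1 : ContinuousAt (fun w : ℂ => max 0 (Real.log r - Real.log ‖w‖)) w := by
          have : ‖w‖ ≠ 0 := norm_ne_zero_iff.2 hw0
          fun_prop (disch := assumption)
        rw [continuousAt_sphereParam_iff]
        refine h1.congr ?_
        filter_upwards [isOpen_ne.mem_nhds hw0] with x hx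
        rw [← Real.log_div hr.ne' (norm_ne_zero_iff.2 hx)]
        by_cases hxr : ‖x‖ < r
        · rw [hvin hxr, max_eq_right]
          exact Real.log_nonneg ((one_le_div (norm_pos_iff.2 hx)).2 hxr.le)
        · rw [hvout fun h => hxr (hball.1 h), max_eq_left]
          exact Real.log_nonpos (by positivity) (div_le_one_of_le₀ (not_lt.1 hxr) (norm_nonneg x))
      · exact continuousAt_const.congr (hvout' z hzD)
    · intro z hz
      apply ContinuousAt.continuousWithinAt
      by_cases hzD : z ∈ sphereParam c '' Metric.closedBall 0 r
      · obtain ⟨w, hw, rfl⟩ := hzD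
        have hwr : ‖w‖ ≤ r := by simpa using hw
        exact (hlogB _ hz.1 (hrB w hw (hne hz)).1).continuousAt.congr (hMdisc w hwr)
      · have h1 : ContinuousAt (fun z => max ‖B z‖ ε) z :=
          (hB.analyticAt z hz.1).continuousAt.norm.sup continuousAt_const
        have h2 : ContinuousAt (fun z => -(μ * Real.log (max ‖B z‖ ε))) z :=
          ((h1.log (by positivity)).const_mul μ).neg
        exact h2.congr (hMout z hzD)
    · intro z hz
      by_cases hzD : z ∈ sphereParam c '' Metric.ball 0 r
      · obtain ⟨w, hw, rfl⟩ := hzD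
        have hw0 := hne hz
        exact ((sphereHarmonicAt_congr (hvdisc w hw0 (by simpa using hw))).1
          (hlogc w hw0)).subharmonicAt
      · exact ⟨fun _ => 0, sphereHarmonicAt_const 0 z, (hvout hzD).symm,
          Eventually.of_forall hv0⟩
    · intro z hz
      by_cases hzD : z ∈ sphereParam c '' Metric.closedBall 0 r
      · obtain ⟨w, hw, rfl⟩ := hzD
        have hwr : ‖w‖ ≤ r := by simpa using hw
        exact ((sphereHarmonicAt_congr (hMdisc w hwr)).1
          (hlogB _ hz.1 (hrB w hw (hne hz)).1)).neg.subharmonicAt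
      · have hMz := hMout z hzD
        by_cases hBz : ε ≤ ‖B z‖
        · have hB0 : B z ≠ 0 := norm_pos_iff.1 (hε.trans_le hBz)
          refine ⟨fun y => μ * Real.log ‖B y‖, ((hB.analyticAt z hz.1).log_norm hB0).const_mul μ, ?_,
            ?_⟩
          · simp only [← hMz.self_of_nhds, max_eq_left hBz, neg_neg]
          · filter_upwards [hMz, (hB.analyticAt z hz.1).continuousAt.eventually_ne hB0] with y hy hy0
            rw [← hy, neg_neg]
            gcongr
            exact le_max_left _ _
        · refine ⟨fun _ => μ * Real.log ε, sphereHarmonicAt_const _ z, ?_, ?_⟩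
          · simp only [← hMz.self_of_nhds, max_eq_right (not_le.1 hBz).le, neg_neg]
          · filter_upwards [hMz] with y hy
            rw [← hy, neg_neg]
            gcongr
            exact le_max_right _ _
    · intro z hz
      by_cases hzD : z ∈ sphereParam c '' Metric.ball 0 r
      · obtain ⟨w, hw, rfl⟩ := hzD
        have hwr : ‖w‖ < r := by simpa using hw
        have hw0 := hne hz
        have hMw : -(μ * Real.log ‖B (sphereParam c w)‖) = M (sphereParam c w) :=
          (hMdisc w hwr.le).self_of_nhds
        rw [hvin hwr, ← hMw, (hrB w (hnorm hwr.le) hw0).2,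
          Real.log_div hr.ne' (norm_ne_zero_iff.2 hw0)]
        linarith [(hrk w (hnorm hwr.le)).1]
      · rw [hvout hzD]
        simp only [hM, if_neg hzD]
        have h1 : max ‖B z‖ ε ≤ 1 := max_le (hB.norm_lt_one z hz.1).le hε1.le
        have h2 := Real.log_nonpos (hε.le.trans (le_max_right _ _)) h1
        nlinarith
  obtain ⟨g, hg⟩ := hex
  refine ⟨g, fun z hz hzc => (hg z ⟨hz, hzc⟩).1, ?_, ?_⟩
  · have hpt : ∀ᶠ w in 𝓝[≠] (0 : ℂ), w ≠ 0 ∧ ‖w‖ < r ∧ sphereParam c w ∈ Ω \ {c} := by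
      filter_upwards [self_mem_nhdsWithin, nhdsWithin_le_nhds
        (continuous_norm.continuousAt.eventually_lt continuousAt_const
          (by simpa using hr : ‖(0 : ℂ)‖ < r))] with w hw hwr
      exact ⟨hw, hwr, hrU w (hnorm hwr.le), fun h => hw (sphereParam_eq_self_iff.1 h)⟩
    -- `g + log ‖w‖` is bounded near the pole, so the singularity is removable
    obtain ⟨h, hh, hhu⟩ := exists_harmonicAt_of_bounded
      (u := fun w => g (sphereParam c w) + Real.log ‖w‖) (C := |Real.log r| + |-(μ * k 0) + 1|)
      (hpt.mono fun w hw => (sphereHarmonicAt_sphereParam_iff.1 (hg _ hw.2.2).1).add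
        (AnalyticAt.harmonicAt_log_norm analyticAt_id hw.1))
      (hpt.mono fun w ⟨hw, hwr, hwU⟩ => by
        obtain ⟨-, h1, h2⟩ := hg _ hwU
        rw [hvin hwr, Real.log_div hr.ne' (norm_ne_zero_iff.2 hw)] at h1
        have hMw : -(μ * Real.log ‖B (sphereParam c w)‖) = M (sphereParam c w) :=
          (hMdisc w hwr.le).self_of_nhds
        rw [← hMw, (hrB w (hnorm hwr.le) hw).2] at h2
        have h3 := (hrk w (hnorm hwr.le)).2
        rw [abs_le]
        constructor
        · linarith [neg_abs_le (Real.log r), abs_nonneg (-(μ * k 0) + 1)]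
        · linarith [le_abs_self (-(μ * k 0) + 1), abs_nonneg (Real.log r)])
    refine ⟨h, hh, hhu.mono fun w hw => ?_⟩
    linarith
  · intro ζ hζ
    have hζΩ : ζ ∉ Ω := by
      rw [hΩ.frontier_eq] at hζ
      exact hζ.2
    have hζD : ζ ∉ sphereParam c '' Metric.closedBall 0 r := by
      rintro ⟨w, hw, rfl⟩
      exact hζΩ (hrU w hw)
    have hζc : ζ ≠ c := fun h => hζΩ (h ▸ hB.mem_of_zero c hc)
    have hlimM : Tendsto M (𝓝[Ω] ζ) (𝓝 0) := by
      have h1 := (((hB.tendsto_frontier ζ hζ).max (tendsto_const_nhds (x := ε))).log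
        (by positivity)).const_mul μ |>.neg
      rw [max_eq_left hε1.le, Real.log_one, mul_zero, neg_zero] at h1
      exact h1.congr' (nhdsWithin_le_nhds (hMout ζ hζD))
    have hev : ∀ᶠ z in 𝓝[Ω] ζ, z ∈ Ω \ {c} := by
      filter_upwards [self_mem_nhdsWithin, nhdsWithin_le_nhds (isOpen_ne.mem_nhds hζc)]
        with z hz hzc using ⟨hz, hzc⟩
    exact tendsto_of_tendsto_of_tendsto_of_le_of_le' tendsto_const_nhds hlimM
      (hev.mono fun z hz => (hv0 z).trans (hg z hz).2.1) (hev.mono fun z hz => (hg z hz).2.2)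

/-- A harmonic function with boundary values zero vanishes. -/
lemma eq_zero_of_sphereHarmonicAt {W : Set RSphere} (hW : IsOpen W) (hne : W ≠ Set.univ)
    {u : RSphere → ℝ} (hu : ∀ z ∈ W, SphereHarmonicAt u z)
    (hfr : ∀ ζ ∈ frontier W, Tendsto u (𝓝[W] ζ) (𝓝 0)) {z : RSphere} (hz : z ∈ W) : u z = 0 := by
  have key : ∀ u : RSphere → ℝ, (∀ z ∈ W, SphereHarmonicAt u z) →
      (∀ ζ ∈ frontier W, Tendsto u (𝓝[W] ζ) (𝓝 0)) → u z ≤ 0 := by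
    intro u hu hfr
    have hind : ∀ y ∈ W, W.indicator u =ᶠ[𝓝 y] u := fun y hy => by
      filter_upwards [hW.mem_nhds hy] with x hx using Set.indicator_of_mem hx u
    have h1 := le_of_frontier_le_of_isLocalMax (C := 0) (u := W.indicator u) hne
      isClosed_closure.isCompact ?_ ?_ ?_ z hz
    · rwa [Set.indicator_of_mem hz] at h1
    · intro y hy
      by_cases hyW : y ∈ W
      · exact ((hu y hyW).continuousAt.congr (hind y hyW).symm).continuousWithinAt
      · apply ContinuousAt.continuousWithinAt
        rw [ContinuousAt, Set.indicator_of_notMem hyW, ← nhdsWithin_univ,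
          ← Set.union_compl_self W, nhdsWithin_union]
        refine Tendsto.sup ?_ ?_
        · refine (hfr y (by rw [hW.frontier_eq]; exact ⟨hy, hyW⟩)).congr' ?_
          filter_upwards [self_mem_nhdsWithin] with x hx using (Set.indicator_of_mem hx u).symm
        · refine tendsto_const_nhds.congr' ?_
          filter_upwards [self_mem_nhdsWithin] with x hx using (Set.indicator_of_notMem hx u).symm
    · intro y hy
      rw [hW.frontier_eq] at hy
      rw [Set.indicator_of_notMem hy.2]
    · intro y hy _ hmax
      exact ((sphereHarmonicAt_congr (hind y hy)).2
        (hu y hy)).subharmonicAt.eventually_eq_of_isLocalMax hmax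
  refine le_antisymm (key u hu hfr) ?_
  have := key (fun z => -u z) (fun z hz => (hu z hz).neg) fun ζ hζ => by simpa using (hfr ζ hζ).neg
  linarith

/-- The Green functions with poles at the zeros of `B` add up to `-log ‖B‖`. -/
lemma IsProperToDisc.sum_greenFunction {Ω : Set RSphere} (hΩ : IsOpen Ω) (hne : Ω ≠ Set.univ)
    {S : Finset RSphere} {m : RSphere → ℕ} {B : RSphere → ℂ} (hB : IsProperToDisc Ω S m B)
    {G : RSphere → RSphere → ℝ} (hG : ∀ c ∈ S, IsGreenFunction Ω c (G c)) {z : RSphere}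
    (hz : z ∈ Ω) (hzS : z ∉ S) : ∑ c ∈ S, m c * G c z = -Real.log ‖B z‖ := by
  classical
  set u : RSphere → ℝ := fun z => ∑ c ∈ S, m c * G c z + Real.log ‖B z‖ with hu
  have hSclosed : ∀ S' : Finset RSphere, IsOpen ((S' : Set RSphere)ᶜ) := fun S' =>
    S'.finite_toSet.isClosed.isOpen_compl
  have hH : ∀ c ∈ S, ∃ H : ℂ → ℝ, HarmonicAt H 0 ∧
      ∀ᶠ w in 𝓝[≠] (0 : ℂ), u (sphereParam c w) = H w := by
    intro c hc
    obtain ⟨k, hk, hkB⟩ := hB.exists_log_eq hc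
    obtain ⟨h, hh, hhG⟩ := (hG c hc).log_pole
    have hrest : SphereHarmonicAt (fun z => ∑ c' ∈ S.erase c, m c' * G c' z) c :=
      SphereHarmonicAt.sum _ fun c' hc' => ((hG c' (Finset.mem_of_mem_erase hc')).harmonic c
        (hB.mem_of_zero c hc) (Finset.ne_of_mem_erase hc').symm).const_mul _
    refine ⟨_, ((HarmonicAt.const_smul (c := (m c : ℝ)) hh).add hrest).add hk, ?_⟩
    filter_upwards [hkB, hhG] with w hw hw'
    simp only [hu, Pi.add_apply, Pi.smul_apply, smul_eq_mul]
    rw [← Finset.add_sum_erase S _ hc, hw.2, hw']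
    ring
  choose! H hH hHu using hH
  set U : RSphere → ℝ := fun z => if z ∈ S then H z 0 else u z with hU
  have hUout : ∀ z, z ∉ S → U =ᶠ[𝓝 z] u := by
    intro z hz
    filter_upwards [(hSclosed S).mem_nhds hz] with y hy
    exact if_neg hy
  have key := eq_zero_of_sphereHarmonicAt hΩ hne (u := U) ?_ ?_ hz
  · have h1 : u z = 0 := (hUout z hzS).self_of_nhds.symm.trans key
    simp only [hu] at h1
    linarith
  · intro y hy
    by_cases hyS : y ∈ S
    · refine (harmonicAt_congr_nhds ?_).2 (hH y hyS)
      have h1 : ∀ᶠ w in 𝓝[≠] (0 : ℂ), U (sphereParam y w) = H y w := by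
        have h2 : ∀ᶠ w in 𝓝[≠] (0 : ℂ), sphereParam y w ∉ S := by
          have h3 : ∀ᶠ q in 𝓝 y, q ∉ S.erase y := (hSclosed (S.erase y)).mem_nhds (by simp)
          filter_upwards [nhdsWithin_le_nhds (eventually_sphere_iff.1 h3), self_mem_nhdsWithin]
            with w hw hw0 hwS
          exact hw (Finset.mem_erase.2 ⟨fun h => hw0 (sphereParam_eq_self_iff.1 h), hwS⟩)
        filter_upwards [h2, hHu y hyS] with w hw hw'
        simp only [hU, if_neg hw, hw']
      rw [eventually_nhdsWithin_iff] at h1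
      filter_upwards [h1] with w hw
      rcases eq_or_ne w 0 with rfl | hw0
      · simp only [hU, sphereParam_zero, if_pos hyS]
      · exact hw hw0
    · rw [sphereHarmonicAt_congr (hUout y hyS)]
      exact (SphereHarmonicAt.sum _ fun c hc => ((hG c hc).harmonic y hy
        fun h => hyS (h ▸ hc)).const_mul _).add
        ((hB.analyticAt y hy).log_norm (hB.ne_zero y hy hyS))
  · intro ζ hζ
    have hζΩ : ζ ∉ Ω := by
      rw [hΩ.frontier_eq] at hζ
      exact hζ.2
    have hlim : Tendsto u (𝓝[Ω] ζ) (𝓝 (∑ c ∈ S, (m c : ℝ) * 0 + Real.log 1)) :=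
      (tendsto_finsetSum _ fun c hc => ((hG c hc).boundary ζ hζ).const_mul _).add
        ((hB.tendsto_frontier ζ hζ).log one_ne_zero)
    simp only [mul_zero, Finset.sum_const_zero, Real.log_one, add_zero] at hlim
    exact hlim.congr' (nhdsWithin_le_nhds (hUout ζ fun h => hζΩ (hB.mem_of_zero ζ h)).symm)

/-! ### Analytic continuation of complex Green functions -/

/-- Two analytic functions with the same modulus differ by a unimodular factor. -/
lemma exists_unimodular_of_norm_eq {f g : RSphere → ℂ} {p : RSphere} (hf : SphereAnalyticAt f p)
    (hg : SphereAnalyticAt g p) (h : ∀ᶠ q in 𝓝[≠] p, g q ≠ 0 ∧ ‖f q‖ = ‖g q‖) :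
    ∃ κ : ℂ, ‖κ‖ = 1 ∧ ∀ᶠ q in 𝓝 p, f q = κ * g q := by
  have hf' : AnalyticAt ℂ (fun w => f (sphereParam p w)) 0 := hf
  have hg' : AnalyticAt ℂ (fun w => g (sphereParam p w)) 0 := hg
  obtain ⟨r, hr, hball⟩ := Metric.eventually_nhds_iff_ball.1
    ((hf'.eventually_analyticAt.and hg'.eventually_analyticAt).and
      (eventually_nhdsWithin_iff.1 (eventually_sphere_nhdsNE_iff.1 h)))
  set w₁ : ℂ := ((r / 2 : ℝ) : ℂ) with hw₁
  have hw₁0 : w₁ ≠ 0 := by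
    rw [hw₁]
    exact_mod_cast (half_pos hr).ne'
  have hw₁b : w₁ ∈ Metric.ball (0 : ℂ) r := by
    rw [mem_ball_zero_iff, hw₁, Complex.norm_real, Real.norm_eq_abs, abs_of_pos (half_pos hr)]
    linarith
  have hpt : ∀ᶠ w in 𝓝 w₁, w ∈ Metric.ball (0 : ℂ) r ∧ w ≠ 0 :=
    Filter.Eventually.and (Metric.isOpen_ball.mem_nhds hw₁b) (isOpen_ne.mem_nhds hw₁0)
  set q : ℂ → ℂ := fun w => f (sphereParam p w) / g (sphereParam p w) with hq
  have hqd : ∀ᶠ w in 𝓝 w₁, DifferentiableAt ℂ q w := hpt.mono fun w hw =>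
    (hball w hw.1).1.1.differentiableAt.div (hball w hw.1).1.2.differentiableAt
      ((hball w hw.1).2 hw.2).1
  have hqn : ∀ w ∈ Metric.ball (0 : ℂ) r, w ≠ 0 → ‖q w‖ = 1 := fun w hw hw0 => by
    obtain ⟨h1, h2⟩ := (hball w hw).2 hw0
    rw [hq, norm_div, h2, div_self (norm_ne_zero_iff.2 h1)]
  have hmax : IsLocalMax (norm ∘ q) w₁ := by
    filter_upwards [hpt] with w hw
    simp only [Function.comp, hqn w hw.1 hw.2, hqn w₁ hw₁b hw₁0, le_refl]
  refine ⟨q w₁, hqn w₁ hw₁b hw₁0, ?_⟩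
  have heq : (fun w => f (sphereParam p w)) =ᶠ[𝓝 w₁]
      fun w => q w₁ * g (sphereParam p w) := by
    filter_upwards [Complex.eventually_eq_of_isLocalMax_norm hqd hmax, hpt] with w hw hwb
    rw [← hw, hq, div_mul_cancel₀ _ ((hball w hwb.1).2 hwb.2).1]
  have h1 := AnalyticOnNhd.eqOn_of_preconnected_of_eventuallyEq
    (U := Metric.ball (0 : ℂ) r) (fun w hw => (hball w hw).1.1)
    (fun w hw => analyticAt_const.fun_mul (hball w hw).1.2) (convex_ball 0 r).isPreconnected
    hw₁b heq
  exact eventually_sphere_iff.2 (eventually_of_mem (Metric.ball_mem_nhds 0 hr) h1)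

lemma eventually_nhdsNE_ne (p c : RSphere) : ∀ᶠ q in 𝓝[≠] p, q ≠ c := by
  rcases eq_or_ne p c with rfl | h
  · exact self_mem_nhdsWithin
  · exact nhdsWithin_le_nhds (isOpen_ne.mem_nhds h)

lemma eventually_nhdsNE_notMem (p : RSphere) (S : Finset RSphere) : ∀ᶠ q in 𝓝[≠] p, q ∉ S := by
  have := (Filter.eventually_all_finset S).2 fun c _ => eventually_nhdsNE_ne p c
  exact this.mono fun q hq hqS => hq q hqS rfl

lemma isGreenFunction_greenFunction {K : Set RSphere} {c : RSphere}
    (h : ∃ g, IsGreenFunction Kᶜ c g) : IsGreenFunction Kᶜ c (greenFunction K c) := by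
  rw [greenFunction, dif_pos h]
  exact Classical.choose_spec h

lemma IsComplexGreenBranchAt.norm_eq {K : Set RSphere} {c p : RSphere} {b : RSphere → ℂ}
    (hb : IsComplexGreenBranchAt K c p b) :
    ∀ᶠ q in 𝓝[≠] p, ‖b q‖ = Real.exp (-greenFunction K c q) := by
  filter_upwards [nhdsWithin_le_nhds hb.2, eventually_nhdsNE_ne p c] with q hq hqc
  obtain ⟨v, -, hv⟩ := hq hqc
  rw [hv.self_of_nhds, Complex.norm_exp]
  simp

/-- Branches of the same complex Green function differ by a unimodular factor. -/
lemma IsComplexGreenBranchAt.exists_unimodular {K : Set RSphere} {c p : RSphere}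
    {b b' : RSphere → ℂ} (hb : IsComplexGreenBranchAt K c p b)
    (hb' : IsComplexGreenBranchAt K c p b') :
    ∃ κ : ℂ, ‖κ‖ = 1 ∧ ∀ᶠ q in 𝓝 p, b q = κ * b' q := by
  refine exists_unimodular_of_norm_eq hb.1 hb'.1 ?_
  filter_upwards [hb.norm_eq, hb'.norm_eq] with q h1 h2
  exact ⟨norm_pos_iff.1 (h2 ▸ Real.exp_pos _), h1.trans h2.symm⟩

lemma IsComplexGreenBranchAt.const_mul {K : Set RSphere} {c p : RSphere} {b : RSphere → ℂ}
    (hb : IsComplexGreenBranchAt K c p b) {κ : ℂ} (hκ : ‖κ‖ = 1) :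
    IsComplexGreenBranchAt K c p fun q => κ * b q := by
  refine ⟨AnalyticAt.fun_mul analyticAt_const hb.1, hb.2.mono fun q hq hqc => ?_⟩
  obtain ⟨v, hv, hbv⟩ := hq hqc
  refine ⟨fun z => v z + -κ.arg, ?_, hbv.mono fun z hz => ?_⟩
  · have h1 : (fun z => (greenFunction K c z : ℂ) + Complex.I * ((v z + -κ.arg : ℝ) : ℂ)) =
        fun z => ((greenFunction K c z : ℂ) + Complex.I * (v z : ℂ)) + Complex.I * (-κ.arg) := by
      ext z
      push_cast
      ring
    rw [h1]
    exact AnalyticAt.fun_add hv analyticAt_const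
  · have h1 : κ = Complex.exp (Complex.I * κ.arg) := by
      have h2 := Complex.norm_mul_exp_arg_mul_I κ
      rw [hκ, Complex.ofReal_one, one_mul, mul_comm] at h2
      exact h2.symm
    change κ * b z =
      Complex.exp (-((greenFunction K c z : ℂ) + Complex.I * ((v z + -κ.arg : ℝ) : ℂ)))
    rw [hz]
    nth_rewrite 1 [h1]
    rw [← Complex.exp_add]
    congr 1
    push_cast
    ring

/-- A criterion for branches in a chart disc. -/
lemma isComplexGreenBranchAt_of_chart {K : Set RSphere} {c p : RSphere} {r : ℝ} {b : RSphere → ℂ}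
    (hb : ∀ w ∈ Metric.ball (0 : ℂ) r, AnalyticAt ℂ (fun w => b (sphereParam p w)) w)
    (hL : ∀ w ∈ Metric.ball (0 : ℂ) r, sphereParam p w ≠ c → ∃ L : ℂ → ℂ, AnalyticAt ℂ L w ∧
      ∀ᶠ x in 𝓝 w, greenFunction K c (sphereParam p x) = (L x).re ∧
        b (sphereParam p x) = Complex.exp (-L x))
    {w : ℂ} (hw : w ∈ Metric.ball (0 : ℂ) r) : IsComplexGreenBranchAt K c (sphereParam p w) b := by
  refine ⟨sphereAnalyticAt_sphereParam_iff.2 (hb w hw), ?_⟩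
  rw [eventually_sphereParam_iff]
  filter_upwards [Metric.isOpen_ball.mem_nhds hw] with x hx hxc
  obtain ⟨L, hL, hLx⟩ := hL x hx hxc
  have h1 : ∀ᶠ y in 𝓝 x, (greenFunction K c (sphereParam p y) : ℂ) +
      Complex.I * ((L (sphereChart p (sphereParam p y))).im : ℂ) = L y := by
    filter_upwards [hLx] with y hy
    rw [sphereChart_sphereParam, hy.1, mul_comm]
    exact Complex.re_add_im _
  refine ⟨fun z => (L (sphereChart p z)).im, ?_, ?_⟩
  · rw [sphereAnalyticAt_sphereParam_iff]
    exact hL.congr (EventuallyEq.symm h1)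
  · rw [eventually_sphereParam_iff]
    filter_upwards [h1, hLx] with y hy hy'
    rw [hy, hy'.2]

/-- Local existence of branches of the complex Green function. -/
lemma exists_isComplexGreenBranchAt {K : Set RSphere} (hK : IsClosed K) {c p : RSphere}
    (hG : IsGreenFunction Kᶜ c (greenFunction K c)) (hp : p ∈ Kᶜ) :
    ∃ r > 0, (∀ w ∈ Metric.ball (0 : ℂ) r, sphereParam p w ∈ Kᶜ) ∧ ∃ b : RSphere → ℂ,
      ∀ w ∈ Metric.ball (0 : ℂ) r, IsComplexGreenBranchAt K c (sphereParam p w) b := by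
  have hU : ∀ᶠ w in 𝓝 (0 : ℂ), sphereParam p w ∈ Kᶜ :=
    eventually_sphere_iff.1 (hK.isOpen_compl.mem_nhds hp)
  rcases eq_or_ne p c with rfl | hpc
  · obtain ⟨h, hh, hhG⟩ := hG.log_pole
    obtain ⟨r₁, hr₁, H, hH, hHh⟩ := HarmonicAt.exists_analyticOnNhd_ball hh
    obtain ⟨r₂, hr₂, hball⟩ := Metric.eventually_nhds_iff_ball.1
      (hU.and (eventually_nhdsWithin_iff.1 hhG))
    have hsub1 := Metric.ball_subset_ball (x := (0 : ℂ)) (min_le_left r₁ r₂)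
    have hsub2 := Metric.ball_subset_ball (x := (0 : ℂ)) (min_le_right r₁ r₂)
    refine ⟨min r₁ r₂, lt_min hr₁ hr₂, fun w hw => (hball w (hsub2 hw)).1,
      fun z => sphereChart p z * Complex.exp (-H (sphereChart p z)), fun w hw =>
        isComplexGreenBranchAt_of_chart (fun w hw => ?_) (fun w hw hwp => ?_) hw⟩
    · simp only [sphereChart_sphereParam]
      exact analyticAt_id.fun_mul (hH w (hsub1 hw)).fun_neg.cexp
    · have hw0 : w ≠ 0 := fun h0 => hwp (sphereParam_eq_self_iff.2 h0)
      -- a branch of the logarithm near `w`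
      set ℓ : ℂ → ℂ := fun x => Complex.log (x / w) + Complex.log w with hℓ
      have hℓa : AnalyticAt ℂ ℓ w := by
        refine AnalyticAt.fun_add (AnalyticAt.clog (by fun_prop) ?_) analyticAt_const
        rw [div_self hw0]
        exact Complex.one_mem_slitPlane
      have hℓe : ∀ x, x ≠ 0 → Complex.exp (ℓ x) = x := fun x hx => by
        rw [hℓ, Complex.exp_add, Complex.exp_log (div_ne_zero hx hw0), Complex.exp_log hw0,
          div_mul_cancel₀ _ hw0]
      refine ⟨fun x => H x - ℓ x, (hH w (hsub1 hw)).fun_sub hℓa, ?_⟩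
      filter_upwards [isOpen_ne.mem_nhds hw0, Metric.isOpen_ball.mem_nhds hw] with x hx hxb
      have h1 : Real.log ‖x‖ = (ℓ x).re := by
        rw [← Real.log_exp (ℓ x).re, ← Complex.norm_exp, hℓe x hx]
      constructor
      · rw [(hball x (hsub2 hxb)).2 hx, hHh x (hsub1 hxb), h1, Complex.sub_re]
        ring
      · rw [sphereChart_sphereParam, neg_sub, sub_eq_add_neg, Complex.exp_add, hℓe x hx]
  · obtain ⟨r₂, hr₂, hball⟩ := Metric.eventually_nhds_iff_ball.1
      (hU.and (eventually_sphere_iff.1 (isOpen_ne.mem_nhds hpc)))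
    obtain ⟨H, hH, hHh⟩ := HarmonicOnNhd.exists_analyticOnNhd_ball_re_eq
      (f := fun w => greenFunction K c (sphereParam p w)) (z := 0) (R := r₂) fun w hw =>
        sphereHarmonicAt_sphereParam_iff.1 (hG.harmonic _ (hball w hw).1 (hball w hw).2)
    refine ⟨r₂, hr₂, fun w hw => (hball w hw).1, fun z => Complex.exp (-H (sphereChart p z)),
      fun w hw => isComplexGreenBranchAt_of_chart (fun w hw => ?_) (fun w hw _ => ?_) hw⟩
    · simp only [sphereChart_sphereParam]
      exact (hH w hw).fun_neg.cexp
    · refine ⟨H, hH w hw, ?_⟩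
      filter_upwards [Metric.isOpen_ball.mem_nhds hw] with x hx
      exact ⟨(hHh hx).symm, by rw [sphereChart_sphereParam]⟩

/-- A continuation along `γ` followed by a fixed branch along `δ`, for the same branch at the
junction up to a unimodular factor. -/
lemma IsComplexGreenContinuation.exists_trans {K : Set RSphere} {c x y z : RSphere} {γ : Path x y}
    {δ : Path y z} {f : unitInterval → RSphere → ℂ} (hf : IsComplexGreenContinuation K c γ f)
    {b : RSphere → ℂ} (hb : ∀ t, IsComplexGreenBranchAt K c (δ t) b) :
    ∃ f', IsComplexGreenContinuation K c (γ.trans δ) f' := by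
  have h1 := hf.branch 1
  have h2 := hb 0
  rw [γ.target] at h1
  rw [δ.source] at h2
  obtain ⟨κ, hκ, hκb⟩ := h1.exists_unimodular h2
  let τ : unitInterval → unitInterval := fun t => Set.projIcc 0 1 zero_le_one (2 * (t : ℝ))
  have hτ : Continuous τ := continuous_projIcc.comp (by fun_prop)
  have hle : ∀ t : unitInterval, (t : ℝ) ≤ 1 / 2 → (γ.trans δ) t = γ (τ t) := fun t ht =>
    if_pos ht
  have hgt : ∀ t : unitInterval, ¬ (t : ℝ) ≤ 1 / 2 →
      (γ.trans δ) t = δ (Set.projIcc 0 1 zero_le_one (2 * (t : ℝ) - 1)) := fun t ht => if_neg ht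
  have hopen : IsOpen {t : unitInterval | ¬ (t : ℝ) ≤ 1 / 2} := by
    simp only [not_le]
    exact isOpen_lt continuous_const continuous_subtype_val
  refine ⟨fun t => if (t : ℝ) ≤ 1 / 2 then f (τ t) else fun q => κ * b q, ?_, ?_⟩
  · intro t
    by_cases ht : (t : ℝ) ≤ 1 / 2
    · rw [if_pos ht, hle t ht]
      exact hf.branch _
    · rw [if_neg ht, hgt t ht]
      exact (hb _).const_mul hκ
  · intro t
    by_cases ht : (t : ℝ) ≤ 1 / 2
    · have hcomp : ∀ᶠ s in 𝓝 t, f (τ s) =ᶠ[𝓝 (γ (τ s))] f (τ t) :=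
        hτ.continuousAt.eventually (hf.compatible (τ t))
      rcases ht.lt_or_eq with hlt | heq
      · have hlt' : ∀ᶠ s : unitInterval in 𝓝 t, (s : ℝ) < 1 / 2 :=
          (isOpen_lt continuous_subtype_val continuous_const).mem_nhds hlt
        filter_upwards [hcomp, hlt'] with s hs hs'
        rw [if_pos hs'.le, if_pos ht, hle s hs'.le]
        exact hs
      · have hτ1 : τ t = 1 := by
          simp only [τ, heq]
          norm_num
        have hjoin : ∀ᶠ s in 𝓝 t, ∀ᶠ q in 𝓝 ((γ.trans δ) s), f 1 q = κ * b q := by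
          have h3 : (γ.trans δ) t = y := by rw [hle t ht, hτ1, γ.target]
          have h4 : ∀ᶠ q in 𝓝 ((γ.trans δ) t), ∀ᶠ q' in 𝓝 q, f 1 q' = κ * b q' := by
            rw [h3]
            exact eventually_eventually_nhds.2 hκb
          exact (γ.trans δ).continuous.continuousAt.eventually h4
        filter_upwards [hcomp, hjoin] with s hs hs'
        rw [if_pos ht]
        by_cases hsle : (s : ℝ) ≤ 1 / 2
        · rw [if_pos hsle, hle s hsle]
          exact hs
        · rw [if_neg hsle, hτ1]
          exact hs'.mono fun q hq => hq.symm
    · filter_upwards [hopen.mem_nhds ht] with s hs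
      rw [if_neg hs, if_neg ht]

/-- Simultaneous continuation of finitely many complex Green functions is possible along a path to
any point: the set of points that are reached is open and closed. -/
lemma exists_continuation {K : Set RSphere} (hK : IsClosed K) (hconn : IsPreconnected Kᶜ)
    {S : Finset RSphere} (hG : ∀ c ∈ S, IsGreenFunction Kᶜ c (greenFunction K c))
    {x z : RSphere} (hx : x ∈ Kᶜ) (hz : z ∈ Kᶜ) :
    ∃ γ : Path x z, (∀ t, γ t ∈ Kᶜ) ∧ ∃ f : RSphere → unitInterval → RSphere → ℂ,
      ∀ c ∈ S, IsComplexGreenContinuation K c γ (f c) := by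
  classical
  set A : Set RSphere := {z | ∃ γ : Path x z, (∀ t, γ t ∈ Kᶜ) ∧
    ∃ f : RSphere → unitInterval → RSphere → ℂ,
      ∀ c ∈ S, IsComplexGreenContinuation K c γ (f c)} with hA
  have hAK : ∀ z ∈ A, z ∈ Kᶜ := by
    rintro z ⟨γ, hγ, -⟩
    have := hγ 1
    rwa [γ.target] at this
  have hloc : ∀ p ∈ Kᶜ, ∃ r > 0, (∀ w ∈ Metric.ball (0 : ℂ) r, sphereParam p w ∈ Kᶜ) ∧
      ∃ b : RSphere → RSphere → ℂ, ∀ c ∈ S, ∀ w ∈ Metric.ball (0 : ℂ) r,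
        IsComplexGreenBranchAt K c (sphereParam p w) (b c) := by
    intro p hp
    have h1 := fun c (hc : c ∈ S) => exists_isComplexGreenBranchAt hK (hG c hc) hp
    choose! ρ hρ hρK b hb using h1
    obtain ⟨r₀, hr₀, hr₀K⟩ := Metric.eventually_nhds_iff_ball.1
      (eventually_sphere_iff.1 (hK.isOpen_compl.mem_nhds hp))
    have h2 : ∀ᶠ r in 𝓝[>] (0 : ℝ), ∀ c ∈ S, r ≤ ρ c :=
      (Filter.eventually_all_finset S).2 fun c hc =>
        (eventually_le_nhds (hρ c hc)).filter_mono nhdsWithin_le_nhds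
    have h3 : ∀ᶠ r in 𝓝[>] (0 : ℝ), r ≤ r₀ :=
      (eventually_le_nhds hr₀).filter_mono nhdsWithin_le_nhds
    obtain ⟨r, hr, hr', hr0⟩ := (h2.and (h3.and self_mem_nhdsWithin)).exists
    exact ⟨r, hr0, fun w hw => hr₀K w (Metric.ball_subset_ball hr' hw), b, fun c hc w hw =>
      hb c hc w (Metric.ball_subset_ball (hr c hc) hw)⟩
  have hext : ∀ p ∈ Kᶜ, ∃ r > 0, ∀ w₁ ∈ Metric.ball (0 : ℂ) r, ∀ w₂ ∈ Metric.ball (0 : ℂ) r,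
      sphereParam p w₁ ∈ A → sphereParam p w₂ ∈ A := by
    intro p hp
    obtain ⟨r, hr, hrK, b, hb⟩ := hloc p hp
    refine ⟨r, hr, ?_⟩
    rintro w₁ hw₁ w₂ hw₂ ⟨γ, hγ, f, hf⟩
    obtain ⟨σ, hσ⟩ := ((convex_ball (0 : ℂ) r).isPathConnected ⟨w₁, hw₁⟩).joinedIn w₁ hw₁ w₂ hw₂
    have h1 := fun c (hc : c ∈ S) => (hf c hc).exists_trans
      (δ := σ.map (continuous_sphereParam p)) (b := b c) fun t => hb c hc _ (hσ t)
    choose! f' hf' using h1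
    refine ⟨γ.trans (σ.map (continuous_sphereParam p)), fun t => ?_, f', hf'⟩
    have h2 : (γ.trans (σ.map (continuous_sphereParam p))) t ∈
        Set.range (γ.trans (σ.map (continuous_sphereParam p))) := ⟨t, rfl⟩
    rw [Path.trans_range] at h2
    rcases h2 with ⟨s, hs⟩ | ⟨s, hs⟩
    · rw [← hs]
      exact hγ s
    · rw [← hs]
      exact hrK _ (hσ s)
  have hopen : IsOpen A := by
    rw [isOpen_iff_mem_nhds]
    intro p hp
    obtain ⟨r, hr, h⟩ := hext p (hAK p hp)
    refine eventually_sphere_iff.2 (eventually_of_mem (Metric.ball_mem_nhds 0 hr) fun w hw => ?_)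
    exact h 0 (Metric.mem_ball_self hr) w hw (by rwa [sphereParam_zero])
  have hxA : x ∈ A := by
    obtain ⟨r, hr, -, b, hb⟩ := hloc x hx
    refine ⟨Path.refl x, fun _ => hx, fun c _ => b c, fun c hc => ⟨fun t => ?_, fun t => ?_⟩⟩
    · have := hb c hc 0 (Metric.mem_ball_self hr)
      rwa [sphereParam_zero] at this
    · exact Eventually.of_forall fun s => EventuallyEq.rfl
  refine hconn.subset_of_closure_inter_subset hopen ⟨x, hx, hxA⟩ ?_ hz
  rintro p ⟨hpc, hpK⟩
  obtain ⟨r, hr, h⟩ := hext p hpK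
  have hnhds : sphereParam p '' Metric.ball 0 r ∈ 𝓝 p := by
    rw [← map_sphereParam_nhds_zero p]
    exact image_mem_map (Metric.ball_mem_nhds 0 hr)
  obtain ⟨_, ⟨w, hw, rfl⟩, hwA⟩ := mem_closure_iff_nhds.1 hpc _ hnhds
  have := h w hw 0 (Metric.mem_ball_self hr) hwA
  rwa [sphereParam_zero] at this

/-- A product of branches of the complex Green functions is a unimodular multiple of `B`. -/
lemma IsProperToDisc.exists_prod_eq {K : Set RSphere} (hK : IsClosed K) (hKne : K.Nonempty)
    {S : Finset RSphere} {m : RSphere → ℕ} {B : RSphere → ℂ} (hB : IsProperToDisc Kᶜ S m B)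
    {p : RSphere} (hp : p ∈ Kᶜ) {b : RSphere → RSphere → ℂ}
    (hb : ∀ c ∈ S, IsComplexGreenBranchAt K c p (b c)) :
    ∃ κ : ℂ, ‖κ‖ = 1 ∧ ∀ᶠ q in 𝓝 p, ∏ c ∈ S, b c q ^ m c = κ * B q := by
  have hne : Kᶜ ≠ Set.univ := fun h => by
    obtain ⟨k, hk⟩ := hKne
    have : k ∈ Kᶜ := by rw [h]; trivial
    exact this hk
  have hG : ∀ c ∈ S, IsGreenFunction Kᶜ c (greenFunction K c) := fun c hc =>
    isGreenFunction_greenFunction (hB.exists_isGreenFunction hK.isOpen_compl hc)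
  refine exists_unimodular_of_norm_eq ?_ (hB.analyticAt p hp) ?_
  · exact Finset.analyticAt_fun_prod S fun c hc => AnalyticAt.fun_pow (hb c hc).1 (m c)
  · have h1 : ∀ᶠ q in 𝓝[≠] p, ∀ c ∈ S, ‖b c q‖ = Real.exp (-greenFunction K c q) :=
      (Filter.eventually_all_finset S).2 fun c hc => (hb c hc).norm_eq
    filter_upwards [h1, eventually_nhdsNE_notMem p S,
      nhdsWithin_le_nhds (hK.isOpen_compl.mem_nhds hp)] with q hq hqS hqK
    have hBq := hB.ne_zero q hqK hqS
    refine ⟨hBq, ?_⟩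
    have h2 := hB.sum_greenFunction hK.isOpen_compl hne hG hqK hqS
    rw [norm_prod, ← Real.exp_log (norm_pos_iff.2 hBq), ← neg_neg (Real.log ‖B q‖), ← h2,
      ← Finset.sum_neg_distrib, Real.exp_sum]
    refine Finset.prod_congr rfl fun c hc => ?_
    rw [norm_pow, hq c hc, ← Real.exp_nat_mul]
    congr 1
    ring

/-- Along a continuation the product of the branches is a constant multiple of `B`. -/
lemma IsProperToDisc.prod_eq_of_continuation {K : Set RSphere} (hK : IsClosed K)
    (hKne : K.Nonempty) {S : Finset RSphere} {m : RSphere → ℕ} {B : RSphere → ℂ}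
    (hB : IsProperToDisc Kᶜ S m B) {x z : RSphere} {γ : Path x z} (hγ : ∀ t, γ t ∈ Kᶜ)
    {f : RSphere → unitInterval → RSphere → ℂ}
    (hf : ∀ c ∈ S, IsComplexGreenContinuation K c γ (f c)) :
    ∃ κ : ℂ, ‖κ‖ = 1 ∧ ∀ t, ∀ᶠ q in 𝓝 (γ t), ∏ c ∈ S, f c t q ^ m c = κ * B q := by
  have h1 : ∀ t, ∃ κ : ℂ, ‖κ‖ = 1 ∧ ∀ᶠ q in 𝓝 (γ t), ∏ c ∈ S, f c t q ^ m c = κ * B q :=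
    fun t => hB.exists_prod_eq hK hKne (hγ t) fun c hc => (hf c hc).branch t
  choose κ hκ hκB using h1
  have hloc : IsLocallyConstant κ := by
    rw [IsLocallyConstant.iff_eventually_eq]
    intro t
    have h2 : ∀ᶠ s in 𝓝 t, ∀ c ∈ S, f c s =ᶠ[𝓝 (γ s)] f c t :=
      (Filter.eventually_all_finset S).2 fun c hc => (hf c hc).compatible t
    have h3 : ∀ᶠ s in 𝓝 t, ∀ᶠ q in 𝓝 (γ s), ∏ c ∈ S, f c t q ^ m c = κ t * B q :=
      γ.continuous.continuousAt.eventually (eventually_eventually_nhds.2 (hκB t))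
    filter_upwards [h2, h3] with s hs hs'
    have h4 : ∀ᶠ q in 𝓝 (γ s), ∀ c ∈ S, f c s q = f c t q :=
      (Filter.eventually_all_finset S).2 fun c hc => hs c hc
    have h5 : ∀ᶠ q in 𝓝[≠] (γ s), ∏ c ∈ S, f c s q ^ m c = κ s * B q ∧
        ∏ c ∈ S, f c t q ^ m c = κ t * B q ∧ (∀ c ∈ S, f c s q = f c t q) ∧ q ∈ Kᶜ :=
      nhdsWithin_le_nhds ((hκB s).and (hs'.and (h4.and (hK.isOpen_compl.mem_nhds (hγ s)))))
    obtain ⟨q, ⟨h6, h7, h8, h9⟩, h10⟩ := (h5.and (eventually_nhdsNE_notMem (γ s) S)).exists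
    refine mul_right_cancel₀ (hB.ne_zero q h9 h10) ?_
    rw [← h6, ← h7]
    exact Finset.prod_congr rfl fun c hc => by rw [h8 c hc]
  refine ⟨κ 0, hκ 0, fun t => ?_⟩
  rw [hloc.apply_eq_of_isPreconnected isPreconnected_univ (Set.mem_univ 0) (Set.mem_univ t)]
  exact hκB t

/-- The multivalued product of complex Green functions is single-valued and equal to `B`. -/
theorem IsProperToDisc.isGreenProductValue_iff {D : RSphere →₀ ℕ} {xs : RSphere} {F : RatFunc ℂ}
    (hK : IsClosed (extensionSet F)) (hKne : (extensionSet F).Nonempty)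
    (hconn : IsPreconnected (extensionSet F)ᶜ) (hxs : xs ∈ (extensionSet F)ᶜ)
    {S : Finset RSphere} {B : RSphere → ℂ}
    (hB : IsProperToDisc (extensionSet F)ᶜ S (polarDivisor F) B)
    (hS : ∀ c, 0 < polarDivisor F c → c ∈ S) {l : ℝ} (hl : 0 < l)
    (hlim : Tendsto (fun x => B x * rKernel x xs ^ D xs) (𝓝[≠] xs) (𝓝 (l : ℂ)))
    {z : RSphere} (hz : z ∈ (extensionSet F)ᶜ) (w : ℂ) :
    IsGreenProductValue D xs F z w ↔ w = B z := by
  have hprod : ∀ b : RSphere → ℂ, ∏ᶠ c, b c ^ polarDivisor F c =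
      ∏ c ∈ S, b c ^ polarDivisor F c := fun b => by
    refine finprod_eq_prod_of_mulSupport_subset _ fun c hc => hS c ?_
    by_contra h
    rw [Function.mem_mulSupport, Nat.eq_zero_of_not_pos h, pow_zero] at hc
    exact hc rfl
  have key : ∀ w, IsGreenProductValue D xs F z w → w = B z := by
    rintro w ⟨γ, hγ, f, hf, u, hu, ⟨l', hl', hlim'⟩, rfl⟩
    obtain ⟨κ, hκ, hκB⟩ := hB.prod_eq_of_continuation hK hKne hγ fun c hc =>
      hf c (hB.order_pos c hc)
    have h0 : ∀ᶠ q in 𝓝 xs, ∏ c ∈ S, f c 0 q ^ polarDivisor F c = κ * B q := by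
      have := hκB 0
      rwa [γ.source] at this
    have h1 : B z * κ = ∏ c ∈ S, f c 1 z ^ polarDivisor F c := by
      have := hκB 1
      rw [γ.target] at this
      rw [this.self_of_nhds, mul_comm]
    -- the normalization forces `u * κ` to be positive, hence equal to `1`
    have h2 : Tendsto (fun x => (u * ∏ᶠ c, f c 0 x ^ polarDivisor F c) * rKernel x xs ^ D xs)
        (𝓝[≠] xs) (𝓝 (u * κ * l)) := by
      refine (hlim.const_mul (u * κ)).congr' ?_
      filter_upwards [nhdsWithin_le_nhds h0] with q hq
      rw [hprod fun c => f c 0 q, hq]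
      ring
    have h3 : (l' : ℂ) = u * κ * l := tendsto_nhds_unique hlim' h2
    have h4 : l' = l := by
      have := congrArg norm h3
      rwa [norm_mul, norm_mul, hu, hκ, one_mul, one_mul, Complex.norm_real, Complex.norm_real,
        Real.norm_of_nonneg hl'.le, Real.norm_of_nonneg hl.le] at this
    have hl0 : (l : ℂ) ≠ 0 := Complex.ofReal_ne_zero.2 hl.ne'
    have h5 : u * κ = 1 := by
      rw [h4] at h3
      exact mul_right_cancel₀ hl0 (by rw [one_mul]; exact h3.symm)
    rw [hprod fun c => f c 1 z, ← h1]
    linear_combination B z * h5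
  refine ⟨key w, ?_⟩
  rintro rfl
  have hG : ∀ c ∈ S, IsGreenFunction (extensionSet F)ᶜ c (greenFunction (extensionSet F) c) :=
    fun c hc => isGreenFunction_greenFunction (hB.exists_isGreenFunction hK.isOpen_compl hc)
  obtain ⟨γ, hγ, f, hf⟩ := exists_continuation hK hconn hG hxs hz
  obtain ⟨κ, hκ, hκB⟩ := hB.exists_prod_eq hK hKne hxs (b := fun c => f c 0) fun c hc => by
    have := (hf c hc).branch 0
    rwa [γ.source] at this
  have hκ0 : κ ≠ 0 := norm_pos_iff.1 (hκ ▸ one_pos)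
  have hval : IsGreenProductValue D xs F z (κ⁻¹ * ∏ᶠ c, f c 1 z ^ polarDivisor F c) := by
    refine ⟨γ, hγ, f, fun c hc => hf c (hS c hc), κ⁻¹, by rw [norm_inv, hκ, inv_one],
      ⟨l, hl, hlim.congr' ?_⟩, rfl⟩
    filter_upwards [nhdsWithin_le_nhds hκB] with q hq
    rw [hprod fun c => f c 0 q, hq, inv_mul_cancel_left₀ hκ0]
  rwa [← key _ hval]

/-! ### Homogeneous evaluation of polynomials on the sphere -/

open Polynomial in
/-- The value at a point of the sphere of a polynomial of degree at most `k`, regarded as a form of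
degree `k`: at `∞` it is the coefficient of `X ^ k`. -/
def homEval (k : ℕ) (P : ℂ[X]) : RSphere → ℂ
  | ∞ => P.coeff k
  | (z : ℂ) => P.eval z

open Polynomial in
/-- The dehomogenization in the chart centred at `p` of a form of degree `k`. -/
def chartPoly (k : ℕ) : RSphere → ℂ[X] → ℂ[X]
  | ∞ => fun P => P.reflect k
  | (z : ℂ) => fun P => P.comp (X + C z)

section Hom

open Polynomial

@[simp] lemma homEval_infty (k : ℕ) (P : ℂ[X]) : homEval k P ∞ = P.coeff k := rfl

@[simp] lemma homEval_coe (k : ℕ) (P : ℂ[X]) (z : ℂ) : homEval k P (z : RSphere) = P.eval z := rfl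

lemma chartPoly_infty (k : ℕ) (P : ℂ[X]) : chartPoly k ∞ P = P.reflect k := rfl

lemma chartPoly_coe (k : ℕ) (P : ℂ[X]) (z : ℂ) :
    chartPoly k (z : RSphere) P = P.comp (X + C z) := rfl

@[simp] lemma homEval_add (k : ℕ) (P Q : ℂ[X]) (p : RSphere) :
    homEval k (P + Q) p = homEval k P p + homEval k Q p := by
  induction p using OnePoint.rec <;> simp

@[simp] lemma homEval_sub (k : ℕ) (P Q : ℂ[X]) (p : RSphere) :
    homEval k (P - Q) p = homEval k P p - homEval k Q p := by
  induction p using OnePoint.rec <;> simp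

@[simp] lemma homEval_C_mul (k : ℕ) (a : ℂ) (P : ℂ[X]) (p : RSphere) :
    homEval k (C a * P) p = a * homEval k P p := by
  induction p using OnePoint.rec <;> simp

lemma homEval_mul {k l : ℕ} {P Q : ℂ[X]} (hP : P.natDegree ≤ k) (hQ : Q.natDegree ≤ l)
    (p : RSphere) : homEval (k + l) (P * Q) p = homEval k P p * homEval l Q p := by
  induction p using OnePoint.rec with
  | infty => exact coeff_mul_add_eq_of_natDegree_le hP hQ
  | coe z => simp

@[simp] lemma eval_chartPoly_zero (k : ℕ) (p : RSphere) (P : ℂ[X]) :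
    (chartPoly k p P).eval 0 = homEval k P p := by
  induction p using OnePoint.rec with
  | infty => simp [chartPoly_infty, ← coeff_zero_eq_eval_zero, coeff_reflect]
  | coe z => simp [chartPoly_coe]

lemma chartPoly_mul {k l : ℕ} {P Q : ℂ[X]} (hP : P.natDegree ≤ k) (hQ : Q.natDegree ≤ l)
    (p : RSphere) : chartPoly (k + l) p (P * Q) = chartPoly k p P * chartPoly l p Q := by
  induction p using OnePoint.rec with
  | infty => exact reflect_mul P Q hP hQ
  | coe z => simp [chartPoly_coe]

/-- Evaluating a form in the chart multiplies it by a nonvanishing factor, independent of the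
form. -/
lemma exists_homEval_sphereParam (k : ℕ) (p : RSphere) : ∃ σ : ℂ → ℂ, (∀ w, σ w ≠ 0) ∧
    ∀ P : ℂ[X], P.natDegree ≤ k → ∀ w,
      homEval k P (sphereParam p w) = σ w * (chartPoly k p P).eval w := by
  induction p using OnePoint.rec with
  | coe z => exact ⟨fun _ => 1, by simp, fun P _ w => by simp [chartPoly_coe, add_comm]⟩
  | infty =>
    refine ⟨fun w => if w = 0 then 1 else (w ^ k)⁻¹, fun w => ?_, fun P hP w => ?_⟩
    · by_cases hw : w = 0
      · simp [hw]
      · simp [hw]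
    · by_cases hw : w = 0
      · subst hw
        simp
      · let _ := invertibleOfNonzero (inv_ne_zero hw)
        have h1 := eval₂_reflect_mul_pow (RingHom.id ℂ) w⁻¹ k P hP
        rw [invOf_eq_inv, inv_inv, inv_pow] at h1
        simp only [sphereParam_infty_of_ne hw, homEval_coe, chartPoly_infty, if_neg hw]
        rw [← eval₂_id, ← eval₂_id, ← h1, mul_comm]

lemma sphereAnalyticAt_homEval_div {k : ℕ} {P Q : ℂ[X]} (hP : P.natDegree ≤ k)
    (hQ : Q.natDegree ≤ k) {p : RSphere} (hp : homEval k Q p ≠ 0) :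
    SphereAnalyticAt (fun z => homEval k P z / homEval k Q z) p := by
  obtain ⟨σ, hσ, h⟩ := exists_homEval_sphereParam k p
  have h1 : (fun w => homEval k P (sphereParam p w) / homEval k Q (sphereParam p w)) =
      fun w => (chartPoly k p P).eval w / (chartPoly k p Q).eval w := by
    funext w
    rw [h P hP, h Q hQ, mul_div_mul_left _ _ (hσ w)]
  have h2 : AnalyticAt ℂ (fun w => (chartPoly k p P).eval w / (chartPoly k p Q).eval w) 0 := by
    refine AnalyticAt.div ?_ ?_ (by simpa using hp)
    · exact (chartPoly k p P).differentiable.analyticAt 0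
    · exact (chartPoly k p Q).differentiable.analyticAt 0
  rw [← h1] at h2
  exact h2

lemma eventually_homEval_ne_zero {k : ℕ} {P : ℂ[X]} (hP : P.natDegree ≤ k) {p : RSphere}
    (hp : homEval k P p ≠ 0) : ∀ᶠ q in 𝓝 p, homEval k P q ≠ 0 := by
  obtain ⟨σ, hσ, h⟩ := exists_homEval_sphereParam k p
  rw [eventually_sphere_iff]
  have h1 : ContinuousAt (fun w => (chartPoly k p P).eval w) 0 :=
    (chartPoly k p P).continuous.continuousAt
  filter_upwards [h1.eventually_ne (by simpa using hp)] with w hw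
  rw [h P hP]
  exact mul_ne_zero (hσ w) hw

/-- A quotient of two forms of the same degree represents the values of a rational function. -/
lemma ratValue_eq_homEval_div {F : RatFunc ℂ} {k : ℕ} {P Q : ℂ[X]} (hP : P.natDegree ≤ k)
    (hQ : Q.natDegree ≤ k) (hF : F.num * Q = P * F.denom) {z : RSphere} (hz : homEval k Q z ≠ 0) :
    ratValue F z = ((homEval k P z / homEval k Q z : ℂ) : RSphere) := by
  have hM := F.denom_ne_zero
  induction z using OnePoint.rec with
  | coe z =>
    simp only [homEval_coe] at hz ⊢
    have h1 : F.num.eval z * Q.eval z = P.eval z * F.denom.eval z := by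
      rw [← eval_mul, ← eval_mul, hF]
    have h2 : F.denom.eval z ≠ 0 := by
      intro h0
      rw [h0, mul_zero] at h1
      have h3 := (mul_eq_zero.1 h1).resolve_right hz
      obtain ⟨a, b, hab⟩ := F.isCoprime_num_denom
      have := congrArg (eval z) hab
      simp [h0, h3] at this
    simp only [ratValue, if_neg h2]
    congr 1
    field_simp
    linear_combination h1
  | infty =>
    simp only [homEval_infty] at hz ⊢
    have hQk : Q.natDegree = k := le_antisymm hQ (le_natDegree_of_ne_zero hz)
    have hQ0 : Q ≠ 0 := by rintro rfl; simp at hz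
    have hle : F.num.natDegree ≤ F.denom.natDegree := by
      by_cases hN : F.num = 0
      · simp [hN]
      have h1 := congrArg natDegree hF
      have hP0 : P ≠ 0 := by
        rintro rfl
        rw [zero_mul] at hF
        exact (mul_ne_zero hN hQ0) hF
      rw [natDegree_mul hN hQ0, natDegree_mul hP0 hM] at h1
      omega
    have h1 : F.num.coeff F.denom.natDegree * Q.coeff k = P.coeff k * F.denom.leadingCoeff := by
      rw [← coeff_mul_add_eq_of_natDegree_le hle hQ, hF, add_comm,
        coeff_mul_add_eq_of_natDegree_le hP le_rfl]
      rfl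
    have h2 : F.denom.leadingCoeff ≠ 0 := leadingCoeff_ne_zero.2 hM
    simp only [ratValue, if_neg hle.not_gt]
    congr 1
    field_simp
    linear_combination h1

/-- The degree of a rational function as a map of the sphere. Its numerator and denominator are
regarded as forms of this degree; they have no common zero on the sphere. -/
def ratDegree (F : RatFunc ℂ) : ℕ := max F.num.natDegree F.denom.natDegree

lemma natDegree_num_le_ratDegree (F : RatFunc ℂ) : F.num.natDegree ≤ ratDegree F := le_max_left _ _

lemma natDegree_denom_le_ratDegree (F : RatFunc ℂ) : F.denom.natDegree ≤ ratDegree F :=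
  le_max_right _ _

lemma ratValue_of_denom_ne_zero {F : RatFunc ℂ} {z : RSphere}
    (hz : homEval (ratDegree F) F.denom z ≠ 0) : ratValue F z =
      ((homEval (ratDegree F) F.num z / homEval (ratDegree F) F.denom z : ℂ) : RSphere) :=
  ratValue_eq_homEval_div (natDegree_num_le_ratDegree F) (natDegree_denom_le_ratDegree F) rfl hz

lemma ratValue_of_denom_eq_zero {F : RatFunc ℂ} {z : RSphere}
    (hz : homEval (ratDegree F) F.denom z = 0) : ratValue F z = ∞ := by
  induction z using OnePoint.rec with
  | coe z => simpa [ratValue] using hz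
  | infty =>
    simp only [homEval_infty] at hz
    have h : F.denom.natDegree < F.num.natDegree := by
      by_contra h
      rw [ratDegree, max_eq_right (not_lt.1 h)] at hz
      exact F.denom_ne_zero (leadingCoeff_eq_zero.1 hz)
    simp [ratValue, h]

lemma homEval_num_ne_zero {F : RatFunc ℂ} {z : RSphere}
    (hz : homEval (ratDegree F) F.denom z = 0) : homEval (ratDegree F) F.num z ≠ 0 := by
  induction z using OnePoint.rec with
  | coe z =>
    simp only [homEval_coe] at hz ⊢
    intro h0
    obtain ⟨a, b, hab⟩ := F.isCoprime_num_denom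
    have := congrArg (eval z) hab
    simp [h0, hz] at this
  | infty =>
    simp only [homEval_infty] at hz ⊢
    have h : F.denom.natDegree < F.num.natDegree := by
      by_contra h
      rw [ratDegree, max_eq_right (not_lt.1 h)] at hz
      exact F.denom_ne_zero (leadingCoeff_eq_zero.1 hz)
    rw [ratDegree, max_eq_left h.le]
    intro h0
    rw [leadingCoeff_eq_zero.1 h0] at h
    simp at h

lemma affineCoord_ratValue (F : RatFunc ℂ) (z : RSphere) : affineCoord (ratValue F z) =
    homEval (ratDegree F) F.num z / homEval (ratDegree F) F.denom z := by
  by_cases hz : homEval (ratDegree F) F.denom z = 0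
  · simp [ratValue_of_denom_eq_zero hz, hz]
  · simp [ratValue_of_denom_ne_zero hz]

lemma inv_affineCoord_ratValue (F : RatFunc ℂ) (z : RSphere) : (affineCoord (ratValue F z))⁻¹ =
    homEval (ratDegree F) F.denom z / homEval (ratDegree F) F.num z := by
  rw [affineCoord_ratValue, inv_div]

lemma continuousAt_affineCoord_ratValue {F : RatFunc ℂ} {p : RSphere}
    (h : homEval (ratDegree F) F.denom p ≠ 0) :
    ContinuousAt (fun z => affineCoord (ratValue F z)) p := by
  have := (sphereAnalyticAt_homEval_div (natDegree_num_le_ratDegree F)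
    (natDegree_denom_le_ratDegree F) h).continuousAt
  simpa only [affineCoord_ratValue] using this

/-- The order of vanishing of the denominator is the order of the pole. -/
lemma exists_chartPoly_denom (F : RatFunc ℂ) (c : RSphere) : ∃ U : ℂ[X], U.eval 0 ≠ 0 ∧
    chartPoly (ratDegree F) c F.denom = X ^ polarDivisor F c * U := by
  have hM := F.denom_ne_zero
  induction c using OnePoint.rec with
  | coe z =>
    obtain ⟨q, hq, hdvd⟩ := exists_eq_pow_rootMultiplicity_mul_and_not_dvd F.denom hM z
    refine ⟨q.comp (X + C z), ?_, ?_⟩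
    · rw [dvd_iff_isRoot, IsRoot] at hdvd
      simpa using hdvd
    · rw [chartPoly_coe]
      conv_lhs => rw [hq]
      simp [polarDivisor]
  | infty =>
    refine ⟨F.denom.reverse, ?_, ?_⟩
    · rw [← coeff_zero_eq_eval_zero, coeff_zero_reverse]
      exact leadingCoeff_ne_zero.2 hM
    · have h1 : ratDegree F = F.denom.natDegree + (F.num.natDegree - F.denom.natDegree) := by
        rw [ratDegree]; omega
      have h2 := reflect_mul F.denom 1 le_rfl
        (show (1 : ℂ[X]).natDegree ≤ F.num.natDegree - F.denom.natDegree by simp)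
      rw [mul_one, ← h1, reflect_one] at h2
      rw [chartPoly_infty, h2, mul_comm]
      rfl

lemma polarDivisor_pos_iff {F : RatFunc ℂ} {c : RSphere} :
    0 < polarDivisor F c ↔ homEval (ratDegree F) F.denom c = 0 := by
  obtain ⟨U, hU, h⟩ := exists_chartPoly_denom F c
  rw [← eval_chartPoly_zero, h]
  simp [hU, Nat.pos_iff_ne_zero]

end Hom

/-! ### The set where a rational function takes values in `[-1, 1]` -/

lemma exists_ratValue_of_mem_extensionSet {F : RatFunc ℂ} {z : RSphere} (hz : z ∈ extensionSet F) :
    homEval (ratDegree F) F.denom z ≠ 0 ∧ ∃ t : ℝ, t ∈ Set.Icc (-1) 1 ∧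
      homEval (ratDegree F) F.num z / homEval (ratDegree F) F.denom z = t := by
  obtain ⟨t, ht, h⟩ := hz
  have h1 : homEval (ratDegree F) F.denom z ≠ 0 := by
    intro h0
    rw [ratValue_of_denom_eq_zero h0] at h
    exact OnePoint.infty_ne_coe _ h
  refine ⟨h1, t, ht, ?_⟩
  rw [ratValue_of_denom_ne_zero h1] at h
  exact OnePoint.coe_injective h

lemma homEval_num_ne_zero_of_notMem {F : RatFunc ℂ} {z : RSphere} (hz : z ∉ extensionSet F) :
    homEval (ratDegree F) F.num z ≠ 0 := by
  intro h0
  by_cases h1 : homEval (ratDegree F) F.denom z = 0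
  · exact homEval_num_ne_zero h1 h0
  · exact hz ⟨0, by simp, by rw [ratValue_of_denom_ne_zero h1, h0]; simp⟩

lemma isClosed_extensionSet (F : RatFunc ℂ) : IsClosed (extensionSet F) := by
  have hN := natDegree_num_le_ratDegree F
  have hM := natDegree_denom_le_ratDegree F
  rw [← isOpen_compl_iff, isOpen_iff_mem_nhds]
  intro z hz
  by_cases h1 : homEval (ratDegree F) F.denom z = 0
  · have h2 := (sphereAnalyticAt_homEval_div hM hN (homEval_num_ne_zero h1)).continuousAt
    have h3 := h2.norm.eventually_lt_const (u := 1) (by simp [h1])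
    filter_upwards [h3, eventually_homEval_ne_zero hN (homEval_num_ne_zero h1)] with q hq hq0 hqK
    obtain ⟨h4, t, ht, h5⟩ := exists_ratValue_of_mem_extensionSet hqK
    have h6 : ‖homEval (ratDegree F) F.num q / homEval (ratDegree F) F.denom q‖ ≤ 1 := by
      rw [h5, Complex.norm_real]
      exact abs_le.2 ht
    rw [norm_div, div_lt_one (norm_pos_iff.2 hq0)] at hq
    rw [norm_div, div_le_one (norm_pos_iff.2 h4)] at h6
    exact absurd h6 hq.not_ge
  · have h2 := (sphereAnalyticAt_homEval_div hN hM h1).continuousAt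
    have h3 : IsClosed ((fun t : ℝ => (t : ℂ)) '' Set.Icc (-1) 1) :=
      (isCompact_Icc.image Complex.continuous_ofReal).isClosed
    have h4 := h2.eventually_mem (h3.isOpen_compl.mem_nhds (by
      rintro ⟨t, ht, h⟩
      exact hz ⟨t, ht, by rw [ratValue_of_denom_ne_zero h1, ← h]⟩))
    filter_upwards [h4] with q hq hqK
    obtain ⟨h4, t, ht, h5⟩ := exists_ratValue_of_mem_extensionSet hqK
    exact hq ⟨t, ht, h5.symm⟩

/-! ### The inverse of the Joukowsky map -/

/-- The branch with values in the unit disc of the inverse of the Joukowsky map, as a function of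
the reciprocal `s` of the value. -/
def joukowskyInv (s : ℂ) : ℂ := s / (1 + (1 - s ^ 2) ^ (2⁻¹ : ℂ))

lemma re_cpow_inv_two_pos {a : ℂ} (ha : a ∈ Complex.slitPlane) : 0 < (a ^ (2⁻¹ : ℂ)).re := by
  rw [Complex.cpow_inv_two_re]
  apply Real.sqrt_pos.2
  rcases Complex.mem_slitPlane_iff.1 ha with h | h
  · have := norm_nonneg a
    linarith
  · have := neg_abs_le a.re
    have := Complex.abs_re_lt_norm.2 h
    linarith

/-- The principal square root in `joukowskyInv` is analytic unless `1 / s` is in `[-1, 1]`. -/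
lemma one_sub_sq_mem_slitPlane {s : ℂ} (hs : ∀ t : ℝ, t ∈ Set.Icc (-1) 1 → s * t ≠ 1) :
    1 - s ^ 2 ∈ Complex.slitPlane := by
  by_contra h
  rw [Complex.mem_slitPlane_iff] at h
  push Not at h
  obtain ⟨h1, h2⟩ := h
  simp only [sq, Complex.sub_re, Complex.one_re, Complex.mul_re, Complex.sub_im, Complex.one_im,
    Complex.mul_im] at h1 h2
  have ha : s.re ≠ 0 := by
    intro h0
    rw [h0] at h1
    nlinarith [sq_nonneg s.im]
  have hb : s.im = 0 := by
    have : s.re * s.im = 0 := by linarith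
    exact (mul_eq_zero.1 this).resolve_left ha
  have hsr : s = (s.re : ℂ) := Complex.ext rfl (by simp [hb])
  refine hs s.re⁻¹ ?_ ?_
  · rw [Set.mem_Icc, ← abs_le, abs_inv]
    apply inv_le_one_of_one_le₀
    rw [hb] at h1
    rw [← one_le_sq_iff_one_le_abs]
    linarith
  · conv_lhs => rw [hsr]
    push_cast
    exact mul_inv_cancel₀ (by exact_mod_cast ha)

lemma exists_joukowskyInv_eq_div {s : ℂ} (hs : 1 - s ^ 2 ∈ Complex.slitPlane) :
    ∃ r : ℂ, 0 < r.re ∧ r ^ 2 = 1 - s ^ 2 ∧ 1 + r ≠ 0 ∧ joukowskyInv s = s / (1 + r) := by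
  have h := re_cpow_inv_two_pos hs
  refine ⟨(1 - s ^ 2) ^ (2⁻¹ : ℂ), h, ?_, ?_, rfl⟩
  · exact Complex.cpow_ofNat_inv_pow _ 2
  · intro h0
    have := congrArg Complex.re h0
    simp at this
    linarith

lemma analyticAt_joukowskyInv {s : ℂ} (hs : 1 - s ^ 2 ∈ Complex.slitPlane) :
    AnalyticAt ℂ joukowskyInv s := by
  obtain ⟨r, -, -, h2, h3⟩ := exists_joukowskyInv_eq_div hs
  have h := re_cpow_inv_two_pos hs
  refine AnalyticAt.div analyticAt_id (analyticAt_const.add ?_) ?_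
  · exact AnalyticAt.cpow (by fun_prop) analyticAt_const hs
  · intro h0
    have := congrArg Complex.re h0
    simp at this
    linarith

lemma norm_joukowskyInv_lt_one {s : ℂ} (hs : 1 - s ^ 2 ∈ Complex.slitPlane) :
    ‖joukowskyInv s‖ < 1 := by
  obtain ⟨r, hr, h1, h2, h3⟩ := exists_joukowskyInv_eq_div hs
  rw [h3, norm_div, div_lt_one (norm_pos_iff.2 h2)]
  have h4 : s ^ 2 = (1 - r) * (1 + r) := by linear_combination h1
  have h5 : ‖s‖ ^ 2 = ‖1 - r‖ * ‖1 + r‖ := by rw [← norm_pow, h4, norm_mul]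
  have h6 : ‖1 - r‖ < ‖1 + r‖ := by
    apply lt_of_pow_lt_pow_left₀ 2 (norm_nonneg _)
    rw [Complex.sq_norm, Complex.sq_norm, Complex.normSq_apply, Complex.normSq_apply]
    simp
    nlinarith
  apply lt_of_pow_lt_pow_left₀ 2 (norm_nonneg _)
  rw [h5, sq]
  exact mul_lt_mul_of_pos_right h6 (norm_pos_iff.2 h2)

lemma joukowskyInv_eq_zero_iff {s : ℂ} (hs : 1 - s ^ 2 ∈ Complex.slitPlane) :
    joukowskyInv s = 0 ↔ s = 0 := by
  obtain ⟨r, -, -, h2, h3⟩ := exists_joukowskyInv_eq_div hs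
  simp [h3, h2]

lemma joukowskyInv_add_inv {s : ℂ} (hs : 1 - s ^ 2 ∈ Complex.slitPlane) (h0 : s ≠ 0) :
    joukowskyInv s + 1 / joukowskyInv s = 2 * s⁻¹ := by
  obtain ⟨r, -, h1, h2, h3⟩ := exists_joukowskyInv_eq_div hs
  rw [h3]
  field_simp
  linear_combination h1

/-- The image under the Joukowsky map of the circle of radius `‖w‖` is an ellipse with foci `±1`. -/
lemma one_sub_norm_sq_le {w f : ℂ} (hw : w ≠ 0) (hw1 : ‖w‖ < 1) (h : w + 1 / w = 2 * f) :
    (1 - ‖w‖) ^ 2 ≤ ‖f - 1‖ + ‖f + 1‖ - 2 := by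
  have hpos := norm_pos_iff.2 hw
  have h1 : f - 1 = (w - 1) ^ 2 / (2 * w) := by
    field_simp at h ⊢
    linear_combination -h
  have h2 : f + 1 = (w + 1) ^ 2 / (2 * w) := by
    field_simp at h ⊢
    linear_combination -h
  have h3 : ‖w - 1‖ ^ 2 + ‖w + 1‖ ^ 2 = 2 * ‖w‖ ^ 2 + 2 := by
    simp only [Complex.sq_norm, Complex.normSq_apply]
    simp
    ring
  have h4 : ‖f - 1‖ + ‖f + 1‖ = (‖w‖ ^ 2 + 1) / ‖w‖ := by
    rw [h1, h2, norm_div, norm_div, norm_pow, norm_pow, norm_mul]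
    have : ‖(2 : ℂ)‖ = 2 := by simp
    rw [this, ← add_div, h3]
    field_simp
  rw [h4, le_sub_iff_add_le, le_div_iff₀ hpos]
  nlinarith [sq_nonneg (1 - ‖w‖)]

/-! ### The inverse of the Joukowsky map composed with a rational function -/

/-- The composition of a rational function with the inverse of the Joukowsky map. -/
def ratJoukowskyInv (F : RatFunc ℂ) (z : RSphere) : ℂ := joukowskyInv (affineCoord (ratValue F z))⁻¹

lemma one_sub_sq_ratValue_mem {F : RatFunc ℂ} {z : RSphere} (hz : z ∉ extensionSet F) :
    1 - (affineCoord (ratValue F z))⁻¹ ^ 2 ∈ Complex.slitPlane := by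
  apply one_sub_sq_mem_slitPlane
  intro t ht h
  have h1 : homEval (ratDegree F) F.denom z ≠ 0 := by
    intro h0
    rw [ratValue_of_denom_eq_zero h0] at h
    simp at h
  apply hz
  refine ⟨t, ht, ?_⟩
  have h2 := ratValue_of_denom_ne_zero h1
  rw [h2, affineCoord_coe] at h
  rw [h2, eq_inv_of_mul_eq_one_right h, inv_inv]

lemma affineCoord_ratValue_eq_zero_iff {F : RatFunc ℂ} {z : RSphere} (hz : z ∉ extensionSet F) :
    affineCoord (ratValue F z) = 0 ↔ homEval (ratDegree F) F.denom z = 0 := by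
  rw [affineCoord_ratValue, div_eq_zero_iff]
  simp [homEval_num_ne_zero_of_notMem hz]

lemma sphereAnalyticAt_inv_ratValue {F : RatFunc ℂ} {z : RSphere} (hz : z ∉ extensionSet F) :
    SphereAnalyticAt (fun q => (affineCoord (ratValue F q))⁻¹) z := by
  simp only [inv_affineCoord_ratValue]
  exact sphereAnalyticAt_homEval_div (natDegree_denom_le_ratDegree F)
    (natDegree_num_le_ratDegree F) (homEval_num_ne_zero_of_notMem hz)

lemma sphereAnalyticAt_ratJoukowskyInv {F : RatFunc ℂ} {z : RSphere} (hz : z ∉ extensionSet F) :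
    SphereAnalyticAt (ratJoukowskyInv F) z := by
  have h := analyticAt_joukowskyInv (one_sub_sq_ratValue_mem hz)
  refine AnalyticAt.comp (f := fun w => (affineCoord (ratValue F (sphereParam z w)))⁻¹) ?_
    (sphereAnalyticAt_inv_ratValue hz)
  simpa using h

lemma ratValue_eq_joukowsky {F : RatFunc ℂ} {z : RSphere} (hz : z ∉ extensionSet F) :
    ratValue F z = joukowsky (ratJoukowskyInv F z) := by
  have h := one_sub_sq_ratValue_mem hz
  by_cases h0 : affineCoord (ratValue F z) = 0
  · have h1 := (affineCoord_ratValue_eq_zero_iff hz).1 h0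
    simp [ratValue_of_denom_eq_zero h1, ratJoukowskyInv, joukowskyInv, joukowsky]
  · have h1 : homEval (ratDegree F) F.denom z ≠ 0 := by
      rwa [Ne, ← affineCoord_ratValue_eq_zero_iff hz]
    have h2 := joukowskyInv_add_inv h (inv_ne_zero h0)
    have h3 : joukowskyInv (affineCoord (ratValue F z))⁻¹ ≠ 0 := by
      rw [Ne, joukowskyInv_eq_zero_iff h]
      exact inv_ne_zero h0
    rw [joukowsky, ratJoukowskyInv, if_neg h3, h2, inv_inv, ratValue_of_denom_ne_zero h1,
      affineCoord_coe]
    congr 1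
    ring

lemma tendsto_norm_ratJoukowskyInv {F : RatFunc ℂ} {ζ : RSphere} (hζ : ζ ∈ extensionSet F) :
    Tendsto (fun z => ‖ratJoukowskyInv F z‖) (𝓝[(extensionSet F)ᶜ] ζ) (𝓝 1) := by
  obtain ⟨h1, t, ht, h2⟩ := exists_ratValue_of_mem_extensionSet hζ
  have hN := natDegree_num_le_ratDegree F
  have hM := natDegree_denom_le_ratDegree F
  set f : RSphere → ℂ := fun z => affineCoord (ratValue F z) with hf
  have hfc : ContinuousAt f ζ := continuousAt_affineCoord_ratValue h1
  have hfζ : f ζ = t := by rw [hf]; simp only [affineCoord_ratValue]; exact h2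
  have hlim : Tendsto (fun z => 1 - √(‖f z - 1‖ + ‖f z + 1‖ - 2)) (𝓝[(extensionSet F)ᶜ] ζ)
      (𝓝 1) := by
    have h3 : ContinuousAt (fun z => 1 - √(‖f z - 1‖ + ‖f z + 1‖ - 2)) ζ := by fun_prop
    have h4 : 1 - √(‖f ζ - 1‖ + ‖f ζ + 1‖ - 2) = 1 := by
      have h5 : ‖f ζ - 1‖ = 1 - t := by
        rw [hfζ, ← Complex.ofReal_one, ← Complex.ofReal_sub, Complex.norm_real, Real.norm_eq_abs,
          abs_of_nonpos (by linarith [ht.2])]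
        ring
      have h6 : ‖f ζ + 1‖ = 1 + t := by
        rw [hfζ, ← Complex.ofReal_one, ← Complex.ofReal_add, Complex.norm_real, Real.norm_eq_abs,
          abs_of_nonneg (by linarith [ht.1])]
        ring
      rw [h5, h6]
      ring_nf
      simp
    have h5 := h3.tendsto
    rw [h4] at h5
    exact h5.mono_left nhdsWithin_le_nhds
  refine tendsto_of_tendsto_of_tendsto_of_le_of_le' hlim tendsto_const_nhds ?_ ?_
  · filter_upwards [self_mem_nhdsWithin,
      nhdsWithin_le_nhds (eventually_homEval_ne_zero hM h1)] with z hz hMz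
    have h := one_sub_sq_ratValue_mem hz
    have h0 : f z ≠ 0 := by rwa [Ne, hf, affineCoord_ratValue_eq_zero_iff hz]
    have h3 : ratJoukowskyInv F z ≠ 0 := by
      rw [ratJoukowskyInv, Ne, joukowskyInv_eq_zero_iff h]
      exact inv_ne_zero h0
    have h4 := one_sub_norm_sq_le h3 (norm_joukowskyInv_lt_one h)
      (joukowskyInv_add_inv h (inv_ne_zero h0))
    rw [inv_inv] at h4
    have h5 := Real.le_sqrt_of_sq_le h4
    linarith
  · filter_upwards [self_mem_nhdsWithin] with z hz
    exact (norm_joukowskyInv_lt_one (one_sub_sq_ratValue_mem hz)).le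

/-- `ratJoukowskyInv F` is a proper map of the complement of `extensionSet F` to the unit disc whose
zeros are the poles of `F`. -/
theorem isProperToDisc_ratJoukowskyInv {F : RatFunc ℂ} {S : Finset RSphere}
    (hS : ∀ c, c ∈ S ↔ 0 < polarDivisor F c) :
    IsProperToDisc (extensionSet F)ᶜ S (polarDivisor F) (ratJoukowskyInv F) where
  analyticAt z hz := sphereAnalyticAt_ratJoukowskyInv hz
  norm_lt_one z hz := norm_joukowskyInv_lt_one (one_sub_sq_ratValue_mem hz)
  tendsto_frontier ζ hζ := by
    rw [frontier_compl] at hζ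
    exact tendsto_norm_ratJoukowskyInv ((isClosed_extensionSet F).frontier_subset hζ)
  mem_of_zero c hc hcK :=
    (exists_ratValue_of_mem_extensionSet hcK).1 (polarDivisor_pos_iff.1 ((hS c).1 hc))
  ne_zero z hz hzS := by
    rw [ratJoukowskyInv, Ne, joukowskyInv_eq_zero_iff (one_sub_sq_ratValue_mem hz), inv_eq_zero,
      affineCoord_ratValue_eq_zero_iff hz, ← polarDivisor_pos_iff, ← hS]
    exact hzS
  order_pos c hc := (hS c).1 hc
  factor c hc := by
    have h0 := polarDivisor_pos_iff.1 ((hS c).1 hc)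
    have hN0 := homEval_num_ne_zero h0
    have hcK : c ∉ extensionSet F := fun h => (exists_ratValue_of_mem_extensionSet h).1 h0
    obtain ⟨U, hU, hfac⟩ := exists_chartPoly_denom F c
    obtain ⟨σ, hσ, hev⟩ := exists_homEval_sphereParam (ratDegree F) c
    set N' := chartPoly (ratDegree F) c F.num with hN'
    have hN'0 : N'.eval 0 ≠ 0 := by simpa [hN'] using hN0
    set s : ℂ → ℂ := fun w => (affineCoord (ratValue F (sphereParam c w)))⁻¹ with hs
    have hs1 : ∀ w, s w = w ^ polarDivisor F c * (U.eval w / N'.eval w) := by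
      intro w
      simp only [hs, inv_affineCoord_ratValue]
      rw [hev _ (natDegree_denom_le_ratDegree F), hev _ (natDegree_num_le_ratDegree F),
        mul_div_mul_left _ _ (hσ w), hfac]
      rw [Polynomial.eval_mul, Polynomial.eval_pow, Polynomial.eval_X, mul_div_assoc]
    have hs0 : s 0 = 0 := by rw [hs1, zero_pow ((hS c).1 hc).ne', zero_mul]
    have hsa : AnalyticAt ℂ s 0 := sphereAnalyticAt_inv_ratValue hcK
    refine ⟨fun w => U.eval w / N'.eval w / (1 + (1 - s w ^ 2) ^ (2⁻¹ : ℂ)), ?_, ?_, ?_⟩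
    · refine AnalyticAt.div (AnalyticAt.div ?_ ?_ hN'0) (analyticAt_const.add
        (AnalyticAt.cpow (analyticAt_const.sub (hsa.pow 2)) analyticAt_const ?_)) ?_
      · exact U.differentiable.analyticAt 0
      · exact N'.differentiable.analyticAt 0
      · simp [hs0]
      · simp [hs0]
    · simp only [hs0]
      refine div_ne_zero (div_ne_zero hU hN'0) ?_
      simp
    · refine Eventually.of_forall fun w => ?_
      change joukowskyInv (s w) = _
      rw [joukowskyInv]
      nth_rewrite 1 [hs1]
      rw [mul_div_assoc]

/-! ### Normalization at the distinguished point -/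

/-- In the chart centred at `p` the kernel is `1 / w`, up to a sign. -/
lemma rKernel_sphereParam (p : RSphere) : ∃ ε : ℝ, ε ≠ 0 ∧
    ∀ w, rKernel (sphereParam p w) p = ε * w⁻¹ := by
  induction p using OnePoint.rec with
  | infty =>
    refine ⟨1, one_ne_zero, fun w => ?_⟩
    by_cases hw : w = 0 <;> simp [sphereParam_infty, hw, rKernel]
  | coe z =>
    refine ⟨-1, by simp, fun w => ?_⟩
    simp [rKernel, inv_neg]

/-- If `D xs` is positive and the leading value is not zero, then `xs` is a pole. -/
lemma denom_eq_zero_of_hasLeadingValue {D : RSphere →₀ ℕ} {xs : RSphere} {F : RatFunc ℂ}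
    {L : ℂ} (hL : L ≠ 0) (hlim : HasLeadingValue D xs F L) (hd : D xs ≠ 0) :
    homEval (ratDegree F) F.denom xs = 0 := by
  by_contra h1
  have hft := (continuousAt_affineCoord_ratValue h1).tendsto.mono_left
    (nhdsWithin_le_nhds (s := {xs}ᶜ))
  obtain ⟨ε, hε, hr⟩ := rKernel_sphereParam xs
  have h3 : Tendsto (fun x => affineCoord (ratValue F x) / rKernel x xs ^ D xs) (𝓝[≠] xs)
      (𝓝 0) := by
    rw [tendsto_sphere_nhdsNE_iff] at hft ⊢
    have h4 : Tendsto (fun w : ℂ => (w / ε) ^ D xs) (𝓝[≠] 0) (𝓝 0) := by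
      have : Continuous (fun w : ℂ => (w / ε) ^ D xs) := by fun_prop
      have h5 := this.tendsto 0
      rw [zero_div, zero_pow hd] at h5
      exact h5.mono_left nhdsWithin_le_nhds
    have h5 := hft.mul h4
    rw [mul_zero] at h5
    refine h5.congr fun w => ?_
    rw [hr, div_eq_mul_inv _ ((ε * w⁻¹ : ℂ) ^ D xs), ← inv_pow, mul_inv, inv_inv, div_eq_inv_mul]
  exact hL (tendsto_nhds_unique h3 hlim).symm

lemma notMem_extensionSet_of_hasLeadingValue {D : RSphere →₀ ℕ} {xs : RSphere} {F : RatFunc ℂ}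
    {L : ℝ} (hL : 0 < L) (hL1 : D xs = 0 → 1 < L)
    (hlim : HasLeadingValue D xs F L) : xs ∉ extensionSet F := by
  intro hK
  obtain ⟨h1, t, ht, h2⟩ := exists_ratValue_of_mem_extensionSet hK
  by_cases hd : D xs = 0
  · have hft := (continuousAt_affineCoord_ratValue h1).tendsto.mono_left
      (nhdsWithin_le_nhds (s := {xs}ᶜ))
    rw [affineCoord_ratValue, h2] at hft
    unfold HasLeadingValue at hlim
    simp only [hd, pow_zero, div_one] at hlim
    have h4 := tendsto_nhds_unique hft hlim
    have h5 : t = L := by exact_mod_cast h4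
    linarith [ht.2, hL1 hd]
  · exact h1 (denom_eq_zero_of_hasLeadingValue (by exact_mod_cast hL.ne') hlim hd)

/-- A positive leading value of `F` provides the normalization of `ratJoukowskyInv F`. -/
lemma exists_tendsto_ratJoukowskyInv {D : RSphere →₀ ℕ} {xs : RSphere} {F : RatFunc ℂ}
    {L : ℝ} (hL : 0 < L) (hL1 : D xs = 0 → 1 < L)
    (hlim : HasLeadingValue D xs F L) : ∃ l : ℝ, 0 < l ∧
      Tendsto (fun x => ratJoukowskyInv F x * rKernel x xs ^ D xs) (𝓝[≠] xs) (𝓝 (l : ℂ)) := by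
  have hK := notMem_extensionSet_of_hasLeadingValue hL hL1 hlim
  set s : RSphere → ℂ := fun q => (affineCoord (ratValue F q))⁻¹ with hs
  have hsc : ContinuousAt s xs := (sphereAnalyticAt_inv_ratValue hK).continuousAt
  -- the value of `s` at the distinguished point is `0` or `1 / L`
  have hs0 : ∃ a : ℝ, s xs = a ∧ 0 < 1 - a ^ 2 := by
    have hLC : (L : ℂ) ≠ 0 := by exact_mod_cast hL.ne'
    by_cases hd : D xs = 0
    · refine ⟨L⁻¹, ?_, ?_⟩
      · unfold HasLeadingValue at hlim
        simp only [hd, pow_zero, div_one] at hlim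
        have h4 := tendsto_nhds_unique (hsc.tendsto.mono_left nhdsWithin_le_nhds)
          (hlim.inv₀ hLC)
        rw [h4]
        push_cast
        rfl
      · have h5 := inv_lt_one_of_one_lt₀ (hL1 hd)
        have h6 := inv_pos.2 hL
        nlinarith
    · refine ⟨0, ?_, by norm_num⟩
      simp [hs, ratValue_of_denom_eq_zero (denom_eq_zero_of_hasLeadingValue hLC hlim hd)]
  obtain ⟨a, ha, ha1⟩ := hs0
  have h1 : Tendsto (fun x => (1 + (1 - s x ^ 2) ^ (2⁻¹ : ℂ))⁻¹) (𝓝[≠] xs)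
      (𝓝 (((1 + (1 - a ^ 2) ^ (2⁻¹ : ℝ))⁻¹ : ℝ) : ℂ)) := by
    have h2 : ContinuousAt (fun x => (1 - s x ^ 2) ^ (2⁻¹ : ℂ)) xs :=
      ContinuousAt.cpow (by fun_prop) continuousAt_const (by
        simp only [ha]
        left
        exact_mod_cast ha1)
    have h3 := h2.tendsto
    have h4 : (1 - s xs ^ 2) ^ (2⁻¹ : ℂ) = (((1 - a ^ 2) ^ (2⁻¹ : ℝ) : ℝ) : ℂ) := by
      rw [ha, Complex.ofReal_cpow ha1.le]
      push_cast
      rfl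
    rw [h4] at h3
    have h5 := Real.rpow_pos_of_pos ha1 2⁻¹
    have h6 := ((tendsto_const_nhds (x := (1 : ℂ))).add h3).inv₀ (by
      have : (1 + (1 - a ^ 2) ^ (2⁻¹ : ℝ) : ℝ) ≠ 0 := by positivity
      exact_mod_cast this)
    push_cast at h6 ⊢
    exact h6.mono_left nhdsWithin_le_nhds
  have h2 := (hlim.inv₀ (by exact_mod_cast hL.ne')).mul h1
  refine ⟨L⁻¹ * (1 + (1 - a ^ 2) ^ (2⁻¹ : ℝ))⁻¹, ?_, ?_⟩
  · have := Real.rpow_pos_of_pos ha1 2⁻¹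
    positivity
  · push_cast at h2 ⊢
    refine h2.congr fun x => ?_
    simp only [ratJoukowskyInv, joukowskyInv, hs]
    rw [inv_div, div_eq_mul_inv, div_eq_mul_inv]
    ring

/-! ### The linear system of a divisor -/

section LinearSystem

open Polynomial

/-- The form of degree one vanishing exactly at `c`. -/
def pointForm (c : RSphere) : ℂ[X] := c.elim 1 fun z => X - C z

@[simp] lemma pointForm_infty : pointForm ∞ = 1 := rfl

@[simp] lemma pointForm_coe (z : ℂ) : pointForm (z : RSphere) = X - C z := rfl

lemma natDegree_pointForm_le (c : RSphere) : (pointForm c).natDegree ≤ 1 := by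
  induction c using OnePoint.rec <;> simp

lemma pointForm_ne_zero (c : RSphere) : pointForm c ≠ 0 := by
  induction c using OnePoint.rec with
  | infty => simp
  | coe z => exact X_sub_C_ne_zero z

lemma homEval_pointForm_eq_zero_iff {c z : RSphere} : homEval 1 (pointForm c) z = 0 ↔ z = c := by
  induction c using OnePoint.rec with
  | infty =>
    induction z using OnePoint.rec with
    | infty => simp [coeff_one]
    | coe z => simp
  | coe c =>
    induction z using OnePoint.rec with
    | infty => simp
    | coe z => simp [sub_eq_zero]

lemma chartPoly_pointForm_self (c : RSphere) : chartPoly 1 c (pointForm c) = X := by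
  induction c using OnePoint.rec with
  | infty => simp [chartPoly_infty, reflect_one]
  | coe c => simp [chartPoly_coe]

/-- The degree of a divisor. -/
def divisorDegree (D : RSphere →₀ ℕ) : ℕ := ∑ c ∈ D.support, D c

/-- The form of degree `divisorDegree D` with zero divisor `D`. -/
def divisorForm (D : RSphere →₀ ℕ) : ℂ[X] := ∏ c ∈ D.support, pointForm c ^ D c

lemma natDegree_pointForm_pow_le (c : RSphere) (k : ℕ) : (pointForm c ^ k).natDegree ≤ k :=
  natDegree_pow_le.trans ((Nat.mul_le_mul_left _ (natDegree_pointForm_le c)).trans (by simp))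

lemma natDegree_prod_pointForm_le (D : RSphere → ℕ) (S : Finset RSphere) :
    (∏ c ∈ S, pointForm c ^ D c).natDegree ≤ ∑ c ∈ S, D c :=
  (natDegree_prod_le _ _).trans (Finset.sum_le_sum fun c _ => natDegree_pointForm_pow_le c (D c))

lemma chartPoly_zero_one (p : RSphere) : chartPoly 0 p (1 : ℂ[X]) = 1 := by
  induction p using OnePoint.rec with
  | infty => simp [chartPoly_infty, reflect_one]
  | coe c => simp [chartPoly_coe]

lemma chartPoly_pow_pointForm (p c : RSphere) (k : ℕ) :
    chartPoly k p (pointForm c ^ k) = chartPoly 1 p (pointForm c) ^ k := by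
  induction k with
  | zero => simp [chartPoly_zero_one]
  | succ k ih =>
    rw [pow_succ, chartPoly_mul (natDegree_pointForm_pow_le c k) (natDegree_pointForm_le c), ih,
      pow_succ]

lemma chartPoly_prod_pointForm (D : RSphere → ℕ) (S : Finset RSphere) (p : RSphere) :
    chartPoly (∑ c ∈ S, D c) p (∏ c ∈ S, pointForm c ^ D c) =
      ∏ c ∈ S, chartPoly 1 p (pointForm c) ^ D c := by
  classical
  induction S using Finset.induction_on with
  | empty => simp [chartPoly_zero_one]
  | insert a S ha ih =>
    rw [Finset.sum_insert ha, Finset.prod_insert ha, Finset.prod_insert ha,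
      chartPoly_mul (natDegree_pointForm_pow_le _ _) (natDegree_prod_pointForm_le _ _), ih,
      chartPoly_pow_pointForm]

lemma natDegree_divisorForm_le (D : RSphere →₀ ℕ) :
    (divisorForm D).natDegree ≤ divisorDegree D := natDegree_prod_pointForm_le D D.support

lemma divisorForm_ne_zero (D : RSphere →₀ ℕ) : divisorForm D ≠ 0 :=
  Finset.prod_ne_zero_iff.2 fun c _ => pow_ne_zero _ (pointForm_ne_zero c)

lemma homEval_divisorForm (D : RSphere →₀ ℕ) (p : RSphere) :
    homEval (divisorDegree D) (divisorForm D) p =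
      ∏ c ∈ D.support, homEval 1 (pointForm c) p ^ D c := by
  rw [← eval_chartPoly_zero, divisorDegree, divisorForm, chartPoly_prod_pointForm, eval_prod]
  simp

lemma homEval_divisorForm_ne_zero {D : RSphere →₀ ℕ} {p : RSphere} (hp : D p = 0) :
    homEval (divisorDegree D) (divisorForm D) p ≠ 0 := by
  rw [homEval_divisorForm, Finset.prod_ne_zero_iff]
  intro c hc
  refine pow_ne_zero _ ?_
  rw [Ne, homEval_pointForm_eq_zero_iff]
  rintro rfl
  exact (Finsupp.mem_support_iff.1 hc) hp

lemma natDegree_divisorForm (D : RSphere →₀ ℕ) :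
    (divisorForm D).natDegree + D ∞ = divisorDegree D := by
  classical
  rw [divisorForm, natDegree_prod _ _ fun c _ => pow_ne_zero _ (pointForm_ne_zero c), divisorDegree]
  by_cases h : ∞ ∈ D.support
  · rw [← Finset.sum_erase_add _ _ h, ← Finset.sum_erase_add _ (fun c => D c) h]
    congr 1
    simp only [pointForm_infty, one_pow, natDegree_one, add_zero]
    refine Finset.sum_congr rfl fun c hc => ?_
    induction c using OnePoint.rec with
    | infty => simp at hc
    | coe z => simp [natDegree_pow]
  · rw [Finsupp.notMem_support_iff.1 h, add_zero]
    refine Finset.sum_congr rfl fun c hc => ?_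
    induction c using OnePoint.rec with
    | infty => exact absurd hc h
    | coe z => simp [natDegree_pow]

lemma rootMultiplicity_divisorForm (D : RSphere →₀ ℕ) (a : ℂ) :
    (divisorForm D).rootMultiplicity a = D (a : RSphere) := by
  classical
  rw [← count_roots, divisorForm, roots_prod _ _ (divisorForm_ne_zero D), Multiset.count_bind]
  have h1 : ∀ c : RSphere, Multiset.count a (pointForm c ^ D c).roots =
      if c = (a : RSphere) then D c else 0 := by
    intro c
    induction c using OnePoint.rec with
    | infty => simp
    | coe z =>
      rw [pointForm_coe, roots_pow, roots_X_sub_C, Multiset.count_nsmul, Multiset.count_singleton]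
      by_cases h : a = z <;> simp [h, eq_comm]
  simp only [h1]
  change ∑ c ∈ D.support, _ = _
  rw [Finset.sum_ite_eq']
  simpa using fun h => h.symm

/-- The rational function `P / divisorForm D`. -/
def systemFun (D : RSphere →₀ ℕ) (P : ℂ[X]) : RatFunc ℂ :=
  algebraMap ℂ[X] (RatFunc ℂ) P / algebraMap ℂ[X] (RatFunc ℂ) (divisorForm D)

lemma num_mul_systemFun (D : RSphere →₀ ℕ) (P : ℂ[X]) :
    (systemFun D P).num * divisorForm D = P * (systemFun D P).denom :=
  (RatFunc.num_mul_eq_mul_denom_iff (divisorForm_ne_zero D)).2 rfl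

/-- Every element of `ℒ(D)` is of the form `P / divisorForm D`. -/
lemma exists_systemFun_eq {D : RSphere →₀ ℕ} {F : RatFunc ℂ} (hF : F ∈ divisorSpace D) :
    ∃ P : ℂ[X], P.natDegree ≤ divisorDegree D ∧ F = systemFun D P := by
  have hM := F.denom_ne_zero
  have h1 : F.denom ∣ divisorForm D := by
    rw [(IsAlgClosed.splits F.denom).dvd_iff_roots_le_roots hM (divisorForm_ne_zero D),
      Multiset.le_iff_count]
    intro a
    rw [count_roots, count_roots, rootMultiplicity_divisorForm]
    exact hF a
  obtain ⟨R, hR⟩ := h1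
  have hR0 : R ≠ 0 := by
    rintro rfl
    exact divisorForm_ne_zero D (by rw [hR, mul_zero])
  refine ⟨F.num * R, ?_, ?_⟩
  · have h2 := natDegree_divisorForm D
    have h3 : F.num.natDegree - F.denom.natDegree ≤ D ∞ := hF ∞
    rw [hR, natDegree_mul hM hR0] at h2
    have h4 := natDegree_mul_le (p := F.num) (q := R)
    omega
  · refine (RatFunc.num_mul_eq_mul_denom_iff (divisorForm_ne_zero D)).1 ?_
    rw [hR]
    ring

lemma systemFun_mem_divisorSpace {D : RSphere →₀ ℕ} {P : ℂ[X]}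
    (hP : P.natDegree ≤ divisorDegree D) : systemFun D P ∈ divisorSpace D := by
  set F := systemFun D P with hF
  have h1 : F.num * divisorForm D = P * F.denom := num_mul_systemFun D P
  have hM := F.denom_ne_zero
  intro c
  induction c using OnePoint.rec with
  | infty =>
    change F.num.natDegree - F.denom.natDegree ≤ _
    by_cases hN : F.num = 0
    · simp [hN]
    have hP0 : P ≠ 0 := by
      rintro rfl
      rw [zero_mul] at h1
      exact mul_ne_zero hN (divisorForm_ne_zero D) h1
    have h2 := congrArg natDegree h1
    rw [natDegree_mul hN (divisorForm_ne_zero D), natDegree_mul hP0 hM] at h2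
    have h3 := natDegree_divisorForm D
    omega
  | coe a =>
    change F.denom.rootMultiplicity a ≤ _
    rw [← rootMultiplicity_divisorForm]
    refine rootMultiplicity_le_rootMultiplicity_of_dvd (divisorForm_ne_zero D) ?_ a
    refine F.isCoprime_num_denom.symm.dvd_of_dvd_mul_left ?_
    rw [h1]
    exact dvd_mul_left _ _

/-- The value at a point outside the support of `D` of `P / divisorForm D`. -/
def systemVal (D : RSphere →₀ ℕ) (P : ℂ[X]) (z : RSphere) : ℂ :=
  homEval (divisorDegree D) P z / homEval (divisorDegree D) (divisorForm D) z

lemma ratValue_systemFun {D : RSphere →₀ ℕ} {P : ℂ[X]} (hP : P.natDegree ≤ divisorDegree D)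
    {z : RSphere} (hz : D z = 0) : ratValue (systemFun D P) z = (systemVal D P z : RSphere) :=
  ratValue_eq_homEval_div hP (natDegree_divisorForm_le D) (num_mul_systemFun D P)
    (homEval_divisorForm_ne_zero hz)

lemma continuousAt_systemVal {D : RSphere →₀ ℕ} {P : ℂ[X]} (hP : P.natDegree ≤ divisorDegree D)
    {z : RSphere} (hz : D z = 0) : ContinuousAt (systemVal D P) z :=
  (sphereAnalyticAt_homEval_div hP (natDegree_divisorForm_le D)
    (homEval_divisorForm_ne_zero hz)).continuousAt

lemma systemVal_add (D : RSphere →₀ ℕ) (P Q : ℂ[X]) (z : RSphere) :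
    systemVal D (P + Q) z = systemVal D P z + systemVal D Q z := by
  simp [systemVal, add_div]

lemma systemVal_sub (D : RSphere →₀ ℕ) (P Q : ℂ[X]) (z : RSphere) :
    systemVal D (P - Q) z = systemVal D P z - systemVal D Q z := by
  simp [systemVal, sub_div]

lemma systemVal_C_mul (D : RSphere →₀ ℕ) (a : ℂ) (P : ℂ[X]) (z : RSphere) :
    systemVal D (C a * P) z = a * systemVal D P z := by
  simp [systemVal, mul_div_assoc]

lemma systemVal_divisorForm {D : RSphere →₀ ℕ} {z : RSphere} (hz : D z = 0) :
    systemVal D (divisorForm D) z = 1 := div_self (homEval_divisorForm_ne_zero hz)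

lemma supNormLeOne_systemFun {E : Set RSphere} {D : RSphere →₀ ℕ} (hD : ∀ x ∈ E, D x = 0)
    {P : ℂ[X]} (hP : P.natDegree ≤ divisorDegree D) :
    SupNormLeOne E (systemFun D P) ↔ ∀ x ∈ E, ‖systemVal D P x‖ ≤ 1 := by
  refine forall₂_congr fun x hx => ?_
  rw [ratValue_systemFun hP (hD x hx)]
  constructor
  · rintro ⟨w, h, hw⟩
    rwa [OnePoint.coe_injective h]
  · exact fun h => ⟨_, rfl, h⟩

/-! ### Real forms -/

lemma mem_extendedReals_iff {z : RSphere} :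
    z ∈ extendedReals ↔ z = ∞ ∨ ∃ x : ℝ, z = ((x : ℂ) : RSphere) := by
  constructor
  · rintro ⟨x, rfl⟩
    induction x using OnePoint.rec with
    | infty => exact Or.inl rfl
    | coe x => exact Or.inr ⟨x, rfl⟩
  · rintro (rfl | ⟨x, rfl⟩)
    · exact ⟨∞, rfl⟩
    · exact ⟨(x : OnePoint ℝ), rfl⟩

lemma homEval_map_conj (k : ℕ) (P : ℂ[X]) {z : RSphere} (hz : z ∈ extendedReals) :
    homEval k (P.map (starRingEnd ℂ)) z = starRingEnd ℂ (homEval k P z) := by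
  rcases mem_extendedReals_iff.1 hz with rfl | ⟨x, rfl⟩
  · simp
  · rw [homEval_coe, homEval_coe, ← eval_map_apply, Complex.conj_ofReal]

lemma map_conj_pointForm {c : RSphere} (hc : c ∈ extendedReals) :
    (pointForm c).map (starRingEnd ℂ) = pointForm c := by
  rcases mem_extendedReals_iff.1 hc with rfl | ⟨x, rfl⟩
  · simp
  · simp

lemma map_conj_divisorForm {D : RSphere →₀ ℕ} (hD : ∀ c, D c ≠ 0 → c ∈ extendedReals) :
    (divisorForm D).map (starRingEnd ℂ) = divisorForm D := by
  rw [divisorForm, Polynomial.map_prod]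
  refine Finset.prod_congr rfl fun c hc => ?_
  rw [Polynomial.map_pow, map_conj_pointForm (hD c (Finsupp.mem_support_iff.1 hc))]

lemma systemVal_map_conj {D : RSphere →₀ ℕ} (hD : ∀ c, D c ≠ 0 → c ∈ extendedReals) (P : ℂ[X])
    {z : RSphere} (hz : z ∈ extendedReals) :
    systemVal D (P.map (starRingEnd ℂ)) z = starRingEnd ℂ (systemVal D P z) := by
  rw [systemVal, systemVal, map_div₀, ← homEval_map_conj _ _ hz, ← homEval_map_conj _ _ hz,
    map_conj_divisorForm hD]

/-! ### The leading value -/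

/-- The nonzero real constant relating the leading value of `P / divisorForm D` at `xs` to the value
of the form `P` at `xs`. -/
lemma exists_hasLeadingValue {D : RSphere →₀ ℕ} (hD : ∀ c, D c ≠ 0 → c ∈ extendedReals)
    {xs : RSphere} (hxs : xs ∈ extendedReals) :
    ∃ κ : ℝ, κ ≠ 0 ∧
      (D xs = 0 → (κ : ℂ) = homEval (divisorDegree D) (divisorForm D) xs) ∧
      ∀ P : ℂ[X], P.natDegree ≤ divisorDegree D →
        HasLeadingValue D xs (systemFun D P) (homEval (divisorDegree D) P xs / κ) := by
  classical
  obtain ⟨ε, hε, hr⟩ := rKernel_sphereParam xs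
  set U : ℂ[X] := ∏ c ∈ D.support.erase xs, chartPoly 1 xs (pointForm c) ^ D c with hU
  have hfac : chartPoly (divisorDegree D) xs (divisorForm D) = X ^ D xs * U := by
    rw [divisorDegree, divisorForm, chartPoly_prod_pointForm]
    by_cases h : xs ∈ D.support
    · rw [← Finset.mul_prod_erase _ _ h, chartPoly_pointForm_self]
    · rw [Finsupp.notMem_support_iff.1 h, pow_zero, one_mul, hU, Finset.erase_eq_of_notMem h]
  have hU0 : U.eval 0 = ∏ c ∈ D.support.erase xs, homEval 1 (pointForm c) xs ^ D c := by
    rw [hU, eval_prod]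
    simp
  have hUne : U.eval 0 ≠ 0 := by
    rw [hU0, Finset.prod_ne_zero_iff]
    intro c hc
    refine pow_ne_zero _ ?_
    rw [Ne, homEval_pointForm_eq_zero_iff]
    exact (Finset.ne_of_mem_erase hc).symm
  obtain ⟨u, hu⟩ : ∃ u : ℝ, U.eval 0 = u := by
    refine Complex.conj_eq_iff_real.1 ?_
    rw [hU0, map_prod]
    refine Finset.prod_congr rfl fun c hc => ?_
    rw [map_pow, ← homEval_map_conj _ _ hxs, map_conj_pointForm
      (hD c (Finsupp.mem_support_iff.1 (Finset.mem_of_mem_erase hc)))]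
  have hu0 : u ≠ 0 := by
    rintro rfl
    exact hUne (by simpa using hu)
  refine ⟨u * ε ^ D xs, mul_ne_zero hu0 (pow_ne_zero _ hε), ?_, ?_⟩
  · intro h0
    rw [← eval_chartPoly_zero, hfac, h0]
    simp [hu]
  · intro P hP
    unfold HasLeadingValue
    rw [tendsto_sphere_nhdsNE_iff]
    obtain ⟨σ, hσ, hev⟩ := exists_homEval_sphereParam (divisorDegree D) xs
    set p := chartPoly (divisorDegree D) xs P with hp
    have h1 : Tendsto (fun w => p.eval w / (U.eval w * (ε : ℂ) ^ D xs)) (𝓝[≠] 0)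
        (𝓝 (homEval (divisorDegree D) P xs / ((u * ε ^ D xs : ℝ) : ℂ))) := by
      have h2 : ContinuousAt (fun w => p.eval w / (U.eval w * (ε : ℂ) ^ D xs)) 0 := by
        refine ContinuousAt.div p.continuous.continuousAt
          (U.continuous.continuousAt.mul continuousAt_const) ?_
        exact mul_ne_zero hUne (pow_ne_zero _ (by exact_mod_cast hε))
      have h3 := h2.tendsto
      rw [hp, eval_chartPoly_zero, hu] at h3
      push_cast
      exact h3.mono_left nhdsWithin_le_nhds
    refine h1.congr' ?_
    have h4 : ∀ᶠ w in 𝓝[≠] (0 : ℂ), U.eval w ≠ 0 :=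
      nhdsWithin_le_nhds (U.continuous.continuousAt.eventually_ne hUne)
    filter_upwards [h4, self_mem_nhdsWithin] with w hw hw0
    have hw0' : w ≠ 0 := hw0
    have h5 : homEval (divisorDegree D) (divisorForm D) (sphereParam xs w) ≠ 0 := by
      rw [hev _ (natDegree_divisorForm_le D), hfac]
      simp [hσ w, hw, hw0']
    rw [ratValue_eq_homEval_div hP (natDegree_divisorForm_le D) (num_mul_systemFun D P) h5,
      affineCoord_coe, hev _ (natDegree_divisorForm_le D), hev _ hP,
      mul_div_mul_left _ _ (hσ w), hfac, hr, ← hp]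
    simp only [Polynomial.eval_mul, Polynomial.eval_pow, eval_X, mul_pow, inv_pow]
    have hεC : (ε : ℂ) ≠ 0 := by exact_mod_cast hε
    field_simp

end LinearSystem

/-! ### Variations of extremal functions -/

/-- A variation `g` that is negative to first order where `‖f‖ = 1` preserves the bound `‖f‖ ≤ 1` on
a compact set. -/
lemma exists_norm_add_mul_le_one {X : Type*} [TopologicalSpace X] {E : Set X} (hE : IsCompact E)
    {f g : X → ℂ} (hf : ∀ x ∈ E, ContinuousAt f x) (hg : ∀ x ∈ E, ContinuousAt g x)
    (hf1 : ∀ x ∈ E, ‖f x‖ ≤ 1)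
    (hneg : ∀ x ∈ E, ‖f x‖ = 1 → (starRingEnd ℂ (f x) * g x).re < 0) :
    ∃ ε : ℝ, 0 < ε ∧ ∀ x ∈ E, ‖f x + ε * g x‖ ≤ 1 := by
  have key : ∀ᶠ ε : ℝ in 𝓝 0, ∀ x ∈ E, 0 < ε → ‖f x + ε * g x‖ ≤ 1 := by
    suffices h : ∀ᶠ ε : ℝ in 𝓝 0, ∀ x ∈ E, x ∈ E → 0 < ε → ‖f x + ε * g x‖ ≤ 1 from
      h.mono fun ε h x hx => h x hx hx
    refine hE.eventually_forall_of_forall_eventually (P := fun (ε : ℝ) x =>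
      x ∈ E → 0 < ε → ‖f x + ε * g x‖ ≤ 1) fun x hx => ?_
    have hfc : ContinuousAt (fun z : ℝ × X => f z.2) (0, x) :=
      ContinuousAt.comp (f := Prod.snd) (hf x hx) continuousAt_snd
    have hgc : ContinuousAt (fun z : ℝ × X => g z.2) (0, x) :=
      ContinuousAt.comp (f := Prod.snd) (hg x hx) continuousAt_snd
    rcases (hf1 x hx).lt_or_eq with h | h
    · have h1 : ContinuousAt (fun z : ℝ × X => ‖f z.2 + z.1 * g z.2‖) (0, x) := by fun_prop
      filter_upwards [h1.eventually_lt_const (u := 1) (by simpa using h)] with z hz _ _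
      exact hz.le
    · have h1 : ContinuousAt (fun z : ℝ × X => 2 * (starRingEnd ℂ (f z.2) * g z.2).re +
          z.1 * ‖g z.2‖ ^ 2) (0, x) := by
        have h2 : ContinuousAt (fun z : ℝ × X => starRingEnd ℂ (f z.2)) (0, x) :=
          Complex.continuous_conj.continuousAt.comp hfc
        have h3 : ContinuousAt (fun z : ℝ × X => (starRingEnd ℂ (f z.2) * g z.2).re) (0, x) :=
          Complex.continuous_re.continuousAt.comp (h2.mul hgc)
        fun_prop
      have h4 : 2 * (starRingEnd ℂ (f x) * g x).re + 0 * ‖g x‖ ^ 2 < 0 := by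
        linarith [hneg x hx h]
      filter_upwards [h1.eventually_lt_const h4] with z hz hzE hpos
      have h5 := hf1 z.2 hzE
      have h6 : ‖f z.2 + z.1 * g z.2‖ ^ 2 = ‖f z.2‖ ^ 2 +
          z.1 * (2 * (starRingEnd ℂ (f z.2) * g z.2).re + z.1 * ‖g z.2‖ ^ 2) := by
        simp only [Complex.sq_norm, Complex.normSq_apply]
        simp
        ring
      have h7 : z.1 * (2 * (starRingEnd ℂ (f z.2) * g z.2).re + z.1 * ‖g z.2‖ ^ 2) ≤ 0 :=
        mul_nonpos_of_nonneg_of_nonpos hpos.le hz.le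
      have h8 : ‖f z.2‖ ^ 2 ≤ 1 := pow_le_one₀ (norm_nonneg _) h5
      refine (sq_le_one_iff₀ (norm_nonneg _)).1 ?_
      linarith
  obtain ⟨ε, h1, h2⟩ := ((key.filter_mono nhdsWithin_le_nhds).and
    (self_mem_nhdsWithin (a := (0 : ℝ)) (s := Set.Ioi 0))).exists
  exact ⟨ε, h2, fun x hx => h1 x hx h2⟩

/-- A variation `g` that is nonpositive to first order where `‖f‖ = 1` becomes negative after adding
a small multiple of a correction `k` that is negative at the points of equality. -/
lemma exists_re_conj_mul_neg {X : Type*} [TopologicalSpace X] {E : Set X} (hE : IsCompact E)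
    {f g k : X → ℂ} (hf : ∀ x ∈ E, ContinuousAt f x) (hg : ∀ x ∈ E, ContinuousAt g x)
    (hk : ∀ x ∈ E, ContinuousAt k x)
    (hle : ∀ x ∈ E, ‖f x‖ = 1 → (starRingEnd ℂ (f x) * g x).re ≤ 0)
    (hlt : ∀ x ∈ E, ‖f x‖ = 1 → (starRingEnd ℂ (f x) * g x).re = 0 →
      (starRingEnd ℂ (f x) * k x).re < 0) :
    ∃ ε : ℝ, 0 < ε ∧ ∀ x ∈ E, ‖f x‖ = 1 → (starRingEnd ℂ (f x) * (g x + ε * k x)).re < 0 := by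
  have key : ∀ᶠ ε : ℝ in 𝓝 0, ∀ x ∈ E, x ∈ E → 0 < ε → ‖f x‖ = 1 →
      (starRingEnd ℂ (f x) * (g x + ε * k x)).re < 0 := by
    refine hE.eventually_forall_of_forall_eventually (P := fun (ε : ℝ) x =>
      x ∈ E → 0 < ε → ‖f x‖ = 1 → (starRingEnd ℂ (f x) * (g x + ε * k x)).re < 0) fun x hx => ?_
    have hfc : ContinuousAt (fun z : ℝ × X => f z.2) (0, x) :=
      ContinuousAt.comp (f := Prod.snd) (hf x hx) continuousAt_snd
    have hgc : ContinuousAt (fun z : ℝ × X => g z.2) (0, x) :=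
      ContinuousAt.comp (f := Prod.snd) (hg x hx) continuousAt_snd
    have hkc : ContinuousAt (fun z : ℝ × X => k z.2) (0, x) :=
      ContinuousAt.comp (f := Prod.snd) (hk x hx) continuousAt_snd
    have hfc' : ContinuousAt (fun z : ℝ × X => starRingEnd ℂ (f z.2)) (0, x) :=
      Complex.continuous_conj.continuousAt.comp hfc
    by_cases h1 : ‖f x‖ = 1
    · rcases (hle x hx h1).lt_or_eq with h | h
      · have h2 : ContinuousAt (fun z : ℝ × X =>
            (starRingEnd ℂ (f z.2) * (g z.2 + z.1 * k z.2)).re) (0, x) := by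
          refine Complex.continuous_re.continuousAt.comp (hfc'.mul ?_)
          fun_prop
        filter_upwards [h2.eventually_lt_const (u := 0) (by simpa using h)] with z hz _ _ _
        exact hz
      · have h2 : ContinuousAt (fun z : ℝ × X => (starRingEnd ℂ (f z.2) * k z.2).re) (0, x) :=
          Complex.continuous_re.continuousAt.comp (hfc'.mul hkc)
        filter_upwards [h2.eventually_lt_const (u := 0) (hlt x hx h1 h)] with z hz hzE hpos hz1
        have h3 := hle z.2 hzE hz1
        have h4 : (starRingEnd ℂ (f z.2) * (g z.2 + z.1 * k z.2)).re =
            (starRingEnd ℂ (f z.2) * g z.2).re + z.1 * (starRingEnd ℂ (f z.2) * k z.2).re := by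
          simp
          ring
        rw [h4]
        have := mul_neg_of_pos_of_neg hpos hz
        linarith
    · filter_upwards [hfc.norm.eventually_ne h1] with z hz _ _ hz1
      exact absurd hz1 hz
  obtain ⟨ε, h1, h2⟩ := ((key.filter_mono nhdsWithin_le_nhds).and
    (self_mem_nhdsWithin (a := (0 : ℝ)) (s := Set.Ioi 0))).exists
  exact ⟨ε, h2, fun x hx => h1 x hx hx h2⟩

section Extremal

open Polynomial

/-- Zeros of a form at `xs` can be moved elsewhere. -/
lemma exists_form_ne_zero_at {n : ℕ} {R : ℂ[X]} (hR : R ≠ 0) (hRn : R.natDegree ≤ n)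
    (xs : RSphere) : ∃ H : ℂ[X], H.natDegree ≤ n ∧ homEval n H xs ≠ 0 ∧
      ∀ x ≠ xs, homEval n R x = 0 → homEval n H x = 0 := by
  induction xs using OnePoint.rec with
  | infty =>
    refine ⟨R * X ^ (n - R.natDegree), ?_, ?_, ?_⟩
    · rw [natDegree_mul_X_pow _ hR]
      omega
    · rw [homEval_infty]
      have h : n = R.natDegree + (n - R.natDegree) := by omega
      conv_lhs => rw [h]
      rw [add_tsub_cancel_left, coeff_mul_X_pow]
      exact leadingCoeff_ne_zero.2 hR
    · intro x hx h
      induction x using OnePoint.rec with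
      | infty => exact absurd rfl hx
      | coe x =>
        rw [homEval_coe] at h
        simp [h]
  | coe a =>
    obtain ⟨q, hq, hdvd⟩ := exists_eq_pow_rootMultiplicity_mul_and_not_dvd R hR a
    set k := R.rootMultiplicity a
    have hq0 : q ≠ 0 := by
      rintro rfl
      exact hdvd (dvd_zero _)
    have hdeg : ((X - C (a + 1)) ^ k * q).natDegree = R.natDegree := by
      rw [hq, natDegree_mul (pow_ne_zero _ (X_sub_C_ne_zero _)) hq0,
        natDegree_mul (pow_ne_zero _ (X_sub_C_ne_zero _)) hq0, natDegree_pow, natDegree_pow,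
        natDegree_X_sub_C, natDegree_X_sub_C]
    refine ⟨(X - C (a + 1)) ^ k * q, hdeg.trans_le hRn, ?_, ?_⟩
    · rw [dvd_iff_isRoot, IsRoot] at hdvd
      simp [hdvd]
    · intro x hx h
      induction x using OnePoint.rec with
      | infty =>
        rw [homEval_infty] at h ⊢
        refine coeff_eq_zero_of_natDegree_lt ?_
        rw [hdeg]
        refine lt_of_le_of_ne hRn ?_
        rintro rfl
        exact hR (leadingCoeff_eq_zero.1 h)
      | coe x =>
        have hxa : x ≠ a := fun h => hx (by rw [h])
        rw [homEval_coe, hq, eval_mul, eval_pow] at h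
        have h1 := (mul_eq_zero.1 h).resolve_left (pow_ne_zero _ (by simpa [sub_eq_zero] using hxa))
        simp [h1]

/-- `P / divisorForm D` is extremal: among the forms `H` of degree `divisorDegree D` for which
`H / divisorForm D` is bounded by one on `E`, the form `P` maximises the real part of the value at
`xs`, divided by the real number `κ`. -/
structure IsExtremalForm (E : Set RSphere) (D : RSphere →₀ ℕ) (xs : RSphere) (κ : ℝ)
    (P : ℂ[X]) : Prop where
  natDegree_le : P.natDegree ≤ divisorDegree D
  norm_le : ∀ x ∈ E, ‖systemVal D P x‖ ≤ 1
  le : ∀ H : ℂ[X], H.natDegree ≤ divisorDegree D → (∀ x ∈ E, ‖systemVal D H x‖ ≤ 1) →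
    (homEval (divisorDegree D) H xs / κ).re ≤ (homEval (divisorDegree D) P xs / κ).re

variable {E : Set RSphere} {D : RSphere →₀ ℕ} {xs : RSphere} {κ : ℝ} {P : ℂ[X]}

/-- The first-order optimality condition: a variation `h` of an extremal function that does not
increase its modulus to first order at the points of `E` where the modulus is one, with equality
only at zeros of a nonzero form `R`, decreases the extremal functional. -/
lemma IsExtremalForm.re_neg (hP : IsExtremalForm E D xs κ P) (hE : IsCompact E) (hxs : xs ∉ E)
    (hD : ∀ x ∈ E, D x = 0) (hκ : κ ≠ 0) {R h : ℂ[X]} (hR : R ≠ 0)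
    (hRn : R.natDegree ≤ divisorDegree D) (hhn : h.natDegree ≤ divisorDegree D)
    (hle : ∀ x ∈ E, ‖systemVal D P x‖ = 1 →
      (starRingEnd ℂ (systemVal D P x) * systemVal D h x).re ≤ 0)
    (heq : ∀ x ∈ E, ‖systemVal D P x‖ = 1 →
      (starRingEnd ℂ (systemVal D P x) * systemVal D h x).re = 0 → systemVal D R x = 0) :
    (homEval (divisorDegree D) h xs / κ).re < 0 := by
  by_contra! hcon
  have hκC : (κ : ℂ) ≠ 0 := by exact_mod_cast hκ
  obtain ⟨H₀, hH₀n, hH₀, hH₀R⟩ := exists_form_ne_zero_at hR hRn xs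
  set n := divisorDegree D with hn
  -- normalised so that the functional takes the value one
  set H : ℂ[X] := C (κ / homEval n H₀ xs) * H₀ with hH
  have hHn : H.natDegree ≤ n := (natDegree_C_mul_le _ _).trans hH₀n
  have hHxs : homEval n H xs / κ = 1 := by
    rw [hH, homEval_C_mul]
    field_simp
  obtain ⟨δ, hδ, hδ1⟩ : ∃ δ : ℝ, 0 < δ ∧ δ * (homEval n P xs / κ).re < 1 := by
    refine ⟨(1 + |(homEval n P xs / κ).re|)⁻¹, by positivity, ?_⟩
    rw [inv_mul_lt_iff₀ (by positivity), mul_one]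
    linarith [le_abs_self (homEval n P xs / κ).re]
  -- `K` still increases the functional, and it decreases the modulus at the zeros of `H`
  set K : ℂ[X] := H - C (δ : ℂ) * P with hK
  have hKn : K.natDegree ≤ n :=
    (natDegree_sub_le _ _).trans (max_le hHn ((natDegree_C_mul_le _ _).trans hP.natDegree_le))
  have hKxs : 0 < (homEval n K xs / κ).re := by
    rw [hK, homEval_sub, homEval_C_mul n (δ : ℂ) P, sub_div, hHxs, mul_div_assoc, Complex.sub_re,
      Complex.re_ofReal_mul, Complex.one_re]
    linarith
  have hc : ∀ {Q : ℂ[X]}, Q.natDegree ≤ n → ∀ x ∈ E, ContinuousAt (systemVal D Q) x :=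
    fun hQ x hx => continuousAt_systemVal hQ (hD x hx)
  obtain ⟨ε, hε, hneg⟩ := exists_re_conj_mul_neg hE (hc hP.natDegree_le) (hc hhn) (hc hKn) hle
    (fun x hx h1 h2 => by
      have h3 := heq x hx h1 h2
      have hne := homEval_divisorForm_ne_zero (hD x hx)
      rw [systemVal, div_eq_zero_iff] at h3
      have h4 := hH₀R x (fun h => hxs (h ▸ hx)) (h3.resolve_right hne)
      have h5 : systemVal D H x = 0 := by simp [systemVal, hH, h4, ← hn]
      rw [hK, systemVal_sub, systemVal_C_mul D (δ : ℂ) P, h5, zero_sub, mul_neg, mul_left_comm,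
        ← Complex.normSq_eq_conj_mul_self, Complex.normSq_eq_norm_sq, h1]
      simpa using hδ)
  set G : ℂ[X] := h + C (ε : ℂ) * K with hG
  have hGn : G.natDegree ≤ n :=
    natDegree_add_le_of_degree_le hhn ((natDegree_C_mul_le _ _).trans hKn)
  obtain ⟨η, hη, hbound⟩ := exists_norm_add_mul_le_one hE (hc hP.natDegree_le) (hc hGn) hP.norm_le
    (fun x hx h1 => by
      rw [hG, systemVal_add, systemVal_C_mul]
      exact hneg x hx h1)
  have hfin := hP.le (P + C (η : ℂ) * G)
    (natDegree_add_le_of_degree_le hP.natDegree_le ((natDegree_C_mul_le _ _).trans hGn))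
    (fun x hx => by
      rw [systemVal_add, systemVal_C_mul]
      exact hbound x hx)
  rw [← hn, homEval_add, homEval_C_mul, hG, homEval_add, homEval_C_mul, add_div, mul_div_assoc,
    add_div, mul_div_assoc, Complex.add_re, Complex.re_ofReal_mul, Complex.add_re,
    Complex.re_ofReal_mul] at hfin
  have h1 := mul_pos hη (add_pos_of_nonneg_of_pos hcon (mul_pos hε hKxs))
  linarith

/-- Extremal functions are unique: where the mean of two of them has modulus one on `E`, they agree,
so that the zero variation of the mean satisfies the optimality condition with `R` their difference. -/
lemma IsExtremalForm.unique {P' : ℂ[X]} (hP : IsExtremalForm E D xs κ P)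
    (hP' : IsExtremalForm E D xs κ P') (hE : IsCompact E) (hxs : xs ∉ E)
    (hD : ∀ x ∈ E, D x = 0) (hκ : κ ≠ 0) : P = P' := by
  by_contra hne
  set Q : ℂ[X] := C (1 / 2 : ℂ) * (P + P') with hQ
  have hQv : ∀ x, systemVal D Q x = 1 / 2 * (systemVal D P x + systemVal D P' x) := fun x => by
    rw [hQ, systemVal_C_mul, systemVal_add]
  have hpar : ∀ x ∈ E, ‖systemVal D Q x‖ ^ 2 ≤ 1 - ‖systemVal D (P - P') x‖ ^ 2 / 4 := by
    intro x hx
    have h1 : ‖systemVal D P x‖ ^ 2 ≤ 1 := pow_le_one₀ (norm_nonneg _) (hP.norm_le x hx)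
    have h2 : ‖systemVal D P' x‖ ^ 2 ≤ 1 := pow_le_one₀ (norm_nonneg _) (hP'.norm_le x hx)
    have h3 := parallelogram_law_with_norm ℝ (systemVal D P x) (systemVal D P' x)
    rw [hQv, systemVal_sub, norm_mul]
    norm_num [mul_pow]
    linarith
  have hQe : IsExtremalForm E D xs κ Q := by
    refine ⟨(natDegree_C_mul_le _ _).trans
      (natDegree_add_le_of_degree_le hP.natDegree_le hP'.natDegree_le), ?_, ?_⟩
    · intro x hx
      refine (sq_le_one_iff₀ (norm_nonneg _)).1 ((hpar x hx).trans ?_)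
      have := sq_nonneg ‖systemVal D (P - P') x‖
      linarith
    · intro H hH hH1
      have h1 := hP.le H hH hH1
      have h2 := hP'.le H hH hH1
      have h3 : homEval (divisorDegree D) Q xs / κ = ((1 / 2 : ℝ) : ℂ) *
          (homEval (divisorDegree D) P xs / κ + homEval (divisorDegree D) P' xs / κ) := by
        rw [hQ, homEval_C_mul, homEval_add]
        push_cast
        ring
      rw [h3, Complex.re_ofReal_mul, Complex.add_re]
      linarith
  have h := hQe.re_neg hE hxs hD hκ (R := P - P') (h := 0) (sub_ne_zero.2 hne)
    ((natDegree_sub_le _ _).trans (max_le hP.natDegree_le hP'.natDegree_le)) (by simp)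
    (fun x hx _ => by
      have : systemVal D 0 x = 0 := by simpa using systemVal_C_mul D 0 0 x
      simp [this])
    (fun x hx h1 _ => by
      have h2 := hpar x hx
      rw [h1] at h2
      have h3 : ‖systemVal D (P - P') x‖ ^ 2 = 0 :=
        le_antisymm (by linarith) (sq_nonneg _)
      simpa using h3)
  have h0 : homEval (divisorDegree D) 0 xs = 0 := by
    simpa using homEval_C_mul (divisorDegree D) 0 0 xs
  simp [h0] at h

/-- By uniqueness, the extremal function is real. -/
lemma IsExtremalForm.map_conj_eq (hP : IsExtremalForm E D xs κ P) (hE : IsCompact E)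
    (hEr : E ⊆ extendedReals) (hxs : xs ∈ extendedReals \ E)
    (hD : ∀ c, D c ≠ 0 → c ∈ extendedReals \ E) (hκ : κ ≠ 0) :
    P.map (starRingEnd ℂ) = P := by
  have hDr : ∀ c, D c ≠ 0 → c ∈ extendedReals := fun c hc => (hD c hc).1
  have hD0 : ∀ x ∈ E, D x = 0 := fun x hx => by
    by_contra h
    exact (hD x h).2 hx
  have hre : (homEval (divisorDegree D) (P.map (starRingEnd ℂ)) xs / κ).re =
      (homEval (divisorDegree D) P xs / κ).re := by
    rw [homEval_map_conj _ _ hxs.1]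
    conv_lhs => rw [← Complex.conj_ofReal κ, ← map_div₀, Complex.conj_re]
  have hP' : IsExtremalForm E D xs κ (P.map (starRingEnd ℂ)) := by
    refine ⟨natDegree_map_le.trans hP.natDegree_le, fun x hx => ?_, fun H hH hH1 => ?_⟩
    · rw [systemVal_map_conj hDr _ (hEr hx), RCLike.norm_conj]
      exact hP.norm_le x hx
    · rw [hre]
      exact hP.le H hH hH1
  exact hP'.unique hP hE hxs.2 hD0 hκ

/-- The leading value is positive, by the optimality condition for the variation `-P`. -/
lemma IsExtremalForm.re_pos (hP : IsExtremalForm E D xs κ P) (hE : IsCompact E) (hxs : xs ∉ E)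
    (hD : ∀ x ∈ E, D x = 0) (hκ : κ ≠ 0) : 0 < (homEval (divisorDegree D) P xs / κ).re := by
  have hv : ∀ x, systemVal D (C (-1) * P) x = -systemVal D P x := fun x => by
    rw [systemVal_C_mul, neg_one_mul]
  have hval : ∀ x, ‖systemVal D P x‖ = 1 →
      (starRingEnd ℂ (systemVal D P x) * systemVal D (C (-1) * P) x).re = -1 := by
    intro x hx
    rw [hv, mul_neg, ← Complex.normSq_eq_conj_mul_self, Complex.normSq_eq_norm_sq, hx]
    simp
  have h := hP.re_neg hE hxs hD hκ (R := 1) (h := C (-1) * P) one_ne_zero (by simp)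
    ((natDegree_C_mul_le _ _).trans hP.natDegree_le)
    (fun x hx h1 => by rw [hval x h1]; norm_num)
    (fun x hx h1 h2 => by rw [hval x h1] at h2; norm_num at h2)
  rw [homEval_C_mul, mul_div_assoc] at h
  simpa using h

/-- If the leading value is the value at `xs`, then it exceeds one, by the optimality condition for
the variation towards the constant function one. -/
lemma IsExtremalForm.one_lt_re (hP : IsExtremalForm E D xs κ P) (hE : IsCompact E) (hxs : xs ∉ E)
    (hD : ∀ x ∈ E, D x = 0) (hκ : κ ≠ 0)
    (hκxs : (κ : ℂ) = homEval (divisorDegree D) (divisorForm D) xs)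
    (hne : P ≠ divisorForm D) : 1 < (homEval (divisorDegree D) P xs / κ).re := by
  have hval : ∀ x ∈ E, ‖systemVal D P x‖ = 1 →
      (starRingEnd ℂ (systemVal D P x) * systemVal D (divisorForm D - P) x).re =
        (systemVal D P x).re - 1 := by
    intro x hx h1
    rw [systemVal_sub, systemVal_divisorForm (hD x hx), mul_sub, mul_one,
      ← Complex.normSq_eq_conj_mul_self, Complex.normSq_eq_norm_sq, h1]
    simp
  have hdeg : (divisorForm D - P).natDegree ≤ divisorDegree D :=
    (natDegree_sub_le _ _).trans (max_le (natDegree_divisorForm_le D) hP.natDegree_le)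
  have h := hP.re_neg hE hxs hD hκ (R := divisorForm D - P) (h := divisorForm D - P)
    (sub_ne_zero.2 hne.symm) hdeg hdeg
    (fun x hx h1 => by
      rw [hval x hx h1]
      have := Complex.re_le_norm (systemVal D P x)
      linarith)
    (fun x hx h1 h2 => by
      rw [hval x hx h1] at h2
      have h3 : (systemVal D P x).re = 1 := by linarith
      have h4 : systemVal D P x = 1 := by
        have h5 : Complex.normSq (systemVal D P x) = 1 := by
          rw [Complex.normSq_eq_norm_sq, h1, one_pow]
        rw [Complex.normSq_apply, h3] at h5
        refine Complex.ext (by simpa using h3) ?_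
        simpa using h5
      rw [systemVal_sub, systemVal_divisorForm (hD x hx), h4, sub_self])
  have hκC : (κ : ℂ) ≠ 0 := by exact_mod_cast hκ
  rw [homEval_sub, ← hκxs, sub_div, div_self hκC, Complex.sub_re, Complex.one_re] at h
  linarith

/-- A nonconstant extremal function takes values in `[-1, 1]` at real points only. Otherwise it
takes the value `t` at conjugate points `z`, `conj z`; moving these two zeros of
`P - t * divisorForm D` to a double zero at `xs`, with a minus sign, yields a
variation contradicting the optimality condition. -/
lemma IsExtremalForm.mem_extendedReals (hP : IsExtremalForm E D xs κ P) (hE : IsCompact E)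
    (hEr : E ⊆ extendedReals) (hxs : xs ∈ extendedReals \ E)
    (hD : ∀ c, D c ≠ 0 → c ∈ extendedReals \ E) (hκ : κ ≠ 0)
    (hne : ∀ a : ℂ, P ≠ C a * divisorForm D) {z : ℂ} {t : ℝ} (ht : t ∈ Set.Icc (-1) 1)
    (hz : P.eval z = t * (divisorForm D).eval z) : (z : RSphere) ∈ extendedReals := by
  by_contra hzr
  have hDr : ∀ c, D c ≠ 0 → c ∈ extendedReals := fun c hc => (hD c hc).1
  have hD0 : ∀ x ∈ E, D x = 0 := fun x hx => by
    by_contra h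
    exact (hD x h).2 hx
  have hconj := hP.map_conj_eq hE hEr hxs hD hκ
  set n := divisorDegree D with hn
  set z' : ℂ := starRingEnd ℂ z with hz'
  have hzz : z ≠ z' := by
    intro h
    obtain ⟨x, hx⟩ := Complex.conj_eq_iff_real.1 h.symm
    exact hzr (mem_extendedReals_iff.2 (Or.inr ⟨x, by rw [hx]⟩))
  set R : ℂ[X] := P - C (t : ℂ) * divisorForm D with hR
  have hR0 : R ≠ 0 := sub_ne_zero.2 (hne t)
  have hRn : R.natDegree ≤ n := (natDegree_sub_le _ _).trans
    (max_le hP.natDegree_le ((natDegree_C_mul_le _ _).trans (natDegree_divisorForm_le D)))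
  have hRz : R.eval z = 0 := by simp [hR, hz]
  have hRconj : R.map (starRingEnd ℂ) = R := by
    rw [hR, Polynomial.map_sub, hconj, Polynomial.map_mul, map_conj_divisorForm hDr, map_C,
      Complex.conj_ofReal]
  have hRz' : R.eval z' = 0 := by
    rw [← hRconj, hz', eval_map_apply, hRz, map_zero]
  have hdvd : (X - C z) * (X - C z') ∣ R :=
    IsCoprime.mul_dvd (isCoprime_X_sub_C_of_isUnit_sub (sub_ne_zero.2 hzz).isUnit)
      (dvd_iff_isRoot.2 hRz) (dvd_iff_isRoot.2 hRz')
  obtain ⟨S, hS⟩ := hdvd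
  have hS0 : S ≠ 0 := by
    rintro rfl
    exact hR0 (by rw [hS, mul_zero])
  have hWdeg : ((X - C z) * (X - C z')).natDegree = 2 := by
    rw [natDegree_mul (X_sub_C_ne_zero _) (X_sub_C_ne_zero _)]
    simp
  have hSn : 2 + S.natDegree ≤ n := by
    rw [hS, natDegree_mul (mul_ne_zero (X_sub_C_ne_zero _) (X_sub_C_ne_zero _)) hS0, hWdeg] at hRn
    exact hRn
  obtain ⟨m, hm⟩ : ∃ m, n = (1 + 1) + m := ⟨n - 2, by omega⟩
  have hSm : S.natDegree ≤ m := by omega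
  have hl := natDegree_pointForm_le xs
  set h : ℂ[X] := C (-1) * (pointForm xs * pointForm xs * S) with hh
  have hl2 : (pointForm xs * pointForm xs).natDegree ≤ 1 + 1 := natDegree_mul_le.trans (by omega)
  have hhn : h.natDegree ≤ n := by
    refine (natDegree_C_mul_le _ _).trans (natDegree_mul_le.trans ?_)
    omega
  have hhv : ∀ x, homEval n h x = -(homEval 1 (pointForm xs) x ^ 2 * homEval m S x) := by
    intro x
    rw [hh, homEval_C_mul, hm, homEval_mul hl2 hSm, homEval_mul hl hl]
    ring
  have hRv : ∀ x ∈ extendedReals, homEval n R x =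
      (‖homEval 1 (pointForm (z : RSphere)) x‖ ^ 2 : ℝ) * homEval m S x := by
    intro x hx
    have h1 : homEval 1 (X - C z') x =
        starRingEnd ℂ (homEval 1 (pointForm (z : RSphere)) x) := by
      rw [← homEval_map_conj _ _ hx]
      simp [hz']
    rw [hS, hm, homEval_mul (k := 1 + 1) hWdeg.le hSm, homEval_mul (by simp) (by simp), h1,
      ← pointForm_coe,
      ← Complex.normSq_eq_norm_sq, Complex.mul_conj]
  -- values at the points of `E`
  have hkey : ∀ x ∈ E, ‖systemVal D P x‖ = 1 → ∃ f w : ℝ, f ^ 2 = 1 ∧ 0 < w ∧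
      systemVal D P x = f ∧ systemVal D h x = ((-((f - t) * w) : ℝ) : ℂ) := by
    intro x hx h1
    have hxr := hEr hx
    obtain ⟨f, hf⟩ : ∃ f : ℝ, systemVal D P x = f := by
      refine Complex.conj_eq_iff_real.1 ?_
      rw [← systemVal_map_conj hDr _ hxr, hconj]
    obtain ⟨l, hl'⟩ : ∃ l : ℝ, homEval 1 (pointForm xs) x = l := by
      refine Complex.conj_eq_iff_real.1 ?_
      rw [← homEval_map_conj _ _ hxr, map_conj_pointForm hxs.1]
    have hl0 : l ≠ 0 := by
      rintro rfl
      rw [Complex.ofReal_zero, homEval_pointForm_eq_zero_iff] at hl'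
      exact hxs.2 (hl' ▸ hx)
    set ω := ‖homEval 1 (pointForm (z : RSphere)) x‖ with hω
    have hω0 : 0 < ω := by
      rw [hω, norm_pos_iff, Ne, homEval_pointForm_eq_zero_iff]
      rintro rfl
      exact hzr hxr
    have hωC : (ω : ℂ) ≠ 0 := by exact_mod_cast hω0.ne'
    refine ⟨f, l ^ 2 / ω ^ 2, ?_, by positivity, hf, ?_⟩
    · rw [hf, Complex.norm_real, Real.norm_eq_abs] at h1
      rw [← sq_abs, h1, one_pow]
    · have h2 : systemVal D R x = f - t := by
        rw [hR, systemVal_sub, systemVal_C_mul, systemVal_divisorForm (hD0 x hx), hf, mul_one]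
      rw [systemVal, hRv x hxr, ← hω] at h2
      rw [systemVal, hhv, hl']
      push_cast at h2 ⊢
      rw [← h2]
      field_simp
  have hfin := hP.re_neg hE hxs.2 hD0 hκ (R := R) (h := h) hR0 hRn hhn
    (fun x hx h1 => by
      obtain ⟨f, w, hf, hw, hPf, hhf⟩ := hkey x hx h1
      rw [hPf, hhf, Complex.conj_ofReal, ← Complex.ofReal_mul, Complex.ofReal_re]
      have h2 : f * -((f - t) * w) = -((1 - t * f) * w) := by linear_combination -w * hf
      rw [h2]
      have h3 : t * f ≤ 1 := by nlinarith [ht.1, ht.2, sq_nonneg (t - f)]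
      nlinarith)
    (fun x hx h1 h0 => by
      obtain ⟨f, w, hf, hw, hPf, hhf⟩ := hkey x hx h1
      rw [hPf, hhf, Complex.conj_ofReal, ← Complex.ofReal_mul, Complex.ofReal_re] at h0
      have h2 : f * -((f - t) * w) = -((1 - t * f) * w) := by linear_combination -w * hf
      rw [h2, neg_eq_zero] at h0
      have h3 := (mul_eq_zero.1 h0).resolve_right hw.ne'
      have h4 : t = f := by linear_combination (-f) * h3 - t * hf
      rw [hR, systemVal_sub, systemVal_C_mul, systemVal_divisorForm (hD0 x hx), hPf, h4]
      ring)
  have h0 : homEval n h xs = 0 := by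
    rw [hhv, homEval_pointForm_eq_zero_iff.2 rfl]
    ring
  simp [← hn, h0] at hfin

end Extremal

/-! ### Connectedness of the complement of a real set -/

lemma isPreconnected_half (s : ℝ) :
    IsPreconnected ((fun z : ℂ => (z : RSphere)) '' {z : ℂ | 0 < s * z.im}) := by
  refine IsPreconnected.image ?_ _ OnePoint.continuous_coe.continuousOn
  refine (convex_halfSpace_gt (f := fun z : ℂ => s * z.im) ⟨fun x y => ?_, fun c x => ?_⟩
    0).isPreconnected
  · rw [Complex.add_im, mul_add]
  · rw [Complex.smul_im, smul_eq_mul, smul_eq_mul]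
    ring

lemma extendedReals_subset_closure_half {s : ℝ} (hs : s ≠ 0) :
    extendedReals ⊆ closure ((fun z : ℂ => (z : RSphere)) '' {z : ℂ | 0 < s * z.im}) := by
  intro p hp
  have hss : 0 < s * s := mul_self_pos.2 hs
  obtain ⟨v, hv⟩ : ∃ v : ℂ, ∀ t : ℝ, 0 < t →
      sphereParam p (t * v) ∈ (fun z : ℂ => (z : RSphere)) '' {z : ℂ | 0 < s * z.im} := by
    rcases mem_extendedReals_iff.1 hp with rfl | ⟨x, rfl⟩
    · refine ⟨(s * Complex.I)⁻¹, fun t ht => ⟨((t * (s * Complex.I)⁻¹ : ℂ))⁻¹, ?_, ?_⟩⟩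
      · have h : ((t * (s * Complex.I)⁻¹ : ℂ))⁻¹ = ((t⁻¹ * s : ℝ) : ℂ) * Complex.I := by
          push_cast
          rw [mul_inv, inv_inv]
          ring
        rw [Set.mem_ofPred_eq, h, Complex.im_ofReal_mul, Complex.I_im, mul_one]
        have := mul_pos (inv_pos.2 ht) hss
        nlinarith
      · refine (sphereParam_infty_of_ne ?_).symm
        refine mul_ne_zero (by exact_mod_cast ht.ne')
          (inv_ne_zero (mul_ne_zero ?_ Complex.I_ne_zero))
        exact_mod_cast hs
    · refine ⟨s * Complex.I, fun t ht => ⟨x + t * (s * Complex.I), ?_, rfl⟩⟩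
      have := mul_pos ht hss
      simp
      nlinarith
  have hlim : Tendsto (fun t : ℝ => sphereParam p (t * v)) (𝓝[>] 0) (𝓝 p) := by
    have h1 : Continuous fun t : ℝ => sphereParam p (t * v) :=
      (continuous_sphereParam p).comp (by fun_prop)
    have h2 := h1.tendsto 0
    simp only [Complex.ofReal_zero, zero_mul, sphereParam_zero] at h2
    exact h2.mono_left nhdsWithin_le_nhds
  refine mem_closure_of_tendsto hlim ?_
  filter_upwards [self_mem_nhdsWithin] with t ht
  exact hv t ht

/-- The complement of a proper subset of the extended real line is connected: the two half planes
are joined through any real point of the complement. -/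
lemma isPreconnected_compl_of_subset_extendedReals {K : Set RSphere} (hK : K ⊆ extendedReals)
    {p : RSphere} (hp : p ∈ extendedReals) (hpK : p ∉ K) : IsPreconnected Kᶜ := by
  have hT : ∀ s : ℝ, s ≠ 0 → IsPreconnected
      ((fun z : ℂ => (z : RSphere)) '' {z : ℂ | 0 < s * z.im} ∪ (extendedReals \ K)) := fun s hs =>
    (isPreconnected_half s).subset_closure Set.subset_union_left
      (Set.union_subset subset_closure
        (Set.sdiff_subset.trans (extendedReals_subset_closure_half hs)))
  have h := IsPreconnected.union p (Or.inr ⟨hp, hpK⟩) (Or.inr ⟨hp, hpK⟩) (hT 1 one_ne_zero)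
    (hT (-1) (by norm_num))
  have hnr : ∀ z : ℂ, z.im ≠ 0 → (z : RSphere) ∉ K := by
    intro z hz hzK
    rcases mem_extendedReals_iff.1 (hK hzK) with h | ⟨x, hx⟩
    · exact OnePoint.coe_ne_infty _ h
    · rw [OnePoint.coe_injective hx] at hz
      simp at hz
  convert h using 1
  ext z
  constructor
  · intro hz
    induction z using OnePoint.rec with
    | infty => exact Or.inl (Or.inr ⟨mem_extendedReals_iff.2 (Or.inl rfl), hz⟩)
    | coe z =>
      rcases lt_trichotomy z.im 0 with h | h | h
      · exact Or.inr (Or.inl ⟨z, by simpa using h, rfl⟩)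
      · refine Or.inl (Or.inr ⟨mem_extendedReals_iff.2 (Or.inr ⟨z.re, ?_⟩), hz⟩)
        congr 1
        exact Complex.ext rfl (by simp [h])
      · exact Or.inl (Or.inl ⟨z, by simpa using h, rfl⟩)
  · rintro ((⟨z, hz, rfl⟩ | hz) | (⟨z, hz, rfl⟩ | hz))
    · exact hnr z fun h => by simp [h] at hz
    · exact hz.2
    · exact hnr z fun h => by simp [h] at hz
    · exact hz.2

/-! ### Extremal functions -/

open Polynomial in
lemma systemFun_C_mul_divisorForm (D : RSphere →₀ ℕ) (a : ℂ) :
    systemFun D (C a * divisorForm D) = RatFunc.C a := by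
  have h : algebraMap ℂ[X] (RatFunc ℂ) (divisorForm D) ≠ 0 :=
    RatFunc.algebraMap_ne_zero (divisorForm_ne_zero D)
  rw [systemFun, map_mul, mul_div_cancel_right₀ _ h, RatFunc.algebraMap_C]

/-- A nonconstant extremal function has a positive leading value, which exceeds one when the divisor
vanishes at `xs`; the set where it takes values in `[-1, 1]` is nonempty and real. -/
lemma IsExtremalFunction.leadingValue_and_extensionSet {E : Set RSphere}
    (hE_real : E ⊆ extendedReals) (hE_compact : IsCompact E) (hE : E.Nonempty)
    {D : RSphere →₀ ℕ} (hD : ∀ c, D c ≠ 0 → c ∈ extendedReals \ E)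
    {xs : RSphere} (hxs : xs ∈ extendedReals \ E) {F : RatFunc ℂ}
    (hF : IsExtremalFunction E D xs F) (hF_nonconst : ∀ a : ℂ, F ≠ RatFunc.C a) :
    (∃ L : ℝ, 0 < L ∧ (D xs = 0 → 1 < L) ∧ HasLeadingValue D xs F L) ∧
      (extensionSet F).Nonempty ∧ extensionSet F ⊆ extendedReals := by
  have hDr : ∀ c, D c ≠ 0 → c ∈ extendedReals := fun c hc => (hD c hc).1
  have hD0 : ∀ x ∈ E, D x = 0 := fun x hx => by
    by_contra h
    exact (hD x h).2 hx
  obtain ⟨hFD, hF1, l, hl, hgreat⟩ := hF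
  obtain ⟨κ, hκ, hκxs, hlead⟩ := exists_hasLeadingValue hDr hxs.1
  obtain ⟨P, hPn, rfl⟩ := exists_systemFun_eq hFD
  have hlP : l = homEval (divisorDegree D) P xs / κ := tendsto_nhds_unique hl (hlead P hPn)
  have hP : IsExtremalForm E D xs κ P := by
    refine ⟨hPn, (supNormLeOne_systemFun hD0 hPn).1 hF1, fun H hHn hH1 => ?_⟩
    rw [← hlP]
    exact hgreat.2 ⟨systemFun D H, systemFun_mem_divisorSpace hHn,
      (supNormLeOne_systemFun hD0 hHn).2 hH1, _, hlead H hHn, rfl⟩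
  have hne : ∀ a : ℂ, P ≠ Polynomial.C a * divisorForm D := fun a h =>
    hF_nonconst a (by rw [h, systemFun_C_mul_divisorForm])
  have hconj := hP.map_conj_eq hE_compact hE_real hxs hD hκ
  have hreal : homEval (divisorDegree D) P xs / κ =
      ((homEval (divisorDegree D) P xs / κ).re : ℂ) := by
    refine (Complex.conj_eq_iff_re.1 ?_).symm
    rw [map_div₀, Complex.conj_ofReal, ← homEval_map_conj _ _ hxs.1, hconj]
  refine ⟨⟨(homEval (divisorDegree D) P xs / κ).re, hP.re_pos hE_compact hxs.2 hD0 hκ, fun h0 => ?_,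
    ?_⟩, ?_, ?_⟩
  · exact hP.one_lt_re hE_compact hxs.2 hD0 hκ (hκxs h0) (by simpa using hne 1)
  · rw [← hreal]
    exact hlead P hPn
  · obtain ⟨x, hx⟩ := hE
    obtain ⟨f, hf⟩ : ∃ f : ℝ, systemVal D P x = f := by
      refine Complex.conj_eq_iff_real.1 ?_
      rw [← systemVal_map_conj hDr _ (hE_real hx), hconj]
    refine ⟨x, f, ?_, by rw [ratValue_systemFun hPn (hD0 x hx), hf]⟩
    have h1 := hP.norm_le x hx
    rw [hf, Complex.norm_real] at h1
    exact abs_le.1 h1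
  · rintro z ⟨t, ht, hzt⟩
    by_cases hz : D z = 0
    · induction z using OnePoint.rec with
      | infty => exact mem_extendedReals_iff.2 (Or.inl rfl)
      | coe z =>
        rw [ratValue_systemFun hPn hz] at hzt
        have h1 : systemVal D P z = t := OnePoint.coe_injective hzt
        have h2 := homEval_divisorForm_ne_zero hz
        rw [systemVal, div_eq_iff h2] at h1
        exact hP.mem_extendedReals hE_compact hE_real hxs hD hκ hne ht h1
    · exact hDr z hz

end

theorem mainTheorem8
    (E : Set RSphere) (hE_real : E ⊆ extendedReals) (hE_compact : IsCompact E)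
    (hE_infinite : E.Infinite)
    (D : RSphere →₀ ℕ) (hD : ∀ c, D c ≠ 0 → c ∈ extendedReals \ E)
    (xs : RSphere) (hxs : xs ∈ extendedReals \ E)
    (F : RatFunc ℂ) (hF : IsExtremalFunction E D xs F)
    (hF_nonconst : ∀ a : ℂ, F ≠ RatFunc.C a) :
    ∃ B : RSphere → ℂ,
      (∀ z ∈ (extensionSet F)ᶜ, ∀ w : ℂ, IsGreenProductValue D xs F z w ↔ w = B z) ∧
      (∀ z ∈ (extensionSet F)ᶜ, SphereAnalyticAt B z) ∧
      (∀ z ∈ (extensionSet F)ᶜ, ratValue F z = joukowsky (B z)) := by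
  obtain ⟨⟨L, hL, hL1, hlim⟩, hKne, hKr⟩ := hF.leadingValue_and_extensionSet hE_real hE_compact
    hE_infinite.nonempty hD hxs hF_nonconst
  have hxsK := notMem_extensionSet_of_hasLeadingValue hL hL1 hlim
  obtain ⟨l, hl, hBlim⟩ := exists_tendsto_ratJoukowskyInv hL hL1 hlim
  have hmem : ∀ c, c ∈ D.support.filter (fun c => 0 < polarDivisor F c) ↔
      0 < polarDivisor F c := by
    intro c
    rw [Finset.mem_filter, Finsupp.mem_support_iff]
    exact ⟨fun h => h.2, fun h => ⟨(h.trans_le (hF.1 c)).ne', h⟩⟩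
  have hB := isProperToDisc_ratJoukowskyInv hmem
  refine ⟨ratJoukowskyInv F, fun z hz w => ?_, fun z hz => hB.analyticAt z hz,
    fun z hz => ratValue_eq_joukowsky hz⟩
  exact hB.isGreenProductValue_iff (isClosed_extensionSet F) hKne
    (isPreconnected_compl_of_subset_extendedReals hKr hxs.1 hxsK) hxsK (fun c hc => (hmem c).2 hc)
    hl hBlim hz w
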